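/- Let $n\ge 1$. A cube is a cube in $\mathbb R^n$ with sides parallel to the axes, and $Mf(x)=\sup_{Q\ni x}\frac1{|Q|}\int_Q|f|$ is the Hardy--Littlewood maximal function, the supremum being over all cubes containing $x$. A weight is a locally integrable function $w$ with $0<w<\infty$ a.e.; $w(E)=\int_E w$. For $q>1$, $A_q$ is the class of weights with $$[w]_{A_q}=\sup_Q\Big(\frac1{|Q|}\int_Q w\Big)\Big(\frac1{|Q|}\int_Q w^{1-q'}\Big)^{q-1}<\infty,\qquad \tfrac1q+\tfrac1{q'}=1,$$ $A_\infty=\bigcup_{q>1}A_q$, and $[w]_{A_\infty}=\sup_Q\frac1{w(Q)}\int_Q M(w\chi_Q)$. A weight $u$ is in $A_1$ if $Mu\le Cu$ a.e. for some finite $C$, and $[u]_{A_1}$ is the least such $C$. For $q\ge1$, $\widehat A_{q,2}$ is the class of weights $w$ that can be written a.e. as $w=u_0(Mh_1)^{\beta(1-q)}(Mh_2)^{(1-\beta)(1-q)}$ with $0\le\beta\le1$, $u_0\in A_1$, $h_1,h_2\in L^1_{loc}(\mathbb R^n)$, and $[w]_{\widehat A_{q,2}}$ is the infimum of $[u_0]_{A_1}^{1/q}$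 over all such representations. Finally $\|g\|_{L^{q,\infty}(W)}=\sup_{t>0}t\,W(\{|g|>t\})^{1/q}$. Let $\mathcal F$ be a family of pairs $(f_1,f_2)$ of measurable functions on $\mathbb R^n$ with values in $[0,\infty]$, let $0<p_0<\infty$, let $\varphi:[0,\infty)\to[0,\infty)$ be increasing (in the weak sense), and suppose that for every $w\in A_\infty$ $$\int_{\mathbb R^n} f_1^{p_0}\,w\,dx\le\varphi([w]_{A_\infty})\int_{\mathbb R^n} f_2^{p_0}\,w\,dx$$ for all $(f_1,f_2)\in\mathcal F$ for which the left-hand side is finite. Let $\mathcal F_0$ be the set of the pairs $(f_1,f_2)\in\mathcal F$ for which the left-hand side is finite for at least one $w\in A_\infty$ (for the other pairs nothing is assumed). Let $q\ge1$. (i) For every $u\in A_\infty$ and every $v$ with $v^q\in A_\infty$ there is a finite constant $C(u,v)$ such that $$\|f_1v^{-1}\|_{L^{q,\infty}(uv^q)}\le C(u,v)\,\|f_2v^{-1}\|_{L^{q,\infty}(uv^q)}\qquad\text{for all }(f_1,f_2)\in\mathcal F_0.$$ (ii) For every $\alpha>0$ there is an increasing function $\phi:[0,\infty)\to[0,\infty)$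 such that, whenever $u\in\widehat A_{q,2}$ and $v=(Mh)^{-\alpha}$ with $h\in L^1_{loc}(\mathbb R^n)$, the inequality in (i) holds for all $(f_1,f_2)\in\mathcal F_0$ with $C(u,v)=\phi([u]_{\widehat A_{q,2}})$; thus $\phi$ does not depend on $u$ or $h$. -/

import Mathlib

open MeasureTheory
open scoped ENNReal NNReal

namespace Muckenhoupt

noncomputable section

/-- The average of `f` over the cube with centre `c` and side length `2 * r`.
The norm on `Fin n → ℝ` is the sup norm, so `Metric.closedBall c r` with `0 < r` is exactly a closed
cube with sides parallel to the axes, and every such cube is of this form. -/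
def avg {n : ℕ} (c : Fin n → ℝ) (r : ℝ) (f : (Fin n → ℝ) → ℝ≥0∞) : ℝ≥0∞ :=
  (volume (Metric.closedBall c r))⁻¹ * ∫⁻ y in Metric.closedBall c r, f y

/-- The (uncentred) Hardy-Littlewood maximal function of a nonnegative function: the supremum of the
averages over all cubes that contain `x`. -/
def maximal {n : ℕ} (f : (Fin n → ℝ) → ℝ≥0∞) (x : Fin n → ℝ) : ℝ≥0∞ :=
  ⨆ (c : Fin n → ℝ) (r : ℝ) (_ : 0 < r) (_ : x ∈ Metric.closedBall c r), avg c r f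

/-- The Hardy-Littlewood maximal function of a real function. -/
def maximalReal {n : ℕ} (h : (Fin n → ℝ) → ℝ) : (Fin n → ℝ) → ℝ≥0∞ :=
  maximal fun y => ‖h y‖ₑ

/-- A weight: a (Lebesgue) measurable, locally integrable function with values in `(0, ∞)` almost
everywhere. -/
structure IsWeight {n : ℕ} (w : (Fin n → ℝ) → ℝ≥0∞) : Prop where
  aemeasurable : AEMeasurable w volume
  ae_pos : ∀ᵐ x, 0 < w x
  ae_lt_top : ∀ᵐ x, w x < ∞
  locally_integrable : ∀ (c : Fin n → ℝ) (r : ℝ), ∫⁻ y in Metric.closedBall c r, w y < ∞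

/-- The constant `[w]_{A_q}` for `1 < q`; here `1 - q'` is the exponent of the second factor, with
`q' = q / (q - 1)`. -/
def aqConst {n : ℕ} (q : ℝ) (w : (Fin n → ℝ) → ℝ≥0∞) : ℝ≥0∞ :=
  ⨆ (c : Fin n → ℝ) (r : ℝ) (_ : 0 < r),
    avg c r w * (avg c r fun y => w y ^ (1 - q / (q - 1))) ^ (q - 1)

/-- The class `A_q`, for `1 < q`. -/
def IsAq {n : ℕ} (q : ℝ) (w : (Fin n → ℝ) → ℝ≥0∞) : Prop :=
  IsWeight w ∧ aqConst q w < ∞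

/-- The class `A_∞`, the union of the classes `A_q` over `1 < q`. -/
def IsAInfty {n : ℕ} (w : (Fin n → ℝ) → ℝ≥0∞) : Prop :=
  ∃ q : ℝ, 1 < q ∧ IsAq q w

/-- The Fujii-Wilson constant `[w]_{A_∞}`. -/
def aInftyConst {n : ℕ} (w : (Fin n → ℝ) → ℝ≥0∞) : ℝ≥0∞ :=
  ⨆ (c : Fin n → ℝ) (r : ℝ) (_ : 0 < r),
    (∫⁻ y in Metric.closedBall c r, w y)⁻¹ *
      ∫⁻ x in Metric.closedBall c r, maximal ((Metric.closedBall c r).indicator w) x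

/-- The constant `[u]_{A_1}`: the least `C` with `M u ≤ C u` almost everywhere. -/
def a1Const {n : ℕ} (u : (Fin n → ℝ) → ℝ≥0∞) : ℝ≥0∞ :=
  sInf {C : ℝ≥0∞ | ∀ᵐ x, maximal u x ≤ C * u x}

/-- The class `A_1`. -/
def IsA1 {n : ℕ} (u : (Fin n → ℝ) → ℝ≥0∞) : Prop :=
  IsWeight u ∧ a1Const u < ∞

/-- `w = u₀ (M h₁)^{β (1 - q)} (M h₂)^{(1 - β) (1 - q)}` almost everywhere for some `0 ≤ β ≤ 1` and
some locally integrable `h₁`, `h₂`. -/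
def HatFactor {n : ℕ} (q : ℝ) (w u₀ : (Fin n → ℝ) → ℝ≥0∞) : Prop :=
  ∃ (β : ℝ) (h₁ h₂ : (Fin n → ℝ) → ℝ), 0 ≤ β ∧ β ≤ 1 ∧
    LocallyIntegrable h₁ volume ∧ LocallyIntegrable h₂ volume ∧
    ∀ᵐ x, w x = u₀ x * maximalReal h₁ x ^ (β * (1 - q)) * maximalReal h₂ x ^ ((1 - β) * (1 - q))

/-- The class `\widehat A_{q,2}`. -/
def IsHatA2 {n : ℕ} (q : ℝ) (w : (Fin n → ℝ) → ℝ≥0∞) : Prop :=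
  IsWeight w ∧ ∃ u₀ : (Fin n → ℝ) → ℝ≥0∞, IsA1 u₀ ∧ HatFactor q w u₀

/-- The constant `[w]_{\widehat A_{q,2}}`: the infimum of `[u₀]_{A_1}^{1/q}` over all factorizations
of `w` with `u₀ ∈ A_1`. -/
def hatA2Const {n : ℕ} (q : ℝ) (w : (Fin n → ℝ) → ℝ≥0∞) : ℝ≥0∞ :=
  ⨅ (u₀ : (Fin n → ℝ) → ℝ≥0∞) (_ : IsA1 u₀) (_ : HatFactor q w u₀), a1Const u₀ ^ (1 / q)

/-- The quasi-norm of a nonnegative function `g` in `L^{q,∞}(W)`: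
the supremum over `t > 0` of `t * W({g > t})^{1/q}`. -/
def weakNorm {n : ℕ} (q : ℝ) (W g : (Fin n → ℝ) → ℝ≥0∞) : ℝ≥0∞ :=
  ⨆ (t : ℝ≥0) (_ : 0 < t), (t : ℝ≥0∞) * (∫⁻ x in {x | (t : ℝ≥0∞) < g x}, W x) ^ (1 / q)

end

end Muckenhoupt

open Muckenhoupt

namespace Muckenhoupt
open Metric Filter Set
open scoped Topology

/-! ### Layer cake formulas for functions with values in `[0, ∞]` -/

/-! Both parts follow from one weak-type inequality for `u = u₀ ω₁^(-a)`, `v^q = v₀ ω₂^(-b)` with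
all four factors in `A_1`. In (i) the factors come from Jones' theorem (`Ap.exists_factorization`).
In (ii) they come from the definition of the class and the Coifman-Rochberg fact that, outside two
trivial cases, `(Mh)^(1/2)` is an `A_1` weight with a dimensional constant.

The product `W = u v^q` need not be locally integrable, so the hypothesis cannot be used with `W`
itself; it has to be fed another weight. It is first made flexible. `dominated_of_aInfty` removes
the finiteness proviso and replaces the Fujii-Wilson constant by `A_s` constants. Rubio de Francia
extrapolation (`Dominated.down`, `Dominated.up`) then gives the strong inequality for every exponent
`r > 0` and every `A_∞` weight.

For the weak inequality take `E ⊆ {f₁/v > t}` with `W(E) < ∞`. The Rubio de Francia algorithm for `g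
↦ M(g u₀)/u₀`, started at the characteristic function of `E`, produces `H` (`exists_majorant`). This
operator is bounded on `L^∞` since `u₀ ∈ A_1`, and on `L^P(W)` for a suitable large `P`. So `H ≥ 1`
on `E`, `H ≤ 2` a.e., `∫ H^P W ≤ 2^P W(E)` and `H u₀ ∈ A_1`. With `r = q(1-ε)`, the weight `H W
v^(-r)` is `H u₀ v₀^ε` times negative powers of `ω₁` and `ω₂`. For small `ε` the first factor is in
`A_1` by the reverse Hölder inequality (`exists_A1_mul_rpow`), so the weight lies in some `A_p`.
Hence `t^r W(E) ≤ ∫ (f₁/v)^r H W ≤ C ∫ (f₂/v)^r H W ≤ C' ‖f₂/v‖^r W(E)^(1-r/q)`, where the norm is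
that of `L^{q,∞}(W)` and the last step is `lintegral_rpow_mul_le_of_weak`. Division by
`W(E)^(1-r/q)` concludes.

Uniformity in (ii) holds because the reverse Hölder exponent depends only on the dimension and the
`A_1` constant, so `P`, `ε` and every later constant do not see the individual weights.
Muckenhoupt's theorem, which drives all the iterations, is derived from maximal functions of
doubling measures through the pointwise bound `rpow_maximal_le`. -/

theorem ofReal_rpow_eq_lintegral {p : ℝ} (hp : 0 < p) {a : ℝ} (ha : 0 ≤ a) :
    ENNReal.ofReal (a ^ p) =
      ∫⁻ t in Ioi (0 : ℝ), (Iio a).indicator (fun t => ENNReal.ofReal (p * t ^ (p - 1))) t := by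
  -- The layer cake formula for a constant function under a unit point mass is the scalar identity.
  have h := lintegral_rpow_eq_lintegral_meas_lt_mul (Measure.dirac ()) (f := fun _ => a)
    (Eventually.of_forall fun _ => ha) measurable_const.aemeasurable hp
  rw [lintegral_dirac, ← lintegral_const_mul' _ _ ENNReal.ofReal_ne_top] at h
  rw [h]
  refine setLIntegral_congr_fun measurableSet_Ioi fun t ht => ?_
  by_cases hta : t < a
  · simp [hta, ENNReal.ofReal_mul hp.le]
  · simp [hta]

theorem rpow_eq_lintegral {p : ℝ} (hp : 0 < p) (x : ℝ≥0∞) :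
    x ^ p = ∫⁻ t in Ioi (0 : ℝ),
      {t : ℝ | ENNReal.ofReal t < x}.indicator (fun t => ENNReal.ofReal (p * t ^ (p - 1))) t := by
  induction x with
  | top =>
    rw [ENNReal.top_rpow_of_pos hp, eq_comm, eq_top_iff]
    have hlim : Tendsto (fun N : ℕ => ENNReal.ofReal ((N : ℝ) ^ p)) atTop (𝓝 ∞) :=
      ENNReal.tendsto_ofReal_atTop.comp ((tendsto_rpow_atTop hp).comp tendsto_natCast_atTop_atTop)
    refine le_of_tendsto' hlim fun N => ?_
    rw [ofReal_rpow_eq_lintegral hp N.cast_nonneg]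
    refine lintegral_mono fun t => indicator_le_indicator_of_subset ?_ (fun _ => zero_le) t
    intro s _
    simp
  | coe x =>
    rw [← ENNReal.ofReal_coe_nnreal, ENNReal.ofReal_rpow_of_nonneg x.coe_nonneg hp.le,
      ofReal_rpow_eq_lintegral hp x.coe_nonneg]
    refine setLIntegral_congr_fun measurableSet_Ioi fun t ht => ?_
    have : ENNReal.ofReal t < ENNReal.ofReal x ↔ t < x := by
      rw [ENNReal.ofReal_lt_ofReal_iff']
      exact ⟨fun h => h.1, fun h => ⟨h, (mem_Ioi.1 ht).trans h⟩⟩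
    simp only [indicator, mem_Iio, mem_ofPred_eq, this]

/-- Tonelli on the region under the graph of `g`, with `g x ^ p` expanded by the scalar identity;
infinite values of `g` cause no trouble. -/
theorem lintegral_rpow_eq_layercake {α : Type*} [MeasurableSpace α] {ν : Measure α} [SFinite ν]
    {g : α → ℝ≥0∞} (hg : AEMeasurable g ν) {p : ℝ} (hp : 0 < p) :
    ∫⁻ x, g x ^ p ∂ν =
      ∫⁻ t in Ioi (0 : ℝ), ENNReal.ofReal (p * t ^ (p - 1)) * ν {x | ENNReal.ofReal t < g x} := by
  obtain ⟨g', hg', hgg'⟩ := hg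
  have h1 : ∀ t : ℝ, ν {x | ENNReal.ofReal t < g x} = ν {x | ENNReal.ofReal t < g' x} := fun t =>
    measure_congr (by filter_upwards [hgg'] with x hx; exact propext (by
      change _ < _ ↔ _ < _
      rw [hx]))
  rw [lintegral_congr_ae (g := fun x => g' x ^ p) (by filter_upwards [hgg'] with x hx; rw [hx])]
  simp_rw [h1, rpow_eq_lintegral hp]
  have hset : MeasurableSet {z : α × ℝ | ENNReal.ofReal z.2 < g' z.1} :=
    measurableSet_lt (by fun_prop) (by fun_prop)
  rw [lintegral_lintegral_swap]
  · refine lintegral_congr fun t => ?_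
    have hm : MeasurableSet {x | ENNReal.ofReal t < g' x} := measurableSet_lt measurable_const hg'
    rw [← setLIntegral_const, ← lintegral_indicator hm]
    rfl
  · have : Function.uncurry (fun (x : α) (t : ℝ) => {t : ℝ | ENNReal.ofReal t < g' x}.indicator
        (fun t => ENNReal.ofReal (p * t ^ (p - 1))) t) =
        {z : α × ℝ | ENNReal.ofReal z.2 < g' z.1}.indicator
          (fun z => ENNReal.ofReal (p * z.2 ^ (p - 1))) := by
      ext ⟨x, t⟩; rfl
    rw [this]
    exact (Measurable.indicator (by fun_prop) hset).aemeasurable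

theorem lintegral_rpow_Ioi {b : ℝ} (hb : 0 < b) {s : ℝ} (hs : 0 < s) :
    ∫⁻ t in Ioi s, ENNReal.ofReal (t ^ (-b - 1)) = ENNReal.ofReal (s ^ (-b) / b) := by
  rw [← ofReal_integral_eq_lintegral_ofReal (integrableOn_Ioi_rpow_of_lt (by linarith) hs),
    integral_Ioi_rpow_of_lt (by linarith) hs]
  · congr 1
    rw [show -b - 1 + 1 = -b by ring]
    field_simp
  · filter_upwards [ae_restrict_mem measurableSet_Ioi] with t ht
    exact Real.rpow_nonneg (hs.le.trans (mem_Ioi.1 ht).le) _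

theorem lintegral_rpow_Ioo {b : ℝ} (hb : 0 < b) {s : ℝ} (hs : 0 ≤ s) :
    ∫⁻ t in Ioo 0 s, ENNReal.ofReal (t ^ (b - 1)) = ENNReal.ofReal (s ^ b / b) := by
  have h := ofReal_rpow_eq_lintegral hb hs
  rw [lintegral_indicator measurableSet_Iio, Measure.restrict_restrict measurableSet_Iio,
    inter_comm, Ioi_inter_Iio] at h
  simp_rw [ENNReal.ofReal_mul hb.le] at h
  rw [lintegral_const_mul' _ _ ENNReal.ofReal_ne_top] at h
  rw [div_eq_inv_mul, ENNReal.ofReal_mul (inv_nonneg.2 hb.le), h, ← mul_assoc,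
    ← ENNReal.ofReal_mul (inv_nonneg.2 hb.le), inv_mul_cancel₀ hb.ne', ENNReal.ofReal_one, one_mul]

/-- Interpolation between two weak-type bounds. -/
theorem lintegral_rpow_le_of_weak {α : Type*} [MeasurableSpace α] {ν : Measure α} [SFinite ν]
    {g : α → ℝ≥0∞} (hg : AEMeasurable g ν) {p a₁ a₂ : ℝ} (hp : 0 < p) (h1 : a₁ < p) (h2 : p < a₂)
    {C₁ C₂ : ℝ≥0∞}
    (hC₁ : ∀ t : ℝ, 0 < t → ν {x | ENNReal.ofReal t < g x} ≤ C₁ * ENNReal.ofReal (t ^ (-a₁)))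
    (hC₂ : ∀ t : ℝ, 0 < t → ν {x | ENNReal.ofReal t < g x} ≤ C₂ * ENNReal.ofReal (t ^ (-a₂)))
    {s : ℝ} (hs : 0 < s) :
    ∫⁻ x, g x ^ p ∂ν ≤ C₁ * ENNReal.ofReal (p / (p - a₁) * s ^ (p - a₁)) +
      C₂ * ENNReal.ofReal (p / (a₂ - p) * s ^ (p - a₂)) := by
  -- The first bound is integrable at `0` and the second at infinity; the cut `s` stays free, to be
  -- chosen where the two balance.
  rw [lintegral_rpow_eq_layercake hg hp, ← Ioo_union_Ici_eq_Ioi hs]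
  refine (lintegral_union_le _ _ _).trans (add_le_add ?_ ?_)
  · calc _ ≤ ∫⁻ t in Ioo 0 s, C₁ * ENNReal.ofReal p * ENNReal.ofReal (t ^ (p - a₁ - 1)) := by
          refine setLIntegral_mono' measurableSet_Ioo fun t ht => ?_
          refine (mul_le_mul_right (hC₁ t ht.1) _).trans (le_of_eq ?_)
          rw [mul_left_comm, mul_assoc, ← ENNReal.ofReal_mul (by have := ht.1; positivity),
            ← ENNReal.ofReal_mul hp.le, mul_assoc, ← Real.rpow_add ht.1]
          ring_nf
      _ = _ := by
          rw [lintegral_const_mul _ (by fun_prop), lintegral_rpow_Ioo (by linarith) hs.le, mul_assoc,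
            ← ENNReal.ofReal_mul hp.le]
          ring_nf
  · calc _ = _ := setLIntegral_congr Ioi_ae_eq_Ici.symm
      _ ≤ ∫⁻ t in Ioi s, C₂ * ENNReal.ofReal p * ENNReal.ofReal (t ^ (-(a₂ - p) - 1)) := by
          refine setLIntegral_mono' measurableSet_Ioi fun t ht => ?_
          have ht0 : 0 < t := hs.trans ht
          refine (mul_le_mul_right (hC₂ t ht0) _).trans (le_of_eq ?_)
          rw [mul_left_comm, mul_assoc, ← ENNReal.ofReal_mul (by positivity),
            ← ENNReal.ofReal_mul hp.le, mul_assoc, ← Real.rpow_add ht0]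
          ring_nf
      _ = _ := by
          rw [lintegral_const_mul _ (by fun_prop), lintegral_rpow_Ioi (by linarith) hs, mul_assoc,
            ← ENNReal.ofReal_mul hp.le]
          ring_nf

/-! ### Maximal functions with respect to a doubling measure -/

variable {n : ℕ}

/-- The average of `f` over a closed cube with respect to `μ`. -/
noncomputable def mavg (μ : Measure (Fin n → ℝ)) (c : Fin n → ℝ) (r : ℝ)
    (f : (Fin n → ℝ) → ℝ≥0∞) : ℝ≥0∞ :=
  (μ (closedBall c r))⁻¹ * ∫⁻ y in closedBall c r, f y ∂μ

/-- The uncentred maximal function with respect to `μ`. -/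
noncomputable def mmax (μ : Measure (Fin n → ℝ)) (f : (Fin n → ℝ) → ℝ≥0∞) (x : Fin n → ℝ) :
    ℝ≥0∞ :=
  ⨆ (c : Fin n → ℝ) (r : ℝ) (_ : 0 < r) (_ : x ∈ closedBall c r), mavg μ c r f

/-- `μ` is positive and finite on cubes, and doubling with constant `D`. -/
structure IsDoubling (μ : Measure (Fin n → ℝ)) (D : ℝ≥0) : Prop where
  pos : ∀ c : Fin n → ℝ, ∀ r : ℝ, 0 < r → 0 < μ (closedBall c r)
  lt_top : ∀ c : Fin n → ℝ, ∀ r : ℝ, μ (closedBall c r) < ∞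
  le_mul : ∀ c : Fin n → ℝ, ∀ r : ℝ, 0 < r → μ (closedBall c (5 * r)) ≤ D * μ (closedBall c r)

theorem maximal_eq_mmax (f : (Fin n → ℝ) → ℝ≥0∞) : maximal f = mmax volume f := rfl

theorem avg_eq_mavg (c : Fin n → ℝ) (r : ℝ) (f : (Fin n → ℝ) → ℝ≥0∞) :
    avg c r f = mavg volume c r f := rfl

variable {μ : Measure (Fin n → ℝ)} {f g : (Fin n → ℝ) → ℝ≥0∞}

theorem mavg_le_mmax {c x : Fin n → ℝ} {r : ℝ} (hr : 0 < r) (hx : x ∈ closedBall c r) :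
    mavg μ c r f ≤ mmax μ f x :=
  le_iSup_of_le c <| le_iSup_of_le r <| le_iSup_of_le hr <| le_iSup_of_le hx le_rfl

theorem mmax_le {x : Fin n → ℝ} {A : ℝ≥0∞}
    (h : ∀ (c : Fin n → ℝ) (r : ℝ), 0 < r → x ∈ closedBall c r → mavg μ c r f ≤ A) :
    mmax μ f x ≤ A :=
  iSup_le fun c => iSup_le fun r => iSup_le fun hr => iSup_le fun hx => h c r hr hx

theorem lt_mmax_iff {x : Fin n → ℝ} {A : ℝ≥0∞} : A < mmax μ f x ↔
    ∃ (c : Fin n → ℝ) (r : ℝ), 0 < r ∧ x ∈ closedBall c r ∧ A < mavg μ c r f := by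
  simp only [mmax, lt_iSup_iff, exists_prop]

theorem mavg_mono (h : ∀ᵐ x ∂μ, f x ≤ g x) (c : Fin n → ℝ) (r : ℝ) :
    mavg μ c r f ≤ mavg μ c r g :=
  mul_le_mul_right (lintegral_mono_ae (ae_restrict_of_ae h)) _

theorem mavg_congr (h : f =ᵐ[μ] g) (c : Fin n → ℝ) (r : ℝ) : mavg μ c r f = mavg μ c r g := by
  unfold mavg
  rw [lintegral_congr_ae (ae_restrict_of_ae h)]

theorem mmax_congr (h : f =ᵐ[μ] g) : mmax μ f = mmax μ g := by
  unfold mmax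
  simp_rw [mavg_congr h]

theorem mmax_mono (h : ∀ᵐ x ∂μ, f x ≤ g x) (x : Fin n → ℝ) : mmax μ f x ≤ mmax μ g x :=
  mmax_le fun c r hr hx => (mavg_mono h c r).trans (mavg_le_mmax hr hx)

theorem mavg_tsum {F : ℕ → (Fin n → ℝ) → ℝ≥0∞} (hF : ∀ k, AEMeasurable (F k) μ)
    (c : Fin n → ℝ) (r : ℝ) :
    mavg μ c r (fun y => ∑' k, F k y) = ∑' k, mavg μ c r (F k) := by
  unfold mavg
  rw [lintegral_tsum fun k => (hF k).restrict, ENNReal.tsum_mul_left]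

theorem mmax_tsum_le {F : ℕ → (Fin n → ℝ) → ℝ≥0∞} (hF : ∀ k, AEMeasurable (F k) μ)
    (x : Fin n → ℝ) : mmax μ (fun y => ∑' k, F k y) x ≤ ∑' k, mmax μ (F k) x :=
  mmax_le fun c r hr hx => by
    rw [mavg_tsum hF]
    exact ENNReal.tsum_le_tsum fun k => mavg_le_mmax hr hx

theorem mavg_const_mul {a : ℝ≥0∞} (ha : a ≠ ∞) (c : Fin n → ℝ) (r : ℝ) :
    mavg μ c r (fun y => a * f y) = a * mavg μ c r f := by
  unfold mavg
  rw [lintegral_const_mul' _ _ ha, mul_left_comm]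

theorem mmax_const_mul_le {a : ℝ≥0∞} (ha : a ≠ ∞) (x : Fin n → ℝ) :
    mmax μ (fun y => a * f y) x ≤ a * mmax μ f x :=
  mmax_le fun c r hr hx => by
    rw [mavg_const_mul ha]
    exact mul_le_mul_right (mavg_le_mmax hr hx) _

theorem IsDoubling.mavg_const {D : ℝ≥0} (hμ : IsDoubling μ D) {c : Fin n → ℝ} {r : ℝ}
    (hr : 0 < r) (a : ℝ≥0∞) : mavg μ c r (fun _ => a) = a := by
  unfold mavg
  rw [setLIntegral_const, mul_left_comm, ENNReal.inv_mul_cancel (hμ.pos c r hr).ne'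
    (hμ.lt_top c r).ne, mul_one]

/-- A closed cube through `x` with large average may have `x` on its boundary. A slight enlargement
has `x` in its interior, and its measure is close to the old one by continuity from above, so the
average stays large. -/
theorem lowerSemicontinuous_mmax (hμ : ∀ c : Fin n → ℝ, ∀ r : ℝ, μ (closedBall c r) < ∞) :
    LowerSemicontinuous (mmax μ f) := by
  intro x A hA
  obtain ⟨c, r, hr, hx, hlt⟩ := lt_mmax_iff.1 hA
  have hinter : (⋂ s, ⋂ (_ : s > r), closedBall c s) = closedBall c r := by
    ext y
    simp only [mem_iInter, mem_closedBall]
    exact ⟨fun h => le_of_forall_gt_imp_ge_of_dense h, fun h s hs => h.trans hs.le⟩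
  have ht : Tendsto (fun s => μ (closedBall c s)) (𝓝[>] r) (𝓝 (μ (closedBall c r))) := by
    have := tendsto_measure_biInter_gt (μ := μ) (s := fun s => closedBall c s) (a := r)
      (fun s _ => measurableSet_closedBall.nullMeasurableSet)
      (fun i j _ hij => closedBall_subset_closedBall hij) ⟨r + 1, by simp, (hμ _ _).ne⟩
    rwa [hinter] at this
  have ht' : Tendsto (fun s => (μ (closedBall c s))⁻¹ * ∫⁻ y in closedBall c r, f y ∂μ) (𝓝[>] r)
      (𝓝 (mavg μ c r f)) :=
    ENNReal.Tendsto.mul_const ht.inv (Or.inl (ENNReal.inv_ne_zero.2 (hμ c r).ne))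
  obtain ⟨s, hs, hsr⟩ := ((ht'.eventually (lt_mem_nhds hlt)).and self_mem_nhdsWithin).exists
  have hball : ball c s ∈ 𝓝 x :=
    isOpen_ball.mem_nhds (mem_ball.2 ((mem_closedBall.1 hx).trans_lt hsr))
  filter_upwards [hball] with y hy
  refine (hs.trans_le (mul_le_mul_right (lintegral_mono_set
    (closedBall_subset_closedBall (le_of_lt hsr))) _)).trans_le
    (mavg_le_mmax (hr.trans hsr) (ball_subset_closedBall hy))

theorem IsDoubling.measurable_mmax {D : ℝ≥0} (hμ : IsDoubling μ D) : Measurable (mmax μ f) :=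
  (lowerSemicontinuous_mmax hμ.lt_top).measurable

/-- The covering argument behind weak-type estimates. -/
theorem IsDoubling.measure_iUnion_le {D : ℝ≥0} (hμ : IsDoubling μ D) {ι : Type*} (t : Set ι)
    (c : ι → Fin n → ℝ) (r : ι → ℝ) (R : ℝ) (hr : ∀ i ∈ t, 0 < r i) (hR : ∀ i ∈ t, r i ≤ R)
    (ν : Measure (Fin n → ℝ)) (hν : ∀ i ∈ t, μ (closedBall (c i) (r i)) ≤ ν (closedBall (c i) (r i))) :
    μ (⋃ i ∈ t, closedBall (c i) (r i)) ≤ D * ν univ := by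
  obtain ⟨u, hut, hdisj, hcov⟩ :=
    Vitali.exists_disjoint_subfamily_covering_enlargement_closedBall t c r R hR 5 (by norm_num)
  have hcount : u.Countable := hdisj.countable_of_nonempty_interior fun i hi =>
    ⟨c i, ball_subset_interior_closedBall (mem_ball_self (hr i (hut hi)))⟩
  calc μ (⋃ i ∈ t, closedBall (c i) (r i)) ≤ μ (⋃ i ∈ u, closedBall (c i) (5 * r i)) := by
        refine measure_mono (iUnion₂_subset fun i hi => ?_)
        obtain ⟨j, hj, hij⟩ := hcov i hi
        exact hij.trans (subset_biUnion_of_mem (u := fun j => closedBall (c j) (5 * r j)) hj)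
    _ ≤ ∑' i : u, μ (closedBall (c i) (5 * r i)) := measure_biUnion_le _ hcount _
    _ ≤ ∑' i : u, D * ν (closedBall (c i) (r i)) := ENNReal.tsum_le_tsum fun i =>
        (hμ.le_mul _ _ (hr i (hut i.2))).trans (mul_le_mul_right (hν i (hut i.2)) _)
    _ = D * ν (⋃ i ∈ u, closedBall (c i) (r i)) := by
        rw [ENNReal.tsum_mul_left, measure_biUnion hcount hdisj
          fun i _ => measurableSet_closedBall]
    _ ≤ D * ν univ := mul_le_mul_right (measure_mono (subset_univ _)) _

/-- The weak-type `(1, 1)` estimate. -/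
theorem IsDoubling.measure_lt_mmax_le {D : ℝ≥0} (hμ : IsDoubling μ D) {t : ℝ≥0∞} (ht : t ≠ 0)
    (ht' : t ≠ ∞) : μ {x | t < mmax μ f x} ≤ D * (t⁻¹ * ∫⁻ x, f x ∂μ) := by
  -- The Vitali selection needs bounded radii, so the cubes with `r ≤ N` are treated first and `N`
  -- is sent to infinity. The comparison measure is `t⁻¹ f μ`.
  let T : ℕ → Set ((Fin n → ℝ) × ℝ) := fun N => {z | 0 < z.2 ∧ z.2 ≤ N ∧ t < mavg μ z.1 z.2 f}
  have hU : {x | t < mmax μ f x} = ⋃ N, ⋃ z ∈ T N, closedBall z.1 z.2 := by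
    ext x
    simp only [mem_ofPred_eq, lt_mmax_iff, mem_iUnion, T]
    constructor
    · rintro ⟨c, r, hr, hx, h⟩
      obtain ⟨N, hN⟩ := exists_nat_ge r
      exact ⟨N, (c, r), ⟨hr, hN, h⟩, hx⟩
    · rintro ⟨N, z, ⟨h1, h2, h3⟩, hx⟩
      exact ⟨z.1, z.2, h1, hx, h3⟩
  have hmono : Monotone fun N => ⋃ z ∈ T N, closedBall z.1 z.2 := by
    intro N M hNM
    refine biUnion_subset_biUnion_left fun z hz => ⟨hz.1, hz.2.1.trans (by exact_mod_cast hNM), hz.2.2⟩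
  rw [hU, hmono.measure_iUnion]
  refine iSup_le fun N => ?_
  refine (hμ.measure_iUnion_le (T N) (fun z => z.1) (fun z => z.2) N (fun z hz => hz.1)
    (fun z hz => hz.2.1) (t⁻¹ • μ.withDensity f) ?_).trans ?_
  · rintro z ⟨hz, -, h⟩
    rw [Measure.smul_apply, withDensity_apply _ measurableSet_closedBall, smul_eq_mul]
    have h0 := (hμ.pos z.1 z.2 hz).ne'
    have h1 := (hμ.lt_top z.1 z.2).ne
    unfold mavg at h
    have h2 : t * μ (closedBall z.1 z.2) ≤ ∫⁻ y in closedBall z.1 z.2, f y ∂μ :=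
      calc t * μ (closedBall z.1 z.2) ≤ ((μ (closedBall z.1 z.2))⁻¹ *
            ∫⁻ y in closedBall z.1 z.2, f y ∂μ) * μ (closedBall z.1 z.2) := mul_le_mul_left h.le _
        _ = _ := by rw [mul_right_comm, ENNReal.inv_mul_cancel h0 h1, one_mul]
    calc μ (closedBall z.1 z.2) = t⁻¹ * (t * μ (closedBall z.1 z.2)) := by
          rw [← mul_assoc, ENNReal.inv_mul_cancel ht ht', one_mul]
      _ ≤ _ := mul_le_mul_right h2 _
  · rw [Measure.smul_apply, withDensity_apply _ MeasurableSet.univ, smul_eq_mul,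
      setLIntegral_univ]

/-- The strong-type `(p, p)` estimate. -/
theorem exists_lintegral_mmax_rpow_le (n : ℕ) (D : ℝ≥0) {p : ℝ} (hp : 1 < p) : ∃ C : ℝ≥0, 1 ≤ C ∧
    ∀ (μ : Measure (Fin n → ℝ)) [SFinite μ], IsDoubling μ D → ∀ f : (Fin n → ℝ) → ℝ≥0∞,
      AEMeasurable f μ → ∫⁻ x, mmax μ f x ^ p ∂μ ≤ C * ∫⁻ x, f x ^ p ∂μ := by
  refine ⟨1 + D * Real.toNNReal (2 ^ p * (p / (p - 1))), by simp, fun μ _ hμ f hf => ?_⟩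
  have hp0 : 0 < p := by linarith
  -- Only the part of `f` above height `t` can push `M f` above `2 t`. The right side is a
  -- distribution function with respect to `f μ`, so a second layer cake with exponent `p - 1`
  -- recovers `∫ f ^ p`.
  have key : ∀ t : ℝ, 0 < t → μ {x | ENNReal.ofReal (2 * t) < mmax μ f x} ≤
      D * ENNReal.ofReal (t⁻¹) * (μ.withDensity f) {x | ENNReal.ofReal t < f x} := by
    intro t ht
    set f₁ : (Fin n → ℝ) → ℝ≥0∞ := {x | ENNReal.ofReal t < f x}.indicator f with hf₁
    have hns : NullMeasurableSet {x | ENNReal.ofReal t < f x} μ :=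
      nullMeasurableSet_lt aemeasurable_const hf
    have hle : ∀ x, mmax μ f x ≤ mmax μ f₁ x + ENNReal.ofReal t := by
      intro x
      refine mmax_le fun c r hr hx => ?_
      calc mavg μ c r f ≤ mavg μ c r (fun y => f₁ y + ENNReal.ofReal t) := by
            refine mavg_mono (Eventually.of_forall fun y => ?_) c r
            by_cases hy : ENNReal.ofReal t < f y
            · simp [hf₁, hy]
            · simp only [hf₁, indicator, mem_ofPred_eq, hy, if_false, zero_add]
              exact not_lt.1 hy
        _ = mavg μ c r f₁ + mavg μ c r (fun _ => ENNReal.ofReal t) := by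
            unfold mavg
            rw [lintegral_add_right _ measurable_const, mul_add]
        _ ≤ _ := by
            rw [hμ.mavg_const hr]
            gcongr
            exact mavg_le_mmax hr hx
    calc μ {x | ENNReal.ofReal (2 * t) < mmax μ f x}
        ≤ μ {x | ENNReal.ofReal t < mmax μ f₁ x} := by
          refine measure_mono fun x hx => ?_
          have h := lt_of_lt_of_le (mem_ofPred_eq ▸ hx) (hle x)
          rw [two_mul, ENNReal.ofReal_add ht.le ht.le] at h
          exact lt_of_add_lt_add_right h
      _ ≤ _ := hμ.measure_lt_mmax_le (by simpa using ht) ENNReal.ofReal_ne_top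
      _ = _ := by
          rw [withDensity_apply₀ _ (hns.mono_ac (Measure.AbsolutelyContinuous.refl _)),
            ← lintegral_indicator₀ hns, ENNReal.ofReal_inv_of_pos ht, mul_assoc]
  have h1 : ∫⁻ x, mmax μ f x ^ p ∂μ = ENNReal.ofReal (2 ^ p) *
      ∫⁻ x, (ENNReal.ofReal 2⁻¹ * mmax μ f x) ^ p ∂μ := by
    rw [← lintegral_const_mul' _ _ ENNReal.ofReal_ne_top]
    refine lintegral_congr fun x => ?_
    rw [ENNReal.mul_rpow_of_nonneg _ _ hp0.le, ← mul_assoc,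
      ENNReal.ofReal_rpow_of_nonneg (by norm_num) hp0.le, ← ENNReal.ofReal_mul (by positivity),
      ← Real.mul_rpow (by norm_num) (by norm_num)]
    norm_num
  have h2 : ∫⁻ x, (ENNReal.ofReal 2⁻¹ * mmax μ f x) ^ p ∂μ ≤
      D * ENNReal.ofReal (p / (p - 1)) * ∫⁻ x, f x ^ p ∂μ := by
    have hd : ∫⁻ x, f x ^ (p - 1) ∂(μ.withDensity f) = ∫⁻ x, f x ^ p ∂μ := by
      rw [lintegral_withDensity_eq_lintegral_mul₀ hf (hf.pow_const _)]
      refine lintegral_congr fun x => ?_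
      have := ENNReal.rpow_add_of_nonneg (x := f x) 1 (p - 1) zero_le_one (by linarith)
      rw [ENNReal.rpow_one] at this
      rw [Pi.mul_apply, ← this]
      ring_nf
    rw [← hd, lintegral_rpow_eq_layercake ((hμ.measurable_mmax.const_mul _).aemeasurable) hp0,
      lintegral_rpow_eq_layercake (hf.mono_ac (withDensity_absolutelyContinuous _ _))
        (by linarith : 0 < p - 1), ← lintegral_const_mul' _ _ (by finiteness)]
    refine setLIntegral_mono' measurableSet_Ioi fun t ht => ?_
    have ht0 : 0 < t := ht
    have hset : {x | ENNReal.ofReal t < ENNReal.ofReal 2⁻¹ * mmax μ f x} =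
        {x | ENNReal.ofReal (2 * t) < mmax μ f x} := by
      ext x
      simp only [mem_ofPred_eq]
      rw [ENNReal.ofReal_mul (by norm_num), ENNReal.ofReal_inv_of_pos (by norm_num), mul_comm,
        ← div_eq_mul_inv, ENNReal.lt_div_iff_mul_lt (by simp) (by simp), mul_comm]
    rw [hset]
    refine (mul_le_mul_right (key t ht0) _).trans (le_of_eq ?_)
    have e : ENNReal.ofReal (p * t ^ (p - 1)) * ENNReal.ofReal t⁻¹ =
        ENNReal.ofReal (p / (p - 1)) * ENNReal.ofReal ((p - 1) * t ^ (p - 1 - 1)) := by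
      rw [← ENNReal.ofReal_mul (by positivity),
        ← ENNReal.ofReal_mul (div_nonneg hp0.le (by linarith))]
      congr 1
      rw [Real.rpow_sub_one ht0.ne' (p - 1)]
      have : p - 1 ≠ 0 := by linarith
      field_simp
    calc _ = D * (ENNReal.ofReal (p * t ^ (p - 1)) * ENNReal.ofReal t⁻¹) *
          (μ.withDensity f) {x | ENNReal.ofReal t < f x} := by ring
      _ = _ := by rw [e]; ring
  rw [h1]
  refine (mul_le_mul_right h2 _).trans ?_
  rw [← mul_assoc]
  refine mul_le_mul_left ?_ _
  rw [ENNReal.coe_add, ENNReal.coe_mul, ← ENNReal.ofReal, ENNReal.ofReal_mul (by positivity)]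
  refine le_trans (le_of_eq (by ring)) le_add_self

end Muckenhoupt

namespace Muckenhoupt
open Metric Filter Set
open scoped Topology

variable {n : ℕ} {f g : (Fin n → ℝ) → ℝ≥0∞}

/-! ### The maximal function with respect to Lebesgue measure -/

theorem volume_closedBall_mul {k r : ℝ} (hk : 0 ≤ k) (hr : 0 ≤ r) (c c' : Fin n → ℝ) :
    volume (closedBall c (k * r)) = ENNReal.ofReal (k ^ n) * volume (closedBall c' r) := by
  rw [Real.volume_pi_closedBall _ (by positivity), Real.volume_pi_closedBall _ hr,
    ← ENNReal.ofReal_mul (by positivity), Fintype.card_fin, ← mul_pow]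
  ring_nf

theorem volume_closedBall_pos (c : Fin n → ℝ) {r : ℝ} (hr : 0 < r) :
    0 < volume (closedBall c r) := measure_closedBall_pos _ _ hr

theorem volume_closedBall_lt_top (c : Fin n → ℝ) (r : ℝ) : volume (closedBall c r) < ∞ :=
  measure_closedBall_lt_top

theorem isDoubling_volume : IsDoubling (volume : Measure (Fin n → ℝ)) (5 ^ n) where
  pos c _ hr := volume_closedBall_pos c hr
  lt_top := volume_closedBall_lt_top
  le_mul c r hr := by
    rw [volume_closedBall_mul (by norm_num) hr.le c c, ENNReal.ofReal_pow (by norm_num)]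
    simp

theorem measurable_maximal : Measurable (maximal f) := isDoubling_volume.measurable_mmax

theorem setLIntegral_eq_mul_avg (f : (Fin n → ℝ) → ℝ≥0∞) (c : Fin n → ℝ) {r : ℝ} (hr : 0 < r) :
    ∫⁻ y in closedBall c r, f y = volume (closedBall c r) * avg c r f := by
  unfold avg
  rw [← mul_assoc, ENNReal.mul_inv_cancel (volume_closedBall_pos c hr).ne'
    (volume_closedBall_lt_top c r).ne, one_mul]

theorem avg_le_of_setLIntegral_le {c : Fin n → ℝ} {r : ℝ} (hr : 0 < r) {A : ℝ≥0∞}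
    (h : ∫⁻ y in closedBall c r, f y ≤ volume (closedBall c r) * A) : avg c r f ≤ A := by
  unfold avg
  refine (mul_le_mul_right h _).trans ?_
  rw [← mul_assoc, ENNReal.inv_mul_cancel (volume_closedBall_pos c hr).ne'
    (volume_closedBall_lt_top c r).ne, one_mul]

theorem avg_le_mul_avg {c c' : Fin n → ℝ} {r k : ℝ} (hr : 0 < r) (hk : 0 < k)
    (h : closedBall c r ⊆ closedBall c' (k * r)) :
    avg c r f ≤ ENNReal.ofReal (k ^ n) * avg c' (k * r) f := by
  refine avg_le_of_setLIntegral_le hr ?_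
  rw [← mul_assoc, mul_comm (volume _), ← volume_closedBall_mul hk.le hr.le c' c,
    ← setLIntegral_eq_mul_avg _ _ (by positivity)]
  exact lintegral_mono_set h

theorem le_of_forall_add_ofReal_le {Φ : ℝ≥0∞ → ℝ≥0∞} (hΦ : Continuous Φ) {A x : ℝ≥0∞}
    (h : ∀ ε : ℝ, 0 < ε → x ≤ Φ (A + ENNReal.ofReal ε)) : x ≤ Φ A := by
  have ht : Tendsto (fun ε : ℝ => Φ (A + ENNReal.ofReal ε)) (𝓝[>] 0) (𝓝 (Φ A)) := by
    have : Continuous fun ε : ℝ => Φ (A + ENNReal.ofReal ε) :=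
      hΦ.comp (continuous_const.add ENNReal.continuous_ofReal)
    simpa using (this.tendsto 0).mono_left nhdsWithin_le_nhds
  exact ge_of_tendsto ht (by filter_upwards [self_mem_nhdsWithin] with ε hε using h ε hε)

/-- Localization: cubes through `y` of radius at most `r` stay inside the tripled cube, while larger
ones, once tripled, contain `x`. -/
theorem maximal_le_max_indicator {c x y : Fin n → ℝ} {r : ℝ}
    (hx : x ∈ closedBall c r) (hy : y ∈ closedBall c r) :
    maximal f y ≤ max (maximal ((closedBall c (3 * r)).indicator f) y)
      (ENNReal.ofReal (3 ^ n) * maximal f x) := by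
  refine mmax_le fun c' r' hr' hy' => ?_
  rw [mem_closedBall] at hx hy hy'
  rcases le_or_gt r' r with h | h
  · refine le_max_of_le_left (le_trans (le_of_eq ?_) (mavg_le_mmax hr' hy'))
    have hsub : closedBall c' r' ⊆ closedBall c (3 * r) := by
      intro z hz
      rw [mem_closedBall] at hz ⊢
      have := dist_triangle4 z c' y c
      rw [dist_comm c' y] at this
      linarith
    unfold mavg
    congr 1
    refine setLIntegral_congr_fun measurableSet_closedBall fun z hz => ?_
    simp [indicator_of_mem (hsub hz)]
  · refine le_max_of_le_right ((avg_le_mul_avg (c' := c') (k := 3) hr' (by norm_num)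
      (closedBall_subset_closedBall (by linarith))).trans ?_)
    refine mul_le_mul_right (mavg_le_mmax (by linarith) ?_) _
    rw [mem_closedBall]
    have := dist_triangle4 x c y c'
    rw [dist_comm c y] at this
    linarith

/-- Coifman-Rochberg: the square root of a maximal function satisfies the `A_1` condition. -/
theorem maximal_sqrt_maximal_le (h : (Fin n → ℝ) → ℝ≥0∞) (x : Fin n → ℝ) :
    maximal (fun y => maximal h y ^ (1 / 2 : ℝ)) x ≤
      (1 + 15 ^ n + 3 ^ n : ℝ≥0∞) * maximal h x ^ (1 / 2 : ℝ) := by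
  refine mmax_le fun c r hr hx => ?_
  rw [← avg_eq_mavg]
  by_cases htop : maximal h x = ∞
  · rw [htop, ENNReal.top_rpow_of_pos (by norm_num), ENNReal.mul_top (by positivity)]
    exact le_top
  -- Adding `ε` replaces `maximal h x` by a positive real `a`, which may be used as a cut level even
  -- when the maximal function vanishes.
  refine le_of_forall_add_ofReal_le (Φ := fun A => (1 + 15 ^ n + 3 ^ n : ℝ≥0∞) * A ^ (1 / 2 : ℝ))
    (ENNReal.continuous_const_mul (by finiteness) |>.comp ENNReal.continuous_rpow_const) ?_
  intro ε hε
  obtain ⟨a, ha⟩ : ∃ a : ℝ, maximal h x + ENNReal.ofReal ε = ENNReal.ofReal a :=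
    ⟨(maximal h x + ENNReal.ofReal ε).toReal, (ENNReal.ofReal_toReal (by finiteness)).symm⟩
  have ha0 : 0 < a := by
    rw [← ENNReal.ofReal_pos, ← ha]
    exact lt_of_lt_of_le (ENNReal.ofReal_pos.2 hε) le_add_self
  have hxa : maximal h x ≤ ENNReal.ofReal a := ha ▸ le_self_add
  simp only [ha]
  set h₁ := (closedBall c (3 * r)).indicator h with hh₁
  have hint : ∫⁻ y, h₁ y ≤ 3 ^ n * volume (closedBall c r) * ENNReal.ofReal a := by
    rw [lintegral_indicator measurableSet_closedBall, setLIntegral_eq_mul_avg _ _ (by positivity),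
      volume_closedBall_mul (by norm_num) hr.le c c, ENNReal.ofReal_pow (by norm_num)]
    gcongr
    · simp
    · exact (mavg_le_mmax (by positivity) (closedBall_subset_closedBall (by linarith) hx)).trans hxa
  -- Kolmogorov's argument: interpolate between the trivial bound by the measure of the cube and
  -- weak type `(1, 1)`, with cut at `a`. The factor `15` is `5` from the covering times `3` from
  -- the tripled cube.
  have hweak : ∫⁻ y in closedBall c r, maximal h₁ y ^ (1 / 2 : ℝ) ≤
      volume (closedBall c r) * ((1 + 15 ^ n) * ENNReal.ofReal a ^ (1 / 2 : ℝ)) := by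
    refine (lintegral_rpow_le_of_weak (p := 1 / 2) (a₁ := 0) (a₂ := 1)
      (C₁ := volume (closedBall c r)) (C₂ := 15 ^ n * volume (closedBall c r) * ENNReal.ofReal a)
      measurable_maximal.aemeasurable (by norm_num) (by norm_num) (by norm_num) ?_ ?_ ha0).trans ?_
    · intro t ht
      refine (measure_mono (subset_univ _)).trans (by simp)
    · intro t ht
      refine (Measure.restrict_apply_le _ _).trans ?_
      refine (isDoubling_volume.measure_lt_mmax_le (f := h₁) (t := ENNReal.ofReal t) (by simpa using ht)
        ENNReal.ofReal_ne_top).trans ?_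
      refine (mul_le_mul_right (mul_le_mul_right hint _) _).trans (le_of_eq ?_)
      rw [Real.rpow_neg_one, ENNReal.ofReal_inv_of_pos ht, show (15 : ℝ≥0∞) = 5 * 3 by norm_num,
        mul_pow]
      push_cast
      ring
    · have e1 : ENNReal.ofReal (1 / 2 / (1 / 2 - 0) * a ^ (1 / 2 - 0 : ℝ)) =
          ENNReal.ofReal a ^ (1 / 2 : ℝ) := by
        rw [ENNReal.ofReal_rpow_of_pos ha0]
        norm_num
      have e2 : ENNReal.ofReal a * ENNReal.ofReal (1 / 2 / (1 - 1 / 2) * a ^ (1 / 2 - 1 : ℝ)) =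
          ENNReal.ofReal a ^ (1 / 2 : ℝ) := by
        rw [ENNReal.ofReal_rpow_of_pos ha0, ← ENNReal.ofReal_mul ha0.le]
        congr 1
        rw [Real.rpow_sub_one ha0.ne']
        field_simp
        norm_num
      rw [e1, mul_assoc _ (ENNReal.ofReal a), e2]
      exact le_of_eq (by ring)
  refine avg_le_of_setLIntegral_le hr ?_
  calc ∫⁻ y in closedBall c r, maximal h y ^ (1 / 2 : ℝ)
      ≤ ∫⁻ y in closedBall c r, (maximal h₁ y ^ (1 / 2 : ℝ) +
          3 ^ n * ENNReal.ofReal a ^ (1 / 2 : ℝ)) := by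
        refine setLIntegral_mono' measurableSet_closedBall fun y hy => ?_
        have h3 : (ENNReal.ofReal (3 ^ n) * maximal h x) ^ (1 / 2 : ℝ) ≤
            3 ^ n * ENNReal.ofReal a ^ (1 / 2 : ℝ) := by
          rw [ENNReal.mul_rpow_of_nonneg _ _ (by norm_num), ENNReal.ofReal_pow (by norm_num)]
          gcongr
          norm_num
          exact (ENNReal.rpow_le_rpow_of_exponent_le (one_le_pow₀ (by norm_num))
            (by norm_num)).trans (ENNReal.rpow_one _).le
        rcases le_max_iff.1 (maximal_le_max_indicator (f := h) hx hy) with h' | h'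
        · exact (ENNReal.rpow_le_rpow h' (by norm_num)).trans le_self_add
        · exact (ENNReal.rpow_le_rpow h' (by norm_num)).trans (h3.trans le_add_self)
    _ ≤ volume (closedBall c r) * ((1 + 15 ^ n) * ENNReal.ofReal a ^ (1 / 2 : ℝ)) +
          volume (closedBall c r) * (3 ^ n * ENNReal.ofReal a ^ (1 / 2 : ℝ)) := by
        rw [lintegral_add_right _ measurable_const, setLIntegral_const, mul_comm (_ * _) (volume _)]
        gcongr
    _ = _ := by ring

/-- The reverse weak-type inequality. -/
theorem setLIntegral_lt_maximal_le (hn : 0 < n) (hf : ∫⁻ x, f x ≠ ∞) {t : ℝ≥0∞} (ht : t ≠ 0)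
    (ht' : t ≠ ∞) :
    ∫⁻ x in {x | t < maximal f x}, f x ≤ 5 ^ n * (t * volume {x | t < maximal f x}) := by
  set Ω : Set (Fin n → ℝ) := {x | t < maximal f x} with hΩ
  have : Nonempty (Fin n) := ⟨⟨0, hn⟩⟩
  have hopen : IsOpen Ω := (lowerSemicontinuous_mmax volume_closedBall_lt_top).isOpen_preimage t
  have hfin : volume Ω < ∞ := (isDoubling_volume.measure_lt_mmax_le (f := f) ht ht').trans_lt
    (by finiteness)
  have hne : (Ωᶜ).Nonempty := by
    rw [nonempty_compl]
    intro h
    rw [h] at hfin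
    simp at hfin
  -- Whitney-type balls: radius `2/5` of the distance to the complement keeps the ball in `Ω`, while
  -- the ball enlarged five times reaches a point where `maximal f ≤ t`, which bounds its average.
  set d : (Fin n → ℝ) → ℝ := fun x => infDist x Ωᶜ with hd
  have hdpos : ∀ x ∈ Ω, 0 < d x := fun x hx =>
    (hopen.isClosed_compl.notMem_iff_infDist_pos hne).1 (by simpa using hx)
  have hsubΩ : ∀ x ∈ Ω, closedBall x (2 / 5 * d x) ⊆ Ω := by
    intro x hx y hy
    by_contra hy'
    have h1 : d x ≤ dist x y := infDist_le_dist_of_mem hy'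
    rw [mem_closedBall, dist_comm] at hy
    linarith [hdpos x hx]
  -- The radii are bounded because these balls lie in a set of finite measure.
  obtain ⟨R, hR⟩ : ∃ R : ℝ, ∀ x ∈ Ω, 2 / 5 * d x ≤ R := by
    refine ⟨1 + (volume Ω).toReal, fun x hx => ?_⟩
    by_contra hlt
    push Not at hlt
    have h0 := hdpos x hx
    have h1 := (measure_mono (hsubΩ x hx)).trans_lt (lt_of_eq_of_lt rfl hfin)
    have h2 : volume (closedBall x (2 / 5 * d x)) ≤ volume Ω := measure_mono (hsubΩ x hx)
    rw [Real.volume_pi_closedBall _ (by positivity), ENNReal.ofReal_le_iff_le_toReal hfin.ne,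
      Fintype.card_fin] at h2
    have h3 : 2 * (2 / 5 * d x) ≤ (2 * (2 / 5 * d x)) ^ n :=
      le_self_pow₀ (by linarith [ENNReal.toReal_nonneg (a := volume Ω)]) hn.ne'
    linarith [ENNReal.toReal_nonneg (a := volume Ω)]
  obtain ⟨u, hut, hdisj, hcov⟩ :=
    Vitali.exists_disjoint_subfamily_covering_enlargement_closedBall Ω id (fun x => 2 / 5 * d x) R
      hR 5 (by norm_num)
  simp only [id] at hdisj hcov
  have hcount : u.Countable := hdisj.countable_of_nonempty_interior fun i hi =>
    ⟨i, ball_subset_interior_closedBall (mem_ball_self (by have := hdpos i (hut hi); positivity))⟩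
  have hball : ∀ x ∈ Ω, ∫⁻ y in closedBall x (5 * (2 / 5 * d x)), f y ≤
      5 ^ n * (t * volume (closedBall x (2 / 5 * d x))) := by
    intro x hx
    have h0 := hdpos x hx
    obtain ⟨z, hz, hxz⟩ := (infDist_lt_iff hne).1 (show infDist x Ωᶜ < 2 * d x by
      change d x < 2 * d x; linarith)
    have hzt : maximal f z ≤ t := by simpa [hΩ] using hz
    rw [setLIntegral_eq_mul_avg _ _ (by positivity),
      volume_closedBall_mul (by norm_num) (by positivity) x x, ENNReal.ofReal_pow (by norm_num)]
    have : avg x (5 * (2 / 5 * d x)) f ≤ t := by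
      refine (mavg_le_mmax (by positivity) ?_).trans hzt
      rw [mem_closedBall, dist_comm]
      linarith
    calc _ ≤ ENNReal.ofReal 5 ^ n * volume (closedBall x (2 / 5 * d x)) * t :=
          mul_le_mul_right this _
      _ = _ := by norm_num; ring
  calc ∫⁻ x in Ω, f x ≤ ∫⁻ x in ⋃ i ∈ u, closedBall i (5 * (2 / 5 * d i)), f x := by
        refine lintegral_mono_set fun x hx => ?_
        obtain ⟨j, hj, hij⟩ := hcov x hx
        exact mem_biUnion hj (hij (mem_closedBall_self (by have := hdpos x hx; positivity)))
    _ ≤ ∑' i : u, ∫⁻ x in closedBall (i : Fin n → ℝ) (5 * (2 / 5 * d i)), f x := by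
        have := hcount.to_subtype
        rw [biUnion_eq_iUnion]
        exact lintegral_iUnion_le _ _
    _ ≤ ∑' i : u, 5 ^ n * (t * volume (closedBall (i : Fin n → ℝ) (2 / 5 * d i))) :=
        ENNReal.tsum_le_tsum fun i => hball i (hut i.2)
    _ = 5 ^ n * (t * volume (⋃ i ∈ u, closedBall i (2 / 5 * d i))) := by
        rw [ENNReal.tsum_mul_left, ENNReal.tsum_mul_left, measure_biUnion hcount hdisj
          fun i _ => measurableSet_closedBall]
    _ ≤ _ := by
        gcongr
        exact iUnion₂_subset fun i hi => hsubΩ i (hut hi)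

/-! ### Reverse Hölder inequality for `A_1` weights -/

theorem ae_le_maximal (hf : AEMeasurable f) (hfin : ∫⁻ x, f x ≠ ∞) : ∀ᵐ x, f x ≤ maximal f x := by
  filter_upwards [(Besicovitch.vitaliFamily (volume : Measure (Fin n → ℝ))).ae_tendsto_lintegral_div
    hf hfin] with x hx
  refine le_of_tendsto (hx.comp (Besicovitch.tendsto_filterAt volume x)) ?_
  filter_upwards [self_mem_nhdsWithin] with r hr
  rw [Function.comp, ENNReal.div_eq_inv_mul]
  exact mavg_le_mmax hr (mem_closedBall_self (le_of_lt hr))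

theorem avg_mono (h : ∀ᵐ x, f x ≤ g x) (c : Fin n → ℝ) (r : ℝ) : avg c r f ≤ avg c r g :=
  mavg_mono h c r

theorem avg_const {c : Fin n → ℝ} {r : ℝ} (hr : 0 < r) (a : ℝ≥0∞) : avg c r (fun _ => a) = a :=
  isDoubling_volume.mavg_const hr a

/-- A cube through a point outside the tripled cube either misses the original cube or is at least
as large, and then its average only dilutes the mass. -/
theorem maximal_indicator_le {c x : Fin n → ℝ} {r : ℝ} (hr : 0 < r)
    (hx : x ∉ closedBall c (3 * r)) : maximal ((closedBall c r).indicator f) x ≤ avg c r f := by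
  refine mmax_le fun c' r' hr' hx' => ?_
  by_cases hrr : r ≤ r'
  · refine avg_le_of_setLIntegral_le hr' ?_
    calc ∫⁻ y in closedBall c' r', (closedBall c r).indicator f y
        ≤ ∫⁻ y, (closedBall c r).indicator f y := setLIntegral_le_lintegral _ _
      _ = volume (closedBall c r) * avg c r f := by
          rw [lintegral_indicator measurableSet_closedBall, setLIntegral_eq_mul_avg _ _ hr]
      _ ≤ _ := by
          gcongr 1
          rw [Real.volume_pi_closedBall _ hr.le, Real.volume_pi_closedBall _ hr'.le]
          gcongr
  · have : ∀ y ∈ closedBall c' r', (closedBall c r).indicator f y = 0 := by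
      intro y hy
      refine indicator_of_notMem (fun hy' => hx ?_) _
      rw [mem_closedBall] at *
      have := dist_triangle4 x c' y c
      rw [dist_comm c' y] at this
      linarith
    unfold mavg
    rw [setLIntegral_congr_fun measurableSet_closedBall this]
    simp

/-- With `f` the restriction of `u` to the cube, `∫ f (M f)^δ` is expanded in levels. Below the
average of `u` the total mass of `f` is used. Above it the reverse weak-type inequality applies, and
the level set lies in the tripled cube, where `M f ≤ K u`. What matters is the factor `δ` in front
of the last integral: for small `δ` that term can be absorbed. -/
theorem setLIntegral_rpow_le_of_maximal_le (hn : 0 < n) {K : ℝ≥0} {u : (Fin n → ℝ) → ℝ≥0∞}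
    (hu : AEMeasurable u) (hK : ∀ᵐ x, maximal u x ≤ K * u x) {δ : ℝ} (hδ : 0 < δ)
    {c : Fin n → ℝ} {r : ℝ} (hr : 0 < r) (h0 : avg c r u ≠ 0) (h1 : avg c r u ≠ ∞) :
    ∫⁻ y in closedBall c r, u y ^ (1 + δ) ≤ volume (closedBall c r) * avg c r u ^ (1 + δ) +
      5 ^ n * ENNReal.ofReal δ * ∫⁻ y in closedBall c (3 * r), (K * u y) ^ (1 + δ) := by
  set f := (closedBall c r).indicator u with hf
  have hfm : AEMeasurable f := hu.indicator measurableSet_closedBall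
  have hfint : ∫⁻ x, f x = volume (closedBall c r) * avg c r u := by
    rw [hf, lintegral_indicator measurableSet_closedBall, setLIntegral_eq_mul_avg _ _ hr]
  have hvol := volume_closedBall_lt_top c r
  have hffin : ∫⁻ x, f x ≠ ∞ := by rw [hfint]; finiteness
  obtain ⟨a, ha⟩ : ∃ a : ℝ, avg c r u = ENNReal.ofReal a :=
    ⟨(avg c r u).toReal, (ENNReal.ofReal_toReal h1).symm⟩
  have ha0 : 0 < a := by
    rw [← ENNReal.ofReal_pos, ← ha]
    exact pos_iff_ne_zero.2 h0
  have hrev : ∀ t : ℝ, a ≤ t → (volume.withDensity f) {x | ENNReal.ofReal t < maximal f x} ≤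
      5 ^ n * ENNReal.ofReal t *
        (volume.restrict (closedBall c (3 * r))) {x | ENNReal.ofReal t < K * u x} := by
    intro t hat
    have ht : 0 < t := ha0.trans_le hat
    have hms : MeasurableSet {x | ENNReal.ofReal t < maximal f x} :=
      measurableSet_lt measurable_const measurable_maximal
    rw [withDensity_apply _ hms]
    refine (setLIntegral_lt_maximal_le hn hffin (by simpa using ht) ENNReal.ofReal_ne_top).trans ?_
    rw [← mul_assoc]
    refine mul_le_mul_right ?_ _
    rw [Measure.restrict_apply₀' measurableSet_closedBall.nullMeasurableSet]
    refine measure_mono_ae ?_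
    filter_upwards [hK] with x hx hxt
    refine ⟨lt_of_lt_of_le hxt (le_trans (mmax_mono (Eventually.of_forall fun y =>
      indicator_le_self' (fun _ _ => zero_le) y) x) hx), ?_⟩
    by_contra hx3
    have := lt_of_lt_of_le (b := maximal f x) hxt (maximal_indicator_le hr hx3)
    rw [ha, ENNReal.ofReal_lt_ofReal_iff'] at this
    linarith [this.1]
  have hsf : SFinite (volume.withDensity f) := inferInstance
  calc ∫⁻ y in closedBall c r, u y ^ (1 + δ)
      = ∫⁻ y, f y * f y ^ δ := by
        rw [← lintegral_indicator measurableSet_closedBall]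
        refine lintegral_congr fun y => ?_
        by_cases hy : y ∈ closedBall c r
        · rw [hf, indicator_of_mem hy, indicator_of_mem hy,
            ENNReal.rpow_add_of_nonneg _ _ zero_le_one hδ.le, ENNReal.rpow_one]
        · simp [hf, indicator_of_notMem hy]
    _ ≤ ∫⁻ y, f y * maximal f y ^ δ := by
        refine lintegral_mono_ae ?_
        filter_upwards [ae_le_maximal hfm hffin] with y hy
        gcongr
    _ = ∫⁻ y, maximal f y ^ δ ∂(volume.withDensity f) := by
        rw [lintegral_withDensity_eq_lintegral_mul₀ hfm (measurable_maximal.pow_const _).aemeasurable]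
        rfl
    _ = _ := lintegral_rpow_eq_layercake measurable_maximal.aemeasurable hδ
    _ ≤ _ := by
        rw [← Ioo_union_Ici_eq_Ioi ha0]
        refine (lintegral_union_le _ _ _).trans (add_le_add ?_ ?_)
        · calc _ ≤ ∫⁻ t in Ioo 0 a, ENNReal.ofReal δ * (∫⁻ x, f x) *
                ENNReal.ofReal (t ^ (δ - 1)) := by
                refine setLIntegral_mono' measurableSet_Ioo fun t ht => ?_
                rw [ENNReal.ofReal_mul hδ.le, mul_right_comm]
                gcongr
                refine (measure_mono (subset_univ _)).trans ?_
                rw [withDensity_apply _ MeasurableSet.univ, setLIntegral_univ]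
            _ = _ := by
                rw [lintegral_const_mul _ (by fun_prop), lintegral_rpow_Ioo hδ ha0.le, hfint,
                  mul_right_comm, ← ENNReal.ofReal_mul hδ.le, mul_div_cancel₀ _ hδ.ne', ha,
                  ← ENNReal.ofReal_rpow_of_pos ha0, mul_left_comm,
                  ENNReal.rpow_add_of_nonneg _ _ zero_le_one hδ.le, ENNReal.rpow_one,
                  mul_comm (ENNReal.ofReal a ^ δ)]
        · rw [lintegral_rpow_eq_layercake (hu.restrict.const_mul _) (by linarith : 0 < 1 + δ),
            ← lintegral_const_mul' _ _ (by finiteness)]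
          refine (setLIntegral_mono' measurableSet_Ici fun t (ht : a ≤ t) => ?_).trans
            (lintegral_mono_set (fun t ht => ha0.trans_le ht))
          have ht0 : 0 < t := ha0.trans_le ht
          refine (mul_le_mul_right (hrev t ht) _).trans ?_
          have key : ENNReal.ofReal (δ * t ^ (δ - 1)) * (5 ^ n * ENNReal.ofReal t) ≤
              5 ^ n * ENNReal.ofReal δ * ENNReal.ofReal ((1 + δ) * t ^ (1 + δ - 1)) := by
            rw [mul_left_comm, mul_assoc, ← ENNReal.ofReal_mul (by positivity),
              ← ENNReal.ofReal_mul hδ.le]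
            refine mul_le_mul_right (ENNReal.ofReal_le_ofReal ?_) _
            rw [add_sub_cancel_left, mul_assoc, ← Real.rpow_add_one ht0.ne', sub_add_cancel]
            gcongr
            exact le_mul_of_one_le_left (by positivity) (by linarith)
          calc _ = ENNReal.ofReal (δ * t ^ (δ - 1)) * (5 ^ n * ENNReal.ofReal t) *
                (volume.restrict (closedBall c (3 * r))) {x | ENNReal.ofReal t < K * u x} := by ring
            _ ≤ _ := mul_le_mul_left key _
            _ = _ := by ring

/-- The reverse Hölder inequality for bounded weights satisfying the `A_1` condition. -/
theorem avg_rpow_le_of_bounded (hn : 0 < n) {K : ℝ≥0} (hK1 : 1 ≤ K) {u : (Fin n → ℝ) → ℝ≥0∞}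
    (hu : AEMeasurable u) (hK : ∀ᵐ x, maximal u x ≤ K * u x) {δ : ℝ} (hδ : 0 < δ) (hδ1 : δ ≤ 1)
    (hδK : (15 ^ n * K ^ 4 : ℝ≥0) * δ ≤ 1 / 2) {a b : ℝ≥0∞} (ha : a ≠ 0) (hb : b ≠ ∞)
    (hau : ∀ x, a ≤ u x) (hbu : ∀ x, u x ≤ b) (c : Fin n → ℝ) {r : ℝ} (hr : 0 < r) :
    avg c r (fun x => u x ^ (1 + δ)) ≤ 2 * avg c r u ^ (1 + δ) := by
  have hδ' : 0 < 1 + δ := by linarith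
  have hlow : ∀ (c : Fin n → ℝ) {r : ℝ}, 0 < r → avg c r u ≠ 0 := fun c r hr h => by
    have := avg_mono (Eventually.of_forall hau) c r
    rw [avg_const hr, h] at this
    exact ha (le_zero_iff.1 this)
  have hupp : ∀ (c : Fin n → ℝ) {r : ℝ}, 0 < r → avg c r u ≠ ∞ := fun c r hr h => by
    have := avg_mono (Eventually.of_forall hbu) c r
    rw [avg_const hr, h] at this
    exact hb (top_le_iff.1 this)
  -- The best constant of the reverse Hölder inequality. The two-sided bounds on `u` make it finite,
  -- so that `A ≤ 1 + A / 2` can be solved for `A`.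
  set A : ℝ≥0∞ := ⨆ (c : Fin n → ℝ) (r : ℝ) (_ : 0 < r),
    avg c r (fun x => u x ^ (1 + δ)) / avg c r u ^ (1 + δ) with hA
  have hle : ∀ (c : Fin n → ℝ) {r : ℝ}, 0 < r →
      avg c r (fun x => u x ^ (1 + δ)) ≤ A * avg c r u ^ (1 + δ) := fun c r hr => by
    rw [← ENNReal.div_le_iff (by simp [hlow c hr, hupp c hr])
      (ENNReal.rpow_ne_top_of_nonneg hδ'.le (hupp c hr))]
    exact le_iSup_of_le c <| le_iSup_of_le r <| le_iSup_of_le hr le_rfl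
  have hAtop : A ≠ ∞ := by
    refine ne_top_of_le_ne_top (b := b ^ (1 + δ) / a ^ (1 + δ)) ?_ ?_
    · refine ENNReal.div_ne_top (ENNReal.rpow_ne_top_of_nonneg hδ'.le hb) ?_
      rw [Ne, ENNReal.rpow_eq_zero_iff]
      rintro (⟨h, -⟩ | ⟨-, h⟩)
      · exact ha h
      · linarith
    · refine iSup_le fun c => iSup_le fun r => iSup_le fun hr => ?_
      refine ENNReal.div_le_div ?_ (ENNReal.rpow_le_rpow ?_ hδ'.le)
      · refine (avg_mono (Eventually.of_forall fun x =>
          ENNReal.rpow_le_rpow (hbu x) hδ'.le) c r).trans (avg_const hr _).le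
      · exact (avg_const hr _).ge.trans (avg_mono (Eventually.of_forall hau) c r)
  have hstep : A ≤ 1 + A / 2 := by
    refine iSup_le fun c => iSup_le fun r => iSup_le fun hr => ?_
    rw [ENNReal.div_le_iff (by simp [hlow c hr, hupp c hr])
      (ENNReal.rpow_ne_top_of_nonneg hδ'.le (hupp c hr))]
    refine avg_le_of_setLIntegral_le hr ?_
    refine (setLIntegral_rpow_le_of_maximal_le hn hu hK hδ hr (hlow c hr) (hupp c hr)).trans ?_
    -- The average over the tripled cube is at most `K u` almost everywhere on the small cube;
    -- averaging this gives doubling.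
    have h3 : avg c (3 * r) u ≤ K * avg c r u := by
      rw [← avg_const (c := c) hr (avg c (3 * r) u), avg_eq_mavg, avg_eq_mavg c r u,
        ← mavg_const_mul ENNReal.coe_ne_top]
      unfold mavg
      refine mul_le_mul_right (lintegral_mono_ae ?_) _
      filter_upwards [ae_restrict_of_ae hK, ae_restrict_mem measurableSet_closedBall] with x hx hxb
      exact (mavg_le_mmax (by positivity) (closedBall_subset_closedBall (by linarith) hxb)).trans hx
    have h4 : ∫⁻ y in closedBall c (3 * r), (K * u y) ^ (1 + δ) ≤
        K ^ (4 : ℕ) * (3 ^ n * volume (closedBall c r)) * (A * avg c r u ^ (1 + δ)) := by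
      have hKp : (K : ℝ≥0∞) ^ (1 + δ) ≤ K ^ (2 : ℕ) := by
        rw [← ENNReal.rpow_natCast]
        exact ENNReal.rpow_le_rpow_of_exponent_le (by exact_mod_cast hK1) (by push_cast; linarith)
      simp_rw [ENNReal.mul_rpow_of_nonneg _ _ hδ'.le]
      rw [lintegral_const_mul' _ _ (by finiteness), setLIntegral_eq_mul_avg _ _ (by positivity),
        volume_closedBall_mul (by norm_num) hr.le c c, ENNReal.ofReal_pow (by norm_num),
        show ENNReal.ofReal 3 = 3 by simp]
      calc _ ≤ (K : ℝ≥0∞) ^ (2 : ℕ) * (3 ^ n * volume (closedBall c r) *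
            (A * (K * avg c r u) ^ (1 + δ))) := by
            gcongr
            refine (hle c (by positivity)).trans ?_
            gcongr
        _ ≤ (K : ℝ≥0∞) ^ (2 : ℕ) * (3 ^ n * volume (closedBall c r) *
            (A * (K ^ (2 : ℕ) * avg c r u ^ (1 + δ)))) := by
            rw [ENNReal.mul_rpow_of_nonneg _ _ hδ'.le]
            gcongr
        _ = _ := by ring
    have h5 : (15 ^ n * K ^ 4 : ℝ≥0∞) * ENNReal.ofReal δ ≤ 2⁻¹ := by
      have : (15 ^ n * K ^ 4 : ℝ≥0∞) * ENNReal.ofReal δ =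
          ENNReal.ofReal ((15 ^ n * K ^ 4 : ℝ≥0) * δ) := by
        rw [ENNReal.ofReal_mul (by positivity), ENNReal.ofReal_coe_nnreal]
        push_cast
        rfl
      rw [this, show (2⁻¹ : ℝ≥0∞) = ENNReal.ofReal (1 / 2) by
        rw [one_div, ENNReal.ofReal_inv_of_pos (by norm_num)]; simp]
      exact ENNReal.ofReal_le_ofReal hδK
    calc _ ≤ volume (closedBall c r) * avg c r u ^ (1 + δ) + 5 ^ n * ENNReal.ofReal δ *
          (K ^ (4 : ℕ) * (3 ^ n * volume (closedBall c r)) * (A * avg c r u ^ (1 + δ))) := by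
          gcongr
      _ = volume (closedBall c r) * avg c r u ^ (1 + δ) + (15 ^ n * K ^ 4 * ENNReal.ofReal δ) *
          (volume (closedBall c r) * (A * avg c r u ^ (1 + δ))) := by
          rw [show (15 : ℝ≥0∞) = 5 * 3 by norm_num, mul_pow]
          ring
      _ ≤ volume (closedBall c r) * avg c r u ^ (1 + δ) + 2⁻¹ *
          (volume (closedBall c r) * (A * avg c r u ^ (1 + δ))) := by
          gcongr
      _ = _ := by rw [ENNReal.div_eq_inv_mul]; ring
  have hA2 : A ≤ 2 := by
    have h2 : A / 2 + A / 2 ≤ 1 + A / 2 := (ENNReal.add_halves A).le.trans hstep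
    have h3 : A / 2 ≤ 1 := (ENNReal.add_le_add_iff_right (ENNReal.div_ne_top hAtop (by norm_num))).1 h2
    have := add_le_add h3 h3
    rwa [ENNReal.add_halves, one_add_one_eq_two] at this
  exact (hle c hr).trans (by gcongr)

/-- The reverse Hölder inequality for `A_1` weights, with an exponent that depends only on the
dimension and the `A_1` constant. -/
theorem exists_reverse_holder (hn : 0 < n) (K : ℝ≥0) : ∃ δ : ℝ, 0 < δ ∧ δ ≤ 1 ∧
    ∀ u : (Fin n → ℝ) → ℝ≥0∞, AEMeasurable u → (∀ᵐ x, maximal u x ≤ K * u x) →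
      ∀ (c : Fin n → ℝ) (r : ℝ), 0 < r →
        avg c r (fun x => u x ^ (1 + δ)) ≤ 2 * avg c r u ^ (1 + δ) := by
  set L : ℝ≥0 := max K 1 with hL
  have hLpos : (0 : ℝ) < (15 ^ n * L ^ 4 : ℝ≥0) := by
    have : 0 < L := lt_of_lt_of_le one_pos (le_max_right _ _)
    positivity
  -- The factor `15 ^ n` collects `5 ^ n` and the `3 ^ n` of the tripled volume. The fourth power
  -- collects two factors `L ^ (1 + δ) ≤ L ^ 2`, one from the `A_1` bound and one from doubling.
  refine ⟨min 1 (1 / 2 / (15 ^ n * L ^ 4 : ℝ≥0)), by positivity, min_le_left _ _, ?_⟩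
  intro u hu hK c r hr
  set δ : ℝ := min 1 (1 / 2 / (15 ^ n * L ^ 4 : ℝ≥0)) with hδdef
  have hδ : 0 < δ := by positivity
  have hδ' : 0 < 1 + δ := by linarith
  have hδK : (15 ^ n * L ^ 4 : ℝ≥0) * δ ≤ 1 / 2 := by
    calc _ ≤ ((15 ^ n * L ^ 4 : ℝ≥0) : ℝ) * (1 / 2 / (15 ^ n * L ^ 4 : ℝ≥0)) := by
          gcongr
          exact min_le_right _ _
      _ = 1 / 2 := mul_div_cancel₀ _ hLpos.ne'
  have htrunc : ∀ (N : ℕ) (ε : ℝ), 0 < ε → avg c r (fun x => (min (u x) N) ^ (1 + δ)) ≤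
      2 * (avg c r u + ENNReal.ofReal ε) ^ (1 + δ) := by
    intro N ε hε
    -- Truncating above and adding a constant preserves the `A_1` condition with constant `L = max K
    -- 1`, so the bounded case applies with a `δ` independent of `N` and `ε`.
    set u' : (Fin n → ℝ) → ℝ≥0∞ := fun x => min (u x) N + ENNReal.ofReal ε with hu'
    have hadd : ∀ (v : (Fin n → ℝ) → ℝ≥0∞) (c : Fin n → ℝ) (r : ℝ), 0 < r →
        avg c r (fun x => v x + ENNReal.ofReal ε) = avg c r v + ENNReal.ofReal ε := by
      intro v c r hr
      conv_rhs => rw [← avg_const (c := c) hr (ENNReal.ofReal ε)]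
      unfold avg
      rw [lintegral_add_right _ measurable_const, mul_add]
    have hmax : ∀ᵐ x, maximal u' x ≤ L * u' x := by
      filter_upwards [hK] with x hx
      refine mmax_le fun c r hr hxc => ?_
      rw [← avg_eq_mavg, hadd _ c r hr, hu', mul_add]
      have hL1 : (1 : ℝ≥0∞) ≤ L := by exact_mod_cast le_max_right K 1
      have hLK : (K : ℝ≥0∞) ≤ L := by exact_mod_cast le_max_left K 1
      refine add_le_add ?_ (le_mul_of_one_le_left zero_le hL1)
      rw [mul_min]
      refine le_min ?_ ?_
      · calc _ ≤ avg c r u := avg_mono (Eventually.of_forall fun x => min_le_left _ _) c r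
          _ ≤ maximal u x := mavg_le_mmax hr hxc
          _ ≤ _ := hx.trans (by gcongr)
      · calc _ ≤ avg c r (fun _ => (N : ℝ≥0∞)) :=
              avg_mono (Eventually.of_forall fun x => min_le_right _ _) c r
          _ = N := avg_const hr _
          _ ≤ _ := le_mul_of_one_le_left zero_le hL1
    calc _ ≤ avg c r (fun x => u' x ^ (1 + δ)) := avg_mono (Eventually.of_forall fun x =>
          ENNReal.rpow_le_rpow le_self_add hδ'.le) c r
      _ ≤ 2 * avg c r u' ^ (1 + δ) := by
          refine avg_rpow_le_of_bounded hn (le_max_right K 1) (by fun_prop) hmax hδ (min_le_left _ _)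
            hδK (a := ENNReal.ofReal ε) (b := N + ENNReal.ofReal ε) (by simpa using hε)
            (by finiteness) (fun x => le_add_self) (fun x => ?_) c hr
          simp only [hu']
          gcongr
          exact min_le_right _ _
      _ ≤ _ := by
          rw [hu', hadd _ c r hr]
          gcongr
          exact avg_mono (Eventually.of_forall fun x => min_le_left _ _) c r
  have htrunc' : ∀ N : ℕ, avg c r (fun x => (min (u x) N) ^ (1 + δ)) ≤ 2 * avg c r u ^ (1 + δ) :=
    fun N => le_of_forall_add_ofReal_le (Φ := fun A => 2 * A ^ (1 + δ))
      (ENNReal.continuous_const_mul (by finiteness) |>.comp ENNReal.continuous_rpow_const)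
      (htrunc N)
  have hsup : avg c r (fun x => u x ^ (1 + δ)) =
      ⨆ N : ℕ, avg c r (fun x => (min (u x) N) ^ (1 + δ)) := by
    unfold avg
    rw [← ENNReal.mul_iSup, ← lintegral_iSup' (fun N => by fun_prop)]
    · congr 1
      refine lintegral_congr fun x => ?_
      have hm : Monotone fun N : ℕ => min (u x) (N : ℝ≥0∞) := fun a b hab =>
        min_le_min_left _ (by exact_mod_cast hab)
      have h1 : ⨆ N : ℕ, min (u x) (N : ℝ≥0∞) = u x := by
        
        rw [← inf_iSup_eq, ENNReal.iSup_natCast, inf_top_eq]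
      have h2 : Tendsto (fun N : ℕ => (min (u x) (N : ℝ≥0∞)) ^ (1 + δ)) atTop
          (𝓝 (u x ^ (1 + δ))) := by
        have := tendsto_atTop_iSup hm
        rw [h1] at this
        exact (ENNReal.continuous_rpow_const.tendsto _).comp this
      exact tendsto_nhds_unique h2 (tendsto_atTop_iSup fun a b hab =>
        ENNReal.rpow_le_rpow (hm hab) hδ'.le)
    · refine Eventually.of_forall fun x a b hab => ENNReal.rpow_le_rpow
        (min_le_min_left _ (by exact_mod_cast hab)) hδ'.le
  rw [hsup]
  exact iSup_le htrunc'

end Muckenhoupt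

namespace Muckenhoupt
open Metric Filter Set
open scoped Topology

variable {n : ℕ} {f g : (Fin n → ℝ) → ℝ≥0∞}

/-! ### Exponential parametrization of `(0, ∞)` -/

/-- `exp t` as an extended nonnegative real. -/
noncomputable def eexp (t : ℝ) : ℝ≥0∞ := ENNReal.ofReal (Real.exp t)

/-- Writing positive finite quantities as exponentials turns identities between products of real
powers into linear identities of exponents, with no side conditions at `0` or `∞`. -/
theorem exists_eq_eexp {x : ℝ≥0∞} (h0 : x ≠ 0) (h1 : x ≠ ∞) : ∃ t, x = eexp t := by
  refine ⟨Real.log x.toReal, ?_⟩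
  rw [eexp, Real.exp_log (ENNReal.toReal_pos h0 h1), ENNReal.ofReal_toReal h1]

theorem eexp_mul (s t : ℝ) : eexp s * eexp t = eexp (s + t) := by
  rw [eexp, eexp, eexp, ← ENNReal.ofReal_mul (Real.exp_pos _).le, Real.exp_add]

theorem eexp_rpow (s p : ℝ) : eexp s ^ p = eexp (s * p) := by
  rw [eexp, eexp, ENNReal.ofReal_rpow_of_pos (Real.exp_pos _), Real.exp_mul]

theorem eexp_inv (s : ℝ) : (eexp s)⁻¹ = eexp (-s) := by
  rw [eexp, eexp, ← ENNReal.ofReal_inv_of_pos (Real.exp_pos _), Real.exp_neg]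

theorem eexp_ne_zero (s : ℝ) : eexp s ≠ 0 := by simp [eexp, Real.exp_pos]

theorem eexp_ne_top (s : ℝ) : eexp s ≠ ∞ := ENNReal.ofReal_ne_top

theorem coe_rpow {x : ℝ≥0} {p : ℝ} (hp : 0 ≤ p) : ((x ^ p : ℝ≥0) : ℝ≥0∞) = (x : ℝ≥0∞) ^ p :=
  (ENNReal.coe_rpow_of_nonneg x hp)

/-! ### Averages -/

theorem avg_congr {c : Fin n → ℝ} {r : ℝ}
    (h : ∀ᵐ y ∂(volume.restrict (closedBall c r)), f y = g y) : avg c r f = avg c r g := by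
  unfold avg
  rw [lintegral_congr_ae h]

theorem avg_mono_restrict {c : Fin n → ℝ} {r : ℝ}
    (h : ∀ᵐ y ∂(volume.restrict (closedBall c r)), f y ≤ g y) : avg c r f ≤ avg c r g :=
  mul_le_mul_right (lintegral_mono_ae h) _

theorem avg_const_mul {a : ℝ≥0∞} (ha : a ≠ ∞) (c : Fin n → ℝ) (r : ℝ) :
    avg c r (fun y => a * f y) = a * avg c r f := mavg_const_mul ha c r

theorem avg_le_maximal {c x : Fin n → ℝ} {r : ℝ} (hr : 0 < r) (hx : x ∈ closedBall c r) :
    avg c r f ≤ maximal f x := mavg_le_mmax hr hx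

theorem avg_rpow_mul_rpow_le (hf : AEMeasurable f) (hg : AEMeasurable g) {a b : ℝ} (ha : 0 ≤ a)
    (hb : 0 ≤ b) (hab : a + b = 1) (c : Fin n → ℝ) {r : ℝ} :
    avg c r (fun y => f y ^ a * g y ^ b) ≤ avg c r f ^ a * avg c r g ^ b := by
  unfold avg
  rw [ENNReal.mul_rpow_of_nonneg _ _ ha, ENNReal.mul_rpow_of_nonneg _ _ hb, mul_mul_mul_comm,
    ← ENNReal.rpow_add_of_nonneg _ _ ha hb, hab, ENNReal.rpow_one]
  gcongr
  exact ENNReal.lintegral_mul_norm_pow_le hf.restrict hg.restrict ha hb hab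

theorem avg_rpow_le (hf : AEMeasurable f) {a : ℝ} (ha : 0 ≤ a) (ha1 : a ≤ 1) (c : Fin n → ℝ) {r : ℝ}
    (hr : 0 < r) : avg c r (fun y => f y ^ a) ≤ avg c r f ^ a := by
  have := avg_rpow_mul_rpow_le hf (g := fun _ => 1) aemeasurable_const ha (sub_nonneg.2 ha1)
    (by ring) c (r := r)
  simpa [avg_const hr] using this

theorem maximal_rpow_mul_rpow_le (hf : AEMeasurable f) (hg : AEMeasurable g) {a b : ℝ} (ha : 0 ≤ a)
    (hb : 0 ≤ b) (hab : a + b = 1) (x : Fin n → ℝ) :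
    maximal (fun y => f y ^ a * g y ^ b) x ≤ maximal f x ^ a * maximal g x ^ b :=
  mmax_le fun c _ hr hx => (avg_rpow_mul_rpow_le hf hg ha hb hab c).trans
    (mul_le_mul' (ENNReal.rpow_le_rpow (avg_le_maximal hr hx) ha)
      (ENNReal.rpow_le_rpow (avg_le_maximal hr hx) hb))

/-! ### Weights -/

theorem IsWeight.congr {w w' : (Fin n → ℝ) → ℝ≥0∞} (hw : IsWeight w) (h : w =ᵐ[volume] w') :
    IsWeight w' where
  aemeasurable := hw.aemeasurable.congr h
  ae_pos := by filter_upwards [hw.ae_pos, h] with x hx hx'; rwa [← hx']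
  ae_lt_top := by filter_upwards [hw.ae_lt_top, h] with x hx hx'; rwa [← hx']
  locally_integrable c r := by
    rw [← lintegral_congr_ae (ae_restrict_of_ae h)]
    exact hw.locally_integrable c r

theorem IsWeight.ae_ne {w : (Fin n → ℝ) → ℝ≥0∞} (hw : IsWeight w) :
    ∀ᵐ x, w x ≠ 0 ∧ w x ≠ ∞ := by
  filter_upwards [hw.ae_pos, hw.ae_lt_top] with x h1 h2 using ⟨h1.ne', h2.ne⟩

theorem avg_ne_zero {w : (Fin n → ℝ) → ℝ≥0∞} (hw : AEMeasurable w) (hpos : ∀ᵐ x, w x ≠ 0)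
    (c : Fin n → ℝ) {r : ℝ} (hr : 0 < r) : avg c r w ≠ 0 := by
  unfold avg
  refine mul_ne_zero (ENNReal.inv_ne_zero.2 (volume_closedBall_lt_top c r).ne) fun h => ?_
  rw [lintegral_eq_zero_iff' hw.restrict] at h
  have h2 : ∀ᵐ x ∂(volume.restrict (closedBall c r)), False := by
    filter_upwards [h, ae_restrict_of_ae hpos] with x h1 h2 using h2 h1
  rw [eventually_false_iff_eq_bot, ae_eq_bot, Measure.restrict_eq_zero] at h2
  exact (volume_closedBall_pos c hr).ne' h2

theorem IsWeight.avg_ne_zero {w : (Fin n → ℝ) → ℝ≥0∞} (hw : IsWeight w) (c : Fin n → ℝ) {r : ℝ}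
    (hr : 0 < r) : avg c r w ≠ 0 :=
  Muckenhoupt.avg_ne_zero hw.aemeasurable (hw.ae_ne.mono fun _ h => h.1) c hr

theorem IsWeight.avg_ne_top {w : (Fin n → ℝ) → ℝ≥0∞} (hw : IsWeight w) (c : Fin n → ℝ) {r : ℝ}
    (hr : 0 < r) : avg c r w ≠ ∞ :=
  ENNReal.mul_ne_top (ENNReal.inv_ne_top.2 (volume_closedBall_pos c hr).ne')
    (hw.locally_integrable c r).ne

/-- The `A_1` condition with constant `K`. -/
structure A1 (K : ℝ≥0) (u : (Fin n → ℝ) → ℝ≥0∞) : Prop where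
  weight : IsWeight u
  le : ∀ᵐ x, maximal u x ≤ K * u x

/-- The `A_p` condition with constant `K`. -/
structure Ap (p : ℝ) (K : ℝ≥0) (w : (Fin n → ℝ) → ℝ≥0∞) : Prop where
  weight : IsWeight w
  le : ∀ (c : Fin n → ℝ) (r : ℝ), 0 < r →
    avg c r w * (avg c r fun y => w y ^ (-(1 / (p - 1)))) ^ (p - 1) ≤ K

theorem isWeight_of_avg_ne_top {w : (Fin n → ℝ) → ℝ≥0∞} (hw : AEMeasurable w)
    (h : ∀ᵐ x, w x ≠ 0 ∧ w x ≠ ∞) (havg : ∀ (c : Fin n → ℝ) (r : ℝ), 0 < r → avg c r w ≠ ∞) :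
    IsWeight w where
  aemeasurable := hw
  ae_pos := h.mono fun x hx => pos_iff_ne_zero.2 hx.1
  ae_lt_top := h.mono fun x hx => lt_top_iff_ne_top.2 hx.2
  locally_integrable c r := by
    refine (lintegral_mono_set (closedBall_subset_closedBall (le_max_left r 1))).trans_lt ?_
    rw [setLIntegral_eq_mul_avg _ _ (by positivity)]
    exact ENNReal.mul_lt_top (volume_closedBall_lt_top _ _)
      (lt_top_iff_ne_top.2 (havg _ _ (by positivity)))

/-- Local integrability is automatic: every cube contains a point where `u` is finite and the `A_1`
bound holds, and that point bounds the average. -/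
theorem A1.of_maximal_le {K : ℝ≥0} {u : (Fin n → ℝ) → ℝ≥0∞} (hu : AEMeasurable u)
    (h : ∀ᵐ x, u x ≠ 0 ∧ u x ≠ ∞) (hK : ∀ᵐ x, maximal u x ≤ K * u x) : A1 K u where
  le := hK
  weight := by
    refine isWeight_of_avg_ne_top hu h fun c r hr => ?_
    have hfreq : ∃ᵐ x ∂(volume : Measure (Fin n → ℝ)), x ∈ closedBall c r := by
      rw [frequently_ae_mem_iff]
      exact (volume_closedBall_pos c hr).ne'
    obtain ⟨x, hxc, hx, hxK⟩ := (hfreq.and_eventually (h.and hK)).exists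
    exact ne_top_of_le_ne_top (ENNReal.mul_ne_top ENNReal.coe_ne_top hx.2)
      ((avg_le_maximal hr hxc).trans hxK)

theorem A1.congr {K : ℝ≥0} {u u' : (Fin n → ℝ) → ℝ≥0∞} (hu : A1 K u) (h : u =ᵐ[volume] u') :
    A1 K u' where
  weight := hu.weight.congr h
  le := by
    rw [maximal_eq_mmax, ← mmax_congr h]
    filter_upwards [hu.le, h] with x h1 h2
    rwa [← h2]

theorem A1.mono {K L : ℝ≥0} {u : (Fin n → ℝ) → ℝ≥0∞} (hu : A1 K u) (h : K ≤ L) : A1 L u where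
  weight := hu.weight
  le := by
    filter_upwards [hu.le] with x hx
    exact hx.trans (by gcongr)

theorem A1.one : A1 (n := n) 1 (fun _ => 1) := by
  refine A1.of_maximal_le aemeasurable_const (Eventually.of_forall fun _ => by simp)
    (Eventually.of_forall fun x => mmax_le fun c r hr _ => ?_)
  rw [← avg_eq_mavg, avg_const hr]
  simp

theorem rpow_ne_zero_top {x : ℝ≥0∞} (hx : x ≠ 0 ∧ x ≠ ∞) (p : ℝ) : x ^ p ≠ 0 ∧ x ^ p ≠ ∞ := by
  obtain ⟨t, rfl⟩ := exists_eq_eexp hx.1 hx.2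
  rw [eexp_rpow]
  exact ⟨eexp_ne_zero _, eexp_ne_top _⟩

theorem mul_ne_zero_top {x y : ℝ≥0∞} (hx : x ≠ 0 ∧ x ≠ ∞) (hy : y ≠ 0 ∧ y ≠ ∞) :
    x * y ≠ 0 ∧ x * y ≠ ∞ :=
  ⟨mul_ne_zero hx.1 hy.1, ENNReal.mul_ne_top hx.2 hy.2⟩

/-- Hölder on each cube: weighted geometric means of `A_1` weights stay in `A_1`. -/
theorem A1.rpow_mul_rpow {K L : ℝ≥0} {u v : (Fin n → ℝ) → ℝ≥0∞} (hu : A1 K u) (hv : A1 L v)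
    {a b : ℝ} (ha : 0 ≤ a) (hb : 0 ≤ b) (hab : a + b = 1) :
    A1 (K ^ a * L ^ b) (fun x => u x ^ a * v x ^ b) := by
  have hum := hu.weight.aemeasurable
  have hvm := hv.weight.aemeasurable
  refine A1.of_maximal_le (by fun_prop) ?_ ?_
  · filter_upwards [hu.weight.ae_ne, hv.weight.ae_ne] with x h1 h2
    exact mul_ne_zero_top (rpow_ne_zero_top h1 _) (rpow_ne_zero_top h2 _)
  · filter_upwards [hu.le, hv.le] with x h1 h2
    refine (maximal_rpow_mul_rpow_le hum hvm ha hb hab x).trans ?_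
    rw [ENNReal.coe_mul, coe_rpow ha, coe_rpow hb, mul_mul_mul_comm,
      ← ENNReal.mul_rpow_of_nonneg _ _ ha, ← ENNReal.mul_rpow_of_nonneg _ _ hb]
    gcongr

theorem A1.rpow {K : ℝ≥0} {u : (Fin n → ℝ) → ℝ≥0∞} (hu : A1 K u) {a : ℝ} (ha : 0 ≤ a)
    (ha1 : a ≤ 1) : A1 (K ^ a) (fun x => u x ^ a) := by
  simpa using hu.rpow_mul_rpow A1.one ha (sub_nonneg.2 ha1) (by ring)

/-- Multiplying an `A_1` weight by a small power of another one. -/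
theorem exists_A1_mul_rpow (hn : 0 < n) (K : ℝ≥0) : ∃ θ₀ : ℝ, 0 < θ₀ ∧ θ₀ < 1 ∧
    ∀ θ : ℝ, 0 ≤ θ → θ ≤ θ₀ → ∀ L : ℝ≥0, ∃ K' : ℝ≥0, ∀ u v : (Fin n → ℝ) → ℝ≥0∞,
      A1 K u → A1 L v → A1 K' (fun x => u x * v x ^ θ) := by
  obtain ⟨δ, hδ, -, hrh⟩ := exists_reverse_holder hn K
  have hδ' : 0 < 1 + δ := by linarith
  -- By reverse Hölder `u ^ (1 + δ)` is in `A_1`, and `u v^θ` is the geometric mean of it and `v ^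
  -- (θ (1 + δ) / δ)`. The latter exponent is at most one exactly when `θ ≤ δ / (1 + δ)`, a
  -- threshold independent of the constant `L` of `v`.
  refine ⟨δ / (1 + δ), by positivity, by rw [div_lt_one hδ']; linarith, fun θ hθ hθ' L => ?_⟩
  have hη : θ * (1 + δ) / δ ≤ 1 := by
    rw [div_le_one hδ]
    rwa [le_div_iff₀ hδ'] at hθ'
  refine ⟨(2 * K ^ (1 + δ)) ^ (1 / (1 + δ)) * (L ^ (θ * (1 + δ) / δ)) ^ (δ / (1 + δ)),
    fun u v hu hv => ?_⟩
  have hum := hu.weight.aemeasurable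
  have h1 : A1 (2 * K ^ (1 + δ)) (fun x => u x ^ (1 + δ)) := by
    refine A1.of_maximal_le (by fun_prop) ?_ ?_
    · filter_upwards [hu.weight.ae_ne] with x h1 using rpow_ne_zero_top h1 _
    · filter_upwards [hu.le] with x hx
      refine mmax_le fun c r hr hxc => (hrh u hum hu.le c r hr).trans ?_
      rw [ENNReal.coe_mul, coe_rpow hδ'.le, mul_assoc, ← ENNReal.mul_rpow_of_nonneg _ _ hδ'.le]
      simp only [ENNReal.coe_ofNat]
      gcongr
      exact (avg_le_maximal hr hxc).trans hx
  have h2 := h1.rpow_mul_rpow (hv.rpow (by positivity) hη) (a := 1 / (1 + δ)) (b := δ / (1 + δ))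
    (by positivity) (by positivity) (by field_simp)
  refine h2.congr ?_
  filter_upwards [hu.weight.ae_ne, hv.weight.ae_ne] with x hx hx'
  obtain ⟨s, hs⟩ := exists_eq_eexp hx.1 hx.2
  obtain ⟨t, ht⟩ := exists_eq_eexp hx'.1 hx'.2
  simp only [hs, ht, eexp_rpow, eexp_mul]
  congr 1
  field_simp

theorem A1.ae_avg_le {K : ℝ≥0} {u : (Fin n → ℝ) → ℝ≥0∞} (hu : A1 K u) (c : Fin n → ℝ) {r : ℝ}
    (hr : 0 < r) : ∀ᵐ y ∂(volume.restrict (closedBall c r)), avg c r u ≤ K * u y := by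
  filter_upwards [ae_restrict_of_ae hu.le, ae_restrict_mem measurableSet_closedBall] with y h1 h2
  exact (avg_le_maximal hr h2).trans h1

theorem A1.ne_zero {K : ℝ≥0} {u : (Fin n → ℝ) → ℝ≥0∞} (hu : A1 K u) : K ≠ 0 := by
  rintro rfl
  obtain ⟨x, hx⟩ := hu.le.exists
  have h0 : maximal u x = 0 := by simpa using hx
  exact hu.weight.avg_ne_zero x one_pos (le_zero_iff.1 (h0 ▸ avg_le_maximal one_pos (by simp)))

theorem rpow_neg_le_of_le_mul {A K x : ℝ≥0∞} (hA : A ≠ 0 ∧ A ≠ ∞) (hK : K ≠ 0 ∧ K ≠ ∞)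
    (h : A ≤ K * x) {e : ℝ} (he : 0 ≤ e) : x ^ (-e) ≤ K ^ e * A ^ (-e) := by
  have h1 : (K * x) ^ (-e) ≤ A ^ (-e) := by
    rw [ENNReal.rpow_neg, ENNReal.rpow_neg]
    exact ENNReal.inv_le_inv.2 (ENNReal.rpow_le_rpow h he)
  rw [ENNReal.mul_rpow_of_ne_zero hK.1 (by rintro rfl; simp at h; exact hA.1 h)] at h1
  calc x ^ (-e) = K ^ e * (K ^ (-e) * x ^ (-e)) := by
        rw [← mul_assoc, ← ENNReal.rpow_add _ _ hK.1 hK.2]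
        simp
    _ ≤ _ := by gcongr

theorem A1.ae_rpow_neg_le {K : ℝ≥0} {u : (Fin n → ℝ) → ℝ≥0∞} (hu : A1 K u) (c : Fin n → ℝ) {r : ℝ}
    (hr : 0 < r) {e : ℝ} (he : 0 ≤ e) :
    ∀ᵐ y ∂(volume.restrict (closedBall c r)), u y ^ (-e) ≤ (K : ℝ≥0∞) ^ e * avg c r u ^ (-e) := by
  filter_upwards [hu.ae_avg_le c hr] with y h
  exact rpow_neg_le_of_le_mul ⟨hu.weight.avg_ne_zero c hr, hu.weight.avg_ne_top c hr⟩
    ⟨by simpa using hu.ne_zero, ENNReal.coe_ne_top⟩ h he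

theorem A1.mul_rpow_neg_ne_top {K : ℝ≥0} {u : (Fin n → ℝ) → ℝ≥0∞} (hu : A1 K u) (c : Fin n → ℝ)
    {r : ℝ} (hr : 0 < r) {e : ℝ} (he : 0 ≤ e) : (K : ℝ≥0∞) ^ e * avg c r u ^ (-e) ≠ ∞ :=
  ENNReal.mul_ne_top (ENNReal.rpow_ne_top_of_nonneg he ENNReal.coe_ne_top)
    (rpow_ne_zero_top ⟨hu.weight.avg_ne_zero c hr, hu.weight.avg_ne_top c hr⟩ (-e)).2

/-- An `A_1` weight is bounded below on a cube by its average over `K`, so a negative power of it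
leaves the integral as a constant. -/
theorem avg_mul_rpow_neg_le {K : ℝ≥0} {u w : (Fin n → ℝ) → ℝ≥0∞} (hu : A1 K u)
    (c : Fin n → ℝ) {r : ℝ} (hr : 0 < r) {e : ℝ} (he : 0 ≤ e) :
    avg c r (fun y => w y * u y ^ (-e)) ≤ (K : ℝ≥0∞) ^ e * avg c r u ^ (-e) * avg c r w := by
  rw [← avg_const_mul (hu.mul_rpow_neg_ne_top c hr he)]
  refine avg_mono_restrict ?_
  filter_upwards [hu.ae_rpow_neg_le c hr he] with y hy
  rw [mul_comm]
  gcongr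

/-- The easy direction of Jones' theorem: in each of the two averages the factor with negative
exponent comes out, and the averages of `u` and `ω` then cancel. -/
theorem A1.ap {K L : ℝ≥0} {u ω : (Fin n → ℝ) → ℝ≥0∞} (hu : A1 K u) (hω : A1 L ω) {e : ℝ}
    (he : 0 < e) : Ap (1 + e) (K * L ^ e) (fun x => u x * ω x ^ (-e)) := by
  have hum := hu.weight.aemeasurable
  have hωm := hω.weight.aemeasurable
  refine ⟨isWeight_of_avg_ne_top (by fun_prop) ?_ fun c r hr => ?_, fun c r hr => ?_⟩
  · filter_upwards [hu.weight.ae_ne, hω.weight.ae_ne] with x h1 h2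
    exact mul_ne_zero_top h1 (rpow_ne_zero_top h2 _)
  · exact ne_top_of_le_ne_top (ENNReal.mul_ne_top (hω.mul_rpow_neg_ne_top c hr he.le)
      (hu.weight.avg_ne_top c hr)) (avg_mul_rpow_neg_le hω c hr he.le)
  · have h1 : avg c r (fun y => (u y * ω y ^ (-e)) ^ (-(1 / (1 + e - 1)))) ≤
        (K : ℝ≥0∞) ^ (1 / e) * avg c r u ^ (-(1 / e)) * avg c r ω := by
      refine le_trans (le_of_eq (avg_congr ?_)) (avg_mul_rpow_neg_le hu c hr (e := 1 / e)
        (by positivity))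
      filter_upwards [ae_restrict_of_ae hu.weight.ae_ne, ae_restrict_of_ae hω.weight.ae_ne]
        with x hx hx'
      obtain ⟨s, hs⟩ := exists_eq_eexp hx.1 hx.2
      obtain ⟨t, ht⟩ := exists_eq_eexp hx'.1 hx'.2
      simp only [hs, ht, eexp_rpow, eexp_mul]
      congr 1
      rw [add_sub_cancel_left]
      field_simp
      ring
    refine (mul_le_mul' (avg_mul_rpow_neg_le hω c hr he.le)
      (ENNReal.rpow_le_rpow h1 (by linarith))).trans (le_of_eq ?_)
    obtain ⟨s, hs⟩ := exists_eq_eexp (hu.weight.avg_ne_zero c hr) (hu.weight.avg_ne_top c hr)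
    obtain ⟨t, ht⟩ := exists_eq_eexp (hω.weight.avg_ne_zero c hr) (hω.weight.avg_ne_top c hr)
    obtain ⟨k, hk⟩ := exists_eq_eexp (ENNReal.coe_ne_zero.2 hu.ne_zero) ENNReal.coe_ne_top
    obtain ⟨l, hl⟩ := exists_eq_eexp (ENNReal.coe_ne_zero.2 hω.ne_zero) ENNReal.coe_ne_top
    simp only [ENNReal.coe_mul, coe_rpow he.le, hs, ht, hk, hl, eexp_rpow, eexp_mul]
    congr 1
    rw [add_sub_cancel_left]
    field_simp
    ring

/-- The price of a factor `ω ^ (-e)` is `e` units of the exponent: it is pulled out of the first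
average, and Hölder splits the dual average so that the powers of the average of `ω` cancel. This
serves the downward extrapolation. -/
theorem Ap.mul_rpow_neg {s : ℝ} (hs : 1 < s) {K L : ℝ≥0} {w ω : (Fin n → ℝ) → ℝ≥0∞}
    (hw : Ap s K w) (hω : A1 L ω) {e : ℝ} (he : 0 < e) :
    Ap (s + e) (K * L ^ e) (fun x => w x * ω x ^ (-e)) := by
  have hwm := hw.weight.aemeasurable
  have hωm := hω.weight.aemeasurable
  refine ⟨isWeight_of_avg_ne_top (by fun_prop) ?_ fun c r hr => ?_, fun c r hr => ?_⟩
  · filter_upwards [hw.weight.ae_ne, hω.weight.ae_ne] with x h1 h2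
    exact mul_ne_zero_top h1 (rpow_ne_zero_top h2 _)
  · exact ne_top_of_le_ne_top (ENNReal.mul_ne_top (hω.mul_rpow_neg_ne_top c hr he.le)
      (hw.weight.avg_ne_top c hr)) (avg_mul_rpow_neg_le hω c hr he.le)
  · have hs1 : 0 < s - 1 := by linarith
    have hse : 0 < s + e - 1 := by linarith
    have h1 : avg c r (fun y => (w y * ω y ^ (-e)) ^ (-(1 / (s + e - 1)))) ≤
        (avg c r fun y => w y ^ (-(1 / (s - 1)))) ^ ((s - 1) / (s + e - 1)) *
          avg c r ω ^ (e / (s + e - 1)) := by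
      refine le_trans (le_of_eq (avg_congr ?_)) (avg_rpow_mul_rpow_le (by fun_prop) hωm
        (by positivity) (by positivity) (by field_simp; ring) c)
      filter_upwards [ae_restrict_of_ae hw.weight.ae_ne, ae_restrict_of_ae hω.weight.ae_ne]
        with x hx hx'
      obtain ⟨s, hs⟩ := exists_eq_eexp hx.1 hx.2
      obtain ⟨t, ht⟩ := exists_eq_eexp hx'.1 hx'.2
      simp only [hs, ht, eexp_rpow, eexp_mul]
      congr 1
      field_simp
      ring
    obtain ⟨t, ht⟩ := exists_eq_eexp (hω.weight.avg_ne_zero c hr) (hω.weight.avg_ne_top c hr)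
    calc _ ≤ ((L : ℝ≥0∞) ^ e * avg c r ω ^ (-e) * avg c r w) *
          ((avg c r fun y => w y ^ (-(1 / (s - 1)))) ^ ((s - 1) / (s + e - 1)) *
          avg c r ω ^ (e / (s + e - 1))) ^ (s + e - 1) :=
          mul_le_mul' (avg_mul_rpow_neg_le hω c hr he.le) (ENNReal.rpow_le_rpow h1 hse.le)
      _ = (avg c r w * (avg c r fun y => w y ^ (-(1 / (s - 1)))) ^ (s - 1)) * (L : ℝ≥0∞) ^ e *
          (avg c r ω ^ (-e) * avg c r ω ^ e) := by
          rw [ENNReal.mul_rpow_of_nonneg _ _ hse.le, ← ENNReal.rpow_mul, ← ENNReal.rpow_mul,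
            div_mul_cancel₀ _ hse.ne', div_mul_cancel₀ _ hse.ne']
          ring
      _ ≤ K * (L : ℝ≥0∞) ^ e * 1 := by
          gcongr
          · exact hw.le c r hr
          · rw [ht, eexp_rpow, eexp_rpow, eexp_mul]
            simp [eexp]
      _ = _ := by rw [mul_one, ENNReal.coe_mul, coe_rpow he.le]

end Muckenhoupt

namespace Muckenhoupt
open Metric Filter Set
open scoped Topology

variable {n : ℕ} {f g : (Fin n → ℝ) → ℝ≥0∞}

/-! ### The `A_p` classes -/

theorem one_sub_conj {q : ℝ} (hq : 1 < q) : 1 - q / (q - 1) = -(1 / (q - 1)) := by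
  have : q - 1 ≠ 0 := by linarith
  field_simp
  ring

theorem Ap.isAq {q : ℝ} (hq : 1 < q) {K : ℝ≥0} {w : (Fin n → ℝ) → ℝ≥0∞} (hw : Ap q K w) :
    IsAq q w := by
  refine ⟨hw.weight, lt_of_le_of_lt (b := (K : ℝ≥0∞)) ?_ ENNReal.coe_lt_top⟩
  refine iSup_le fun c => iSup_le fun r => iSup_le fun hr => ?_
  rw [one_sub_conj hq]
  exact hw.le c r hr

theorem IsAq.exists_ap {q : ℝ} (hq : 1 < q) {w : (Fin n → ℝ) → ℝ≥0∞} (hw : IsAq q w) :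
    ∃ K : ℝ≥0, Ap q K w := by
  refine ⟨(aqConst q w).toNNReal, hw.1, fun c r hr => ?_⟩
  rw [ENNReal.coe_toNNReal hw.2.ne, ← one_sub_conj hq]
  exact le_iSup_of_le c <| le_iSup_of_le r <| le_iSup_of_le hr le_rfl

theorem Ap.congr {p : ℝ} {K : ℝ≥0} {w w' : (Fin n → ℝ) → ℝ≥0∞} (hw : Ap p K w)
    (h : w =ᵐ[volume] w') : Ap p K w' := by
  refine ⟨hw.weight.congr h, fun c r hr => ?_⟩
  rw [← avg_congr (ae_restrict_of_ae h), ← avg_congr (f := fun y => w y ^ (-(1 / (p - 1))))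
    (g := fun y => w' y ^ (-(1 / (p - 1))))]
  · exact hw.le c r hr
  · filter_upwards [ae_restrict_of_ae h] with x hx
    rw [hx]

/-- Jensen for the dual averages; it allows different weights to be brought to a common exponent. -/
theorem Ap.mono_exponent {p q : ℝ} (hp : 1 < p) (hpq : p ≤ q) {K : ℝ≥0}
    {w : (Fin n → ℝ) → ℝ≥0∞} (hw : Ap p K w) : Ap q K w := by
  refine ⟨hw.weight, fun c r hr => le_trans ?_ (hw.le c r hr)⟩
  have hwm := hw.weight.aemeasurable
  have hp1 : 0 < p - 1 := by linarith
  have hq1 : 0 < q - 1 := by linarith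
  gcongr
  have h := avg_rpow_le (f := fun y => w y ^ (-(1 / (p - 1)))) (by fun_prop)
    (a := (p - 1) / (q - 1)) (by positivity) (by rw [div_le_one hq1]; linarith) c hr
  calc _ ≤ ((avg c r fun y => w y ^ (-(1 / (p - 1)))) ^ ((p - 1) / (q - 1))) ^ (q - 1) := by
        refine ENNReal.rpow_le_rpow (le_trans (le_of_eq ?_) h) hq1.le
        congr 1
        ext y
        rw [← ENNReal.rpow_mul]
        congr 1
        field_simp
    _ = _ := by rw [← ENNReal.rpow_mul, div_mul_cancel₀ _ hq1.ne']

theorem Ap.isWeight_dual {p : ℝ} (hp : 1 < p) {K : ℝ≥0} {w : (Fin n → ℝ) → ℝ≥0∞} (hw : Ap p K w) :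
    IsWeight (fun x => w x ^ (-(1 / (p - 1)))) := by
  have hwm := hw.weight.aemeasurable
  refine isWeight_of_avg_ne_top (by fun_prop) (hw.weight.ae_ne.mono fun x hx =>
    rpow_ne_zero_top hx _) fun c r hr h => ?_
  have := hw.le c r hr
  rw [h, ENNReal.top_rpow_of_pos (by linarith), ENNReal.mul_top (hw.weight.avg_ne_zero c hr)] at this
  exact ENNReal.coe_ne_top (top_le_iff.1 this)

theorem Ap.dual {p : ℝ} (hp : 1 < p) {K : ℝ≥0} {w : (Fin n → ℝ) → ℝ≥0∞} (hw : Ap p K w) :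
    Ap (p / (p - 1)) (K ^ (1 / (p - 1))) (fun x => w x ^ (-(1 / (p - 1)))) := by
  have hp1 : 0 < p - 1 := by linarith
  have he : p / (p - 1) - 1 = 1 / (p - 1) := by field_simp; ring
  refine ⟨hw.isWeight_dual hp, fun c r hr => ?_⟩
  rw [he]
  have h1 : avg c r (fun y => (w y ^ (-(1 / (p - 1)))) ^ (-(1 / (1 / (p - 1))))) = avg c r w := by
    refine avg_congr (Eventually.of_forall fun y => ?_)
    rw [← ENNReal.rpow_mul, show -(1 / (p - 1)) * -(1 / (1 / (p - 1))) = 1 by field_simp,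
      ENNReal.rpow_one]
  rw [h1, coe_rpow (by positivity)]
  calc _ = (avg c r w * (avg c r fun y => w y ^ (-(1 / (p - 1)))) ^ (p - 1)) ^ (1 / (p - 1)) := by
        rw [ENNReal.mul_rpow_of_nonneg _ _ (by positivity), ← ENNReal.rpow_mul,
          mul_one_div_cancel hp1.ne', ENNReal.rpow_one, mul_comm]
    _ ≤ _ := ENNReal.rpow_le_rpow (hw.le c r hr) (by positivity)

/-! ### `A_p` weights as doubling measures, Muckenhoupt's theorem and the Fujii-Wilson constant -/

theorem withDensity_closedBall (w : (Fin n → ℝ) → ℝ≥0∞) (c : Fin n → ℝ) {r : ℝ} (hr : 0 < r) :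
    (volume.withDensity w) (closedBall c r) = volume (closedBall c r) * avg c r w := by
  rw [withDensity_apply _ measurableSet_closedBall, setLIntegral_eq_mul_avg _ _ hr]

theorem setLIntegral_withDensity {w : (Fin n → ℝ) → ℝ≥0∞} (hw : AEMeasurable w)
    (hf : AEMeasurable f) {s : Set (Fin n → ℝ)} (hs : MeasurableSet s) :
    ∫⁻ x in s, f x ∂(volume.withDensity w) = ∫⁻ x in s, w x * f x := by
  rw [restrict_withDensity hs, lintegral_withDensity_eq_lintegral_mul₀ hw.restrict hf.restrict]
  rfl

theorem one_le_avg_mul_avg {p : ℝ} (hp : 1 < p) {w : (Fin n → ℝ) → ℝ≥0∞} (hw : IsWeight w)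
    (c : Fin n → ℝ) {r : ℝ} (hr : 0 < r) :
    1 ≤ avg c r w * (avg c r fun y => w y ^ (-(1 / (p - 1)))) ^ (p - 1) := by
  have hp1 : 0 < p - 1 := by linarith
  have hwm := hw.aemeasurable
  have h := avg_rpow_mul_rpow_le (f := w) (g := fun y => w y ^ (-(1 / (p - 1)))) hwm (by fun_prop)
    (a := 1 / p) (b := (p - 1) / p) (by positivity) (by positivity) (by field_simp; ring) c (r := r)
  have h1 : avg c r (fun y => w y ^ (1 / p) * (w y ^ (-(1 / (p - 1)))) ^ ((p - 1) / p)) = 1 := by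
    rw [← avg_const (c := c) hr 1]
    refine avg_congr ?_
    filter_upwards [ae_restrict_of_ae hw.ae_ne] with x hx
    obtain ⟨s, hs⟩ := exists_eq_eexp hx.1 hx.2
    simp only [hs, eexp_rpow, eexp_mul]
    rw [show s * (1 / p) + s * -(1 / (p - 1)) * ((p - 1) / p) = 0 by field_simp; ring]
    simp [eexp]
  rw [h1] at h
  have h2 := ENNReal.rpow_le_rpow h (by linarith : 0 ≤ p)
  rwa [ENNReal.one_rpow, ENNReal.mul_rpow_of_nonneg _ _ (by linarith), ← ENNReal.rpow_mul,
    ← ENNReal.rpow_mul, one_div_mul_cancel (by linarith), div_mul_cancel₀ _ (by linarith),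
    ENNReal.rpow_one] at h2

/-- The `A_p` product is at least one on the small cube by Hölder and at most `K` on the enlarged
one, while the dual average grows by at most `5 ^ n` when passing to the enlarged cube. -/
theorem Ap.isDoubling {p : ℝ} (hp : 1 < p) {K : ℝ≥0} {w : (Fin n → ℝ) → ℝ≥0∞} (hw : Ap p K w) :
    IsDoubling (volume.withDensity w) (K * (5 ^ n) ^ p) where
  pos c r hr := by
    rw [withDensity_closedBall _ _ hr]
    exact ENNReal.mul_pos (volume_closedBall_pos c hr).ne' (hw.weight.avg_ne_zero c hr)
  lt_top c r := by
    rw [withDensity_apply _ measurableSet_closedBall]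
    exact hw.weight.locally_integrable c r
  le_mul c r hr := by
    have hp1 : 0 < p - 1 := by linarith
    have hr5 : 0 < 5 * r := by positivity
    set σ : (Fin n → ℝ) → ℝ≥0∞ := fun y => w y ^ (-(1 / (p - 1))) with hσ
    have h1 := hw.le c (5 * r) hr5
    have h2 : 1 ≤ avg c r w * (5 ^ n * avg c (5 * r) σ) ^ (p - 1) := by
      refine (one_le_avg_mul_avg hp hw.weight c hr).trans ?_
      gcongr
      refine (avg_le_mul_avg (c' := c) (k := 5) hr (by norm_num)
        (closedBall_subset_closedBall (by linarith))).trans (le_of_eq ?_)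
      rw [ENNReal.ofReal_pow (by norm_num), show ENNReal.ofReal 5 = 5 by simp]
    rw [withDensity_closedBall _ _ hr5, withDensity_closedBall _ _ hr,
      volume_closedBall_mul (by norm_num) hr.le c c, ENNReal.ofReal_pow (by norm_num),
      show ENNReal.ofReal 5 = 5 by simp]
    calc 5 ^ n * volume (closedBall c r) * avg c (5 * r) w
        ≤ 5 ^ n * volume (closedBall c r) * avg c (5 * r) w *
          (avg c r w * (5 ^ n * avg c (5 * r) σ) ^ (p - 1)) := le_mul_of_one_le_right zero_le h2
      _ = (avg c (5 * r) w * avg c (5 * r) σ ^ (p - 1)) * (5 ^ n * (5 ^ n) ^ (p - 1)) *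
          (volume (closedBall c r) * avg c r w) := by
          rw [ENNReal.mul_rpow_of_nonneg _ _ hp1.le]
          ring
      _ ≤ K * (5 ^ n * (5 ^ n) ^ (p - 1)) * (volume (closedBall c r) * avg c r w) := by
          gcongr
      _ = _ := by
          have h5 : (5 ^ n : ℝ≥0∞) * (5 ^ n) ^ (p - 1) = (5 ^ n) ^ p := by
            nth_rewrite 1 [← ENNReal.rpow_one (5 ^ n)]
            rw [← ENNReal.rpow_add_of_nonneg _ _ zero_le_one hp1.le]
            ring_nf
          rw [h5, ENNReal.coe_mul, coe_rpow (by linarith)]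
          push_cast
          ring

/-- Lerner's pointwise bound, with `σ = w ^ (-(1 / (p - 1)))`. An average of `f` is the average of
`σ` times a `σ`-average `A` of `f / σ`, and `A` is at most the `σ`-maximal function throughout the
cube. Hence `A ^ (p - 1)` divided by the average of `w` is at most a `w`-average, and the `A_p`
condition joins the two. -/
theorem rpow_maximal_le {p : ℝ} (hp : 1 < p) {K : ℝ≥0} {w : (Fin n → ℝ) → ℝ≥0∞} (hw : Ap p K w)
    (hf : AEMeasurable f) (x : Fin n → ℝ) :
    maximal f x ^ (p - 1) ≤ K * mmax (volume.withDensity w) (fun y =>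
      mmax (volume.withDensity fun z => w z ^ (-(1 / (p - 1))))
        (fun z => (w z ^ (-(1 / (p - 1))))⁻¹ * f z) y ^ (p - 1) * (w y)⁻¹) x := by
  have hp1 : 0 < p - 1 := by linarith
  set σ : (Fin n → ℝ) → ℝ≥0∞ := fun y => w y ^ (-(1 / (p - 1))) with hσ
  have hσw : IsWeight σ := hw.isWeight_dual hp
  have hσm := hσw.aemeasurable
  have hwm := hw.weight.aemeasurable
  have hσd := (hw.dual hp).isDoubling (by rw [lt_div_iff₀ hp1]; linarith)
  set m₁ := mmax (volume.withDensity σ) (fun z => (σ z)⁻¹ * f z) with hm₁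
  have hm₁m : Measurable m₁ := hσd.measurable_mmax
  have hroot : ∀ A B : ℝ≥0∞, A ^ (p - 1) ≤ B ↔ A ≤ B ^ (1 / (p - 1)) := fun A B => by
    rw [one_div, ENNReal.le_rpow_inv_iff hp1]
  rw [hroot]
  refine mmax_le fun c r hr hx => ?_
  rw [← hroot, ← avg_eq_mavg]
  refine le_trans ?_ (mul_le_mul_right (mavg_le_mmax hr hx) _)
  have hV0 := (volume_closedBall_pos c hr).ne'
  have hV1 := (volume_closedBall_lt_top c r).ne
  have hw0 := hw.weight.avg_ne_zero c hr
  have hw1 := hw.weight.avg_ne_top c hr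
  have hσ0 := hσw.avg_ne_zero c hr
  have hσ1 := hσw.avg_ne_top c hr
  set A := mavg (volume.withDensity σ) c r (fun z => (σ z)⁻¹ * f z) with hA
  have hfA : avg c r f = avg c r σ * A := by
    rw [hA, mavg, setLIntegral_withDensity hσm (by fun_prop) measurableSet_closedBall,
      withDensity_closedBall _ _ hr, ENNReal.mul_inv (Or.inl hV0) (Or.inl hV1)]
    have : ∫⁻ z in closedBall c r, σ z * ((σ z)⁻¹ * f z) = ∫⁻ z in closedBall c r, f z := by
      refine lintegral_congr_ae ?_
      filter_upwards [ae_restrict_of_ae hσw.ae_ne] with z hz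
      rw [← mul_assoc, ENNReal.mul_inv_cancel hz.1 hz.2, one_mul]
    rw [this, mul_comm (volume _)⁻¹, mul_assoc, ← mul_assoc, ENNReal.mul_inv_cancel hσ0 hσ1, one_mul]
    rfl
  have hGA : A ^ (p - 1) * (avg c r w)⁻¹ ≤
      mavg (volume.withDensity w) c r (fun y => m₁ y ^ (p - 1) * (w y)⁻¹) := by
    rw [mavg, setLIntegral_withDensity hwm (by fun_prop) measurableSet_closedBall,
      withDensity_closedBall _ _ hr, ENNReal.mul_inv (Or.inl hV0) (Or.inl hV1)]
    have : volume (closedBall c r) * A ^ (p - 1) ≤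
        ∫⁻ y in closedBall c r, w y * (m₁ y ^ (p - 1) * (w y)⁻¹) := by
      rw [mul_comm, ← setLIntegral_const]
      refine lintegral_mono_ae ?_
      filter_upwards [ae_restrict_of_ae hw.weight.ae_ne, ae_restrict_mem measurableSet_closedBall]
        with y hy hyc
      rw [mul_left_comm, ENNReal.mul_inv_cancel hy.1 hy.2, mul_one]
      exact ENNReal.rpow_le_rpow (mavg_le_mmax hr hyc) hp1.le
    refine le_trans (le_of_eq ?_) (mul_le_mul_right this _)
    calc _ = (volume (closedBall c r))⁻¹ * volume (closedBall c r) * (A ^ (p - 1) *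
          (avg c r w)⁻¹) := by rw [ENNReal.inv_mul_cancel hV0 hV1, one_mul]
      _ = _ := by ring
  calc avg c r f ^ (p - 1) = avg c r σ ^ (p - 1) * A ^ (p - 1) := by
        rw [hfA, ENNReal.mul_rpow_of_nonneg _ _ hp1.le]
    _ = (avg c r w * avg c r σ ^ (p - 1)) * (A ^ (p - 1) * (avg c r w)⁻¹) := by
        rw [mul_comm (A ^ (p - 1)) (avg c r w)⁻¹, mul_comm (avg c r w), mul_assoc,
          ← mul_assoc (avg c r w), ENNReal.mul_inv_cancel hw0 hw1, one_mul]
    _ ≤ _ := mul_le_mul' (hw.le c r hr) hGA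

/-- Muckenhoupt's theorem. -/
theorem exists_lintegral_maximal_rpow_le (n : ℕ) {p : ℝ} (hp : 1 < p) (K : ℝ≥0) :
    ∃ C : ℝ≥0, 1 ≤ C ∧ ∀ w f : (Fin n → ℝ) → ℝ≥0∞, Ap p K w → AEMeasurable f →
      ∫⁻ x, maximal f x ^ p * w x ≤ C * ∫⁻ x, f x ^ p * w x := by
  have hp1 : 0 < p - 1 := by linarith
  have hq : 1 < p / (p - 1) := by rw [lt_div_iff₀ hp1]; linarith
  obtain ⟨C₁, hC₁, h₁⟩ := exists_lintegral_mmax_rpow_le n (K * (5 ^ n) ^ p) hq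
  obtain ⟨C₂, hC₂, h₂⟩ := exists_lintegral_mmax_rpow_le n
    (K ^ (1 / (p - 1)) * (5 ^ n) ^ (p / (p - 1))) hp
  refine ⟨max 1 (K ^ (p / (p - 1)) * C₁ * C₂), le_max_left _ _, fun w f hw hf => ?_⟩
  set σ : (Fin n → ℝ) → ℝ≥0∞ := fun y => w y ^ (-(1 / (p - 1))) with hσ
  have hσw : IsWeight σ := hw.isWeight_dual hp
  have hσm := hσw.aemeasurable
  have hwm := hw.weight.aemeasurable
  have hwd := hw.isDoubling hp
  have hσd := (hw.dual hp).isDoubling hq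
  set m₁ := mmax (volume.withDensity σ) (fun z => (σ z)⁻¹ * f z) with hm₁
  have hm₁m : Measurable m₁ := hσd.measurable_mmax
  set G : (Fin n → ℝ) → ℝ≥0∞ := fun y => m₁ y ^ (p - 1) * (w y)⁻¹ with hG
  have hGm : AEMeasurable G := by fun_prop
  have hFm : AEMeasurable (fun z => (σ z)⁻¹ * f z) := by fun_prop
  have hconv : ∀ {v F : (Fin n → ℝ) → ℝ≥0∞}, AEMeasurable v → AEMeasurable F →
      ∫⁻ x, F x ∂(volume.withDensity v) = ∫⁻ x, v x * F x := fun hv hF => by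
    rw [lintegral_withDensity_eq_lintegral_mul₀ hv hF]
    rfl
  -- With `p' = p / (p - 1)`, the operator for `w` is used on `L^{p'}(w)` and the one for `σ` on
  -- `L^p(σ)`; the link is `G ^ p' w = m₁ ^ p σ`.
  have s1 : ∫⁻ x, maximal f x ^ p * w x ≤ (K : ℝ≥0∞) ^ (p / (p - 1)) *
      ∫⁻ x, mmax (volume.withDensity w) G x ^ (p / (p - 1)) ∂(volume.withDensity w) := by
    have hMm : Measurable (mmax (volume.withDensity w) G) := hwd.measurable_mmax
    rw [hconv hwm (by fun_prop), ← lintegral_const_mul' _ _ (by finiteness)]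
    refine lintegral_mono fun x => ?_
    calc maximal f x ^ p * w x = (maximal f x ^ (p - 1)) ^ (p / (p - 1)) * w x := by
          rw [← ENNReal.rpow_mul, mul_div_cancel₀ _ hp1.ne']
      _ ≤ (K * mmax (volume.withDensity w) G x) ^ (p / (p - 1)) * w x := by
          gcongr
          exact rpow_maximal_le hp hw hf x
      _ = _ := by
          rw [ENNReal.mul_rpow_of_nonneg _ _ (by positivity)]
          ring
  have s2 := h₁ _ hwd G (hGm.mono_ac (withDensity_absolutelyContinuous _ _))
  have s3 : ∫⁻ x, G x ^ (p / (p - 1)) ∂(volume.withDensity w) =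
      ∫⁻ x, m₁ x ^ p ∂(volume.withDensity σ) := by
    rw [hconv hwm (by fun_prop), hconv hσm (by fun_prop)]
    refine lintegral_congr_ae ?_
    filter_upwards [hw.weight.ae_ne] with x hx
    rw [hG, ENNReal.mul_rpow_of_nonneg _ _ (by positivity), ← ENNReal.rpow_mul,
      mul_div_cancel₀ _ hp1.ne', mul_left_comm, mul_comm]
    obtain ⟨s, hs⟩ := exists_eq_eexp hx.1 hx.2
    simp only [hσ, hs, eexp_rpow, eexp_inv, eexp_mul]
    congr 2
    field_simp
    ring
  have s4 := h₂ _ hσd (fun z => (σ z)⁻¹ * f z) (hFm.mono_ac (withDensity_absolutelyContinuous _ _))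
  have s5 : ∫⁻ x, ((σ x)⁻¹ * f x) ^ p ∂(volume.withDensity σ) = ∫⁻ x, f x ^ p * w x := by
    rw [hconv hσm (by fun_prop)]
    refine lintegral_congr_ae ?_
    filter_upwards [hw.weight.ae_ne] with x hx
    rw [ENNReal.mul_rpow_of_nonneg _ _ (by linarith), ← mul_assoc, mul_comm]
    obtain ⟨s, hs⟩ := exists_eq_eexp hx.1 hx.2
    simp only [hσ, hs, eexp_rpow, eexp_inv, eexp_mul]
    congr 2
    field_simp
    ring
  calc _ ≤ (K : ℝ≥0∞) ^ (p / (p - 1)) * (C₁ * (C₂ * ∫⁻ x, f x ^ p * w x)) := by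
        refine s1.trans ?_
        gcongr
        refine s2.trans ?_
        gcongr
        rw [s3, ← s5]
        exact s4
    _ = ((K ^ (p / (p - 1)) * C₁ * C₂ : ℝ≥0) : ℝ≥0∞) * ∫⁻ x, f x ^ p * w x := by
        rw [ENNReal.coe_mul, ENNReal.coe_mul, coe_rpow (by positivity)]
        ring
    _ ≤ _ := by
        gcongr
        exact le_max_right _ _

/-- The Fujii-Wilson constant is controlled by the `A_p` constant. -/
theorem exists_aInftyConst_le (n : ℕ) {p : ℝ} (hp : 1 < p) (K : ℝ≥0) :
    ∃ C : ℝ≥0, ∀ w : (Fin n → ℝ) → ℝ≥0∞, Ap p K w → aInftyConst w ≤ C := by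
  have hp1 : 0 < p - 1 := by linarith
  have hq : 1 < p / (p - 1) := by rw [lt_div_iff₀ hp1]; linarith
  obtain ⟨C, -, hC⟩ := exists_lintegral_maximal_rpow_le n hq (K ^ (1 / (p - 1)))
  refine ⟨C ^ ((p - 1) / p), fun w hw => ?_⟩
  refine iSup_le fun c => iSup_le fun r => iSup_le fun hr => ?_
  have hwm := hw.weight.aemeasurable
  set σ : (Fin n → ℝ) → ℝ≥0∞ := fun y => w y ^ (-(1 / (p - 1))) with hσ
  set g := maximal ((closedBall c r).indicator w) with hg
  have hgm : Measurable g := measurable_maximal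
  have hI0 : ∫⁻ y in closedBall c r, w y ≠ 0 := by
    rw [setLIntegral_eq_mul_avg _ _ hr]
    exact mul_ne_zero (volume_closedBall_pos c hr).ne' (hw.weight.avg_ne_zero c hr)
  have hI1 := (hw.weight.locally_integrable c r).ne
  set I := ∫⁻ y in closedBall c r, w y with hI
  -- Hölder against `σ = w ^ (1 - p')`, followed by the boundedness of the maximal operator on
  -- `L^{p'}(σ)`; the loop closes because `w ^ p' σ = w`.
  have h1 : ∫⁻ x in closedBall c r, g x ≤ (C : ℝ≥0∞) ^ ((p - 1) / p) * I := by
    calc ∫⁻ x in closedBall c r, g x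
        = ∫⁻ x in closedBall c r, (g x ^ (p / (p - 1)) * σ x) ^ ((p - 1) / p) * w x ^ (1 / p) := by
          refine lintegral_congr_ae ?_
          filter_upwards [ae_restrict_of_ae hw.weight.ae_ne] with x hx
          rw [ENNReal.mul_rpow_of_nonneg _ _ (by positivity), ← ENNReal.rpow_mul, mul_assoc]
          obtain ⟨s, hs⟩ := exists_eq_eexp hx.1 hx.2
          simp only [hσ, hs, eexp_rpow, eexp_mul]
          rw [show p / (p - 1) * ((p - 1) / p) = 1 by field_simp, ENNReal.rpow_one,
            show s * -(1 / (p - 1)) * ((p - 1) / p) + s * (1 / p) = 0 by field_simp; ring]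
          simp [eexp]
      _ ≤ (∫⁻ x in closedBall c r, g x ^ (p / (p - 1)) * σ x) ^ ((p - 1) / p) * I ^ (1 / p) :=
          ENNReal.lintegral_mul_norm_pow_le (by fun_prop) (by fun_prop) (by positivity)
            (by positivity) (by field_simp; ring)
      _ ≤ (C * I) ^ ((p - 1) / p) * I ^ (1 / p) := by
          gcongr
          refine (setLIntegral_le_lintegral _ _).trans ((hC _ _ (hw.dual hp)
            (hwm.indicator measurableSet_closedBall)).trans ?_)
          rw [hI, ← lintegral_indicator measurableSet_closedBall]
          refine mul_le_mul_right (lintegral_mono_ae ?_) _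
          filter_upwards [hw.weight.ae_ne] with x hx
          by_cases hxc : x ∈ closedBall c r
          · rw [indicator_of_mem hxc]
            obtain ⟨s, hs⟩ := exists_eq_eexp hx.1 hx.2
            simp only [hs, eexp_rpow, eexp_mul]
            refine le_of_eq (congrArg _ ?_)
            field_simp
            ring
          · rw [indicator_of_notMem hxc, ENNReal.zero_rpow_of_pos (by positivity), zero_mul]
      _ = _ := by
          rw [ENNReal.mul_rpow_of_nonneg _ _ (by positivity), mul_assoc,
            ← ENNReal.rpow_add_of_nonneg _ _ (by positivity) (by positivity),
            show (p - 1) / p + 1 / p = 1 by field_simp; ring, ENNReal.rpow_one]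
  calc _ ≤ I⁻¹ * ((C : ℝ≥0∞) ^ ((p - 1) / p) * I) := mul_le_mul_right h1 _
    _ = _ := by
      rw [mul_left_comm, ENNReal.inv_mul_cancel hI0 hI1, mul_one, coe_rpow (by positivity)]

/-! ### Operations that preserve `A_p` -/

theorem Ap.const_mul {p : ℝ} (hp : 1 < p) {K : ℝ≥0} {w : (Fin n → ℝ) → ℝ≥0∞} (hw : Ap p K w)
    {a : ℝ≥0∞} (ha : a ≠ 0 ∧ a ≠ ∞) : Ap p K (fun x => a * w x) := by
  have hwm := hw.weight.aemeasurable
  have hp1 : 0 < p - 1 := by linarith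
  refine ⟨isWeight_of_avg_ne_top (by fun_prop) (hw.weight.ae_ne.mono fun x hx =>
    mul_ne_zero_top ha hx) fun c r hr => ?_, fun c r hr => ?_⟩
  · rw [avg_const_mul ha.2]
    exact ENNReal.mul_ne_top ha.2 (hw.weight.avg_ne_top c hr)
  · have h1 : avg c r (fun y => (a * w y) ^ (-(1 / (p - 1)))) =
        a ^ (-(1 / (p - 1))) * avg c r fun y => w y ^ (-(1 / (p - 1))) := by
      rw [← avg_const_mul (rpow_ne_zero_top ha _).2]
      refine avg_congr ?_
      filter_upwards [ae_restrict_of_ae hw.weight.ae_ne] with x hx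
      rw [ENNReal.mul_rpow_of_ne_zero ha.1 hx.1]
    rw [h1, avg_const_mul ha.2, ENNReal.mul_rpow_of_nonneg _ _ hp1.le, mul_mul_mul_comm]
    obtain ⟨s, rfl⟩ := exists_eq_eexp ha.1 ha.2
    rw [eexp_rpow, eexp_rpow, eexp_mul, show s + s * -(1 / (p - 1)) * (p - 1) = 0 by
      field_simp; ring]
    simpa [eexp] using hw.le c r hr

/-- A negative power of a minimum is at most the sum of the negative powers. The larger dual average
is kept and paired with the weight it belongs to. As scaling does not change `A_p` constants, the
bound is uniform for minima with multiples of a fixed weight. -/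
theorem Ap.inf {p : ℝ} (hp : 1 < p) {K L : ℝ≥0} {w v : (Fin n → ℝ) → ℝ≥0∞} (hw : Ap p K w)
    (hv : Ap p L v) : Ap p (2 ^ (p - 1) * (K + L)) (fun x => min (w x) (v x)) := by
  have hwm := hw.weight.aemeasurable
  have hvm := hv.weight.aemeasurable
  have hp1 : 0 < p - 1 := by linarith
  have hle1 : ∀ (c : Fin n → ℝ) (r : ℝ), avg c r (fun x => min (w x) (v x)) ≤ avg c r w :=
    fun c r => avg_mono (Eventually.of_forall fun x => min_le_left _ _) c r
  have hle2 : ∀ (c : Fin n → ℝ) (r : ℝ), avg c r (fun x => min (w x) (v x)) ≤ avg c r v :=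
    fun c r => avg_mono (Eventually.of_forall fun x => min_le_right _ _) c r
  refine ⟨isWeight_of_avg_ne_top (by fun_prop) ?_ fun c r hr =>
    ne_top_of_le_ne_top (hw.weight.avg_ne_top c hr) (hle1 c r), fun c r hr => ?_⟩
  · filter_upwards [hw.weight.ae_ne, hv.weight.ae_ne] with x hx hx'
    rcases min_choice (w x) (v x) with h | h <;> rw [h] <;> assumption
  · set A := avg c r fun y => w y ^ (-(1 / (p - 1))) with hA
    set B := avg c r fun y => v y ^ (-(1 / (p - 1))) with hB
    have h1 : avg c r (fun y => (min (w y) (v y)) ^ (-(1 / (p - 1)))) ≤ A + B := by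
      have : A + B = avg c r fun y => w y ^ (-(1 / (p - 1))) + v y ^ (-(1 / (p - 1))) := by
        rw [hA, hB]
        unfold avg
        rw [lintegral_add_left' (by fun_prop), mul_add]
      rw [this]
      refine avg_mono (Eventually.of_forall fun y => ?_) c r
      rcases min_choice (w y) (v y) with h | h <;> rw [h]
      · exact le_self_add
      · exact le_add_self
    have hpush : ∀ Z : ℝ≥0∞, A + B ≤ 2 * Z → (avg c r fun y =>
        (min (w y) (v y)) ^ (-(1 / (p - 1)))) ^ (p - 1) ≤ 2 ^ (p - 1) * Z ^ (p - 1) :=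
      fun Z hZ => by
        rw [← ENNReal.mul_rpow_of_nonneg _ _ hp1.le]
        exact ENNReal.rpow_le_rpow (h1.trans hZ) hp1.le
    have hcoe : ((2 ^ (p - 1) * (K + L) : ℝ≥0) : ℝ≥0∞) = 2 ^ (p - 1) * (K + L) := by
      rw [ENNReal.coe_mul, coe_rpow hp1.le]
      push_cast
      rfl
    rw [hcoe]
    rcases le_total B A with h | h
    · calc _ ≤ avg c r w * (2 ^ (p - 1) * A ^ (p - 1)) :=
            mul_le_mul' (hle1 c r) (hpush A (by rw [two_mul]; gcongr))
        _ = 2 ^ (p - 1) * (avg c r w * A ^ (p - 1)) := by ring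
        _ ≤ _ := by
            gcongr
            exact (hw.le c r hr).trans le_self_add
    · calc _ ≤ avg c r v * (2 ^ (p - 1) * B ^ (p - 1)) :=
            mul_le_mul' (hle2 c r) (hpush B (by rw [two_mul]; gcongr))
        _ = 2 ^ (p - 1) * (avg c r v * B ^ (p - 1)) := by ring
        _ ≤ _ := by
            gcongr
            exact (hv.le c r hr).trans le_add_self

/-- If `H` satisfies the `A_1` condition with respect to `w ∈ A_p`, then `H w ∈ A_p`. -/
theorem Ap.mul_of_mmax_le {p : ℝ} (hp : 1 < p) {K L : ℝ≥0} {w H : (Fin n → ℝ) → ℝ≥0∞}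
    (hw : Ap p K w) (hHm : AEMeasurable H) (hH : ∀ᵐ x, H x ≠ 0 ∧ H x ≠ ∞)
    (hL : ∀ᵐ x, mmax (volume.withDensity w) H x ≤ L * H x) : Ap p (K * L) (fun x => H x * w x) := by
  have hwm := hw.weight.aemeasurable
  have hp1 : 0 < p - 1 := by linarith
  have hmavg : ∀ (c : Fin n → ℝ) (r : ℝ), 0 < r → avg c r (fun x => H x * w x) =
      avg c r w * mavg (volume.withDensity w) c r H := by
    intro c r hr
    rw [mavg, setLIntegral_withDensity hwm hHm measurableSet_closedBall,
      withDensity_closedBall _ _ hr, ENNReal.mul_inv (Or.inl (volume_closedBall_pos c hr).ne')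
      (Or.inl (volume_closedBall_lt_top c r).ne), ← mul_assoc, mul_left_comm,
      ENNReal.mul_inv_cancel (hw.weight.avg_ne_zero c hr) (hw.weight.avg_ne_top c hr), mul_one]
    unfold avg
    simp_rw [mul_comm (H _)]
  have hae : ∀ (c : Fin n → ℝ) (r : ℝ), 0 < r → ∀ᵐ y ∂(volume.restrict (closedBall c r)),
      mavg (volume.withDensity w) c r H ≤ L * H y := by
    intro c r hr
    filter_upwards [ae_restrict_of_ae hL, ae_restrict_mem measurableSet_closedBall] with y h1 h2
    exact (mavg_le_mmax hr h2).trans h1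
  have hfin : ∀ (c : Fin n → ℝ) (r : ℝ), 0 < r → mavg (volume.withDensity w) c r H ≠ ∞ := by
    intro c r hr h
    have : ∀ᵐ y ∂(volume.restrict (closedBall c r)), False := by
      filter_upwards [hae c r hr, ae_restrict_of_ae hH] with y h1 h2
      rw [h] at h1
      exact ENNReal.mul_ne_top ENNReal.coe_ne_top h2.2 (top_le_iff.1 h1)
    rw [eventually_false_iff_eq_bot, ae_eq_bot, Measure.restrict_eq_zero] at this
    exact (volume_closedBall_pos c hr).ne' this
  refine ⟨isWeight_of_avg_ne_top (by fun_prop) ?_ fun c r hr => ?_, fun c r hr => ?_⟩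
  · filter_upwards [hH, hw.weight.ae_ne] with x h1 h2 using mul_ne_zero_top h1 h2
  · rw [hmavg c r hr]
    exact ENNReal.mul_ne_top (hw.weight.avg_ne_top c hr) (hfin c r hr)
  · have hne : avg c r (fun x => H x * w x) ≠ 0 := avg_ne_zero (by fun_prop) (by
      filter_upwards [hH, hw.weight.ae_ne] with x h1 h2 using mul_ne_zero h1.1 h2.1) c hr
    set A := mavg (volume.withDensity w) c r H with hA
    have hA0 : A ≠ 0 := by
      rw [hmavg c r hr] at hne
      exact right_ne_zero_of_mul hne
    have hA1 : A ≠ ∞ := hfin c r hr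
    have hL0 : L ≠ 0 := by
      rintro rfl
      have : ∀ᵐ y ∂(volume.restrict (closedBall c r)), False := by
        filter_upwards [hae c r hr] with y h1
        exact hA0 (by simpa using h1)
      rw [eventually_false_iff_eq_bot, ae_eq_bot, Measure.restrict_eq_zero] at this
      exact (volume_closedBall_pos c hr).ne' this
    -- On the cube `H` is at least its `w`-average `A` over `L`, so its negative power leaves the
    -- dual average and cancels the `A` in the average of `H w`.
    have h1 : avg c r (fun y => (H y * w y) ^ (-(1 / (p - 1)))) ≤
        (L : ℝ≥0∞) ^ (1 / (p - 1)) * A ^ (-(1 / (p - 1))) *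
          avg c r fun y => w y ^ (-(1 / (p - 1))) := by
      rw [← avg_const_mul (ENNReal.mul_ne_top (by finiteness) (rpow_ne_zero_top ⟨hA0, hA1⟩ _).2)]
      refine avg_mono_restrict ?_
      filter_upwards [hae c r hr, ae_restrict_of_ae hH, ae_restrict_of_ae hw.weight.ae_ne]
        with y h1 h2 h3
      rw [ENNReal.mul_rpow_of_ne_zero h2.1 h3.1]
      gcongr
      exact rpow_neg_le_of_le_mul ⟨hA0, hA1⟩ ⟨by simpa using hL0, ENNReal.coe_ne_top⟩ h1
        (by positivity)
    calc _ ≤ avg c r w * A * ((L : ℝ≥0∞) ^ (1 / (p - 1)) * A ^ (-(1 / (p - 1))) *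
          avg c r fun y => w y ^ (-(1 / (p - 1)))) ^ (p - 1) :=
          mul_le_mul' (hmavg c r hr).le (ENNReal.rpow_le_rpow h1 hp1.le)
      _ = (avg c r w * (avg c r fun y => w y ^ (-(1 / (p - 1)))) ^ (p - 1)) * L *
          (A * A ^ (-1 : ℝ)) := by
          rw [ENNReal.mul_rpow_of_nonneg _ _ hp1.le, ENNReal.mul_rpow_of_nonneg _ _ hp1.le,
            ← ENNReal.rpow_mul, ← ENNReal.rpow_mul, neg_mul, one_div_mul_cancel hp1.ne',
            ENNReal.rpow_one]
          ring
      _ ≤ K * L * 1 := by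
          rw [ENNReal.rpow_neg_one, ENNReal.mul_inv_cancel hA0 hA1]
          gcongr
          exact hw.le c r hr
      _ = _ := by simp

end Muckenhoupt

namespace Muckenhoupt
open Metric Filter Set
open scoped Topology

/-! ### Minkowski's inequality for series and the Rubio de Francia algorithm -/

section RubioDeFrancia

variable {α : Type*}

/-- The function produced by the Rubio de Francia algorithm. -/
noncomputable def rdf (T : (α → ℝ≥0∞) → α → ℝ≥0∞) (B : ℝ≥0) (h : α → ℝ≥0∞) (x : α) : ℝ≥0∞ :=
  ∑' k : ℕ, ((2 * B : ℝ≥0∞)⁻¹) ^ k * T^[k] h x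

variable {T : (α → ℝ≥0∞) → α → ℝ≥0∞} {B : ℝ≥0} {h : α → ℝ≥0∞}

theorem le_rdf (x : α) : h x ≤ rdf T B h x := by
  refine le_trans ?_ (ENNReal.le_tsum 0)
  simp

variable [MeasurableSpace α] {μ ν : Measure α}

theorem lintegral_sum_rpow_le {F : ℕ → α → ℝ≥0∞} (hF : ∀ k, AEMeasurable (F k) μ) {p : ℝ}
    (hp : 1 ≤ p) (N : ℕ) : (∫⁻ x, (∑ k ∈ Finset.range N, F k x) ^ p ∂μ) ^ (1 / p) ≤
      ∑ k ∈ Finset.range N, (∫⁻ x, F k x ^ p ∂μ) ^ (1 / p) := by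
  have hp0 : 0 < p := by linarith
  induction N with
  | zero => simp [hp0]
  | succ N ih =>
    simp_rw [Finset.sum_range_succ]
    refine (ENNReal.lintegral_Lp_add_le (f := fun x => ∑ k ∈ Finset.range N, F k x)
      (Finset.aemeasurable_fun_sum _ fun k _ => hF k) (hF N) hp).trans ?_
    gcongr

theorem lintegral_tsum_rpow_le {F : ℕ → α → ℝ≥0∞} (hF : ∀ k, AEMeasurable (F k) μ) {p : ℝ}
    (hp : 1 ≤ p) : (∫⁻ x, (∑' k, F k x) ^ p ∂μ) ^ (1 / p) ≤
      ∑' k, (∫⁻ x, F k x ^ p ∂μ) ^ (1 / p) := by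
  have hp0 : 0 < p := by linarith
  have hmono : ∀ x, Monotone fun N : ℕ => ∑ k ∈ Finset.range N, F k x := fun x N M hNM =>
    Finset.sum_le_sum_of_subset (Finset.range_mono hNM)
  have hlim : Tendsto (fun N : ℕ => ∫⁻ x, (∑ k ∈ Finset.range N, F k x) ^ p ∂μ) atTop
      (𝓝 (∫⁻ x, (∑' k, F k x) ^ p ∂μ)) := by
    refine lintegral_tendsto_of_tendsto_of_monotone (fun N =>
      (Finset.aemeasurable_fun_sum _ fun k _ => hF k).pow_const _)
      (Eventually.of_forall fun x N M hNM => ENNReal.rpow_le_rpow (hmono x hNM) hp0.le)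
      (Eventually.of_forall fun x => ?_)
    exact (ENNReal.continuous_rpow_const.tendsto _).comp ENNReal.summable.hasSum.tendsto_sum_nat
  refine le_of_tendsto' ((ENNReal.continuous_rpow_const.tendsto _).comp hlim) fun N => ?_
  exact (lintegral_sum_rpow_le hF hp N).trans (ENNReal.sum_le_tsum _)

theorem aemeasurable_iterate (hT : ∀ g, AEMeasurable g μ → AEMeasurable (T g) μ)
    (hh : AEMeasurable h μ) (k : ℕ) : AEMeasurable (T^[k] h) μ := by
  induction k with
  | zero => exact hh
  | succ k ih =>
    rw [Function.iterate_succ_apply']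
    exact hT _ ih

theorem aemeasurable_rdf (hT : ∀ g, AEMeasurable g μ → AEMeasurable (T g) μ)
    (hh : AEMeasurable h μ) : AEMeasurable (rdf T B h) μ :=
  AEMeasurable.tsum fun k => (aemeasurable_iterate hT hh k).const_mul _

theorem two_mul_inv_ne_top (hB : 1 ≤ B) : (2 * B : ℝ≥0∞)⁻¹ ≠ ∞ := by
  rw [ENNReal.inv_ne_top]
  exact mul_ne_zero two_ne_zero (ENNReal.coe_ne_zero.2 (one_pos.trans_le hB).ne')

theorem two_mul_inv_pow_mul_pow (hB : 1 ≤ B) (k : ℕ) :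
    ((2 * B : ℝ≥0∞)⁻¹) ^ k * B ^ k = 2⁻¹ ^ k := by
  have h0 : (B : ℝ≥0∞) ≠ 0 := ENNReal.coe_ne_zero.2 (one_pos.trans_le hB).ne'
  rw [← mul_pow, ENNReal.mul_inv (Or.inl two_ne_zero) (Or.inl (by simp)), mul_assoc,
    ENNReal.inv_mul_cancel h0 ENNReal.coe_ne_top, mul_one]

/-- Applying `T` shifts the series by one term, and compensating the shift in the coefficients costs
the factor `2 B`. -/
theorem ae_apply_rdf_le (hB : 1 ≤ B) (hT : ∀ g, AEMeasurable g μ → AEMeasurable (T g) μ)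
    (hsub : ∀ (F : ℕ → α → ℝ≥0∞) (a : ℕ → ℝ≥0∞), (∀ k, AEMeasurable (F k) μ) → (∀ k, a k ≠ ∞) →
      ∀ᵐ x ∂μ, T (fun y => ∑' k, a k * F k y) x ≤ ∑' k, a k * T (F k) x)
    (hh : AEMeasurable h μ) :
    ∀ᵐ x ∂μ, T (rdf T B h) x ≤ (2 * B : ℝ≥0) * rdf T B h x := by
  filter_upwards [hsub (fun k => T^[k] h) (fun k => ((2 * B : ℝ≥0∞)⁻¹) ^ k)
    (aemeasurable_iterate hT hh) fun k => ENNReal.pow_ne_top (two_mul_inv_ne_top hB)] with x hx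
  refine hx.trans ?_
  have h0 : (2 * B : ℝ≥0∞) ≠ 0 :=
    mul_ne_zero two_ne_zero (ENNReal.coe_ne_zero.2 (one_pos.trans_le hB).ne')
  unfold rdf
  push_cast
  rw [← ENNReal.tsum_mul_left, tsum_eq_zero_add' (f := fun k => (2 * B : ℝ≥0∞) *
    (((2 * B : ℝ≥0∞)⁻¹) ^ k * T^[k] h x)) ENNReal.summable]
  refine le_trans (le_of_eq (tsum_congr fun k => ?_)) le_add_self
  rw [Function.iterate_succ_apply', pow_succ', ← mul_assoc, ← mul_assoc,
    ENNReal.mul_inv_cancel h0 (by finiteness), one_mul]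

theorem tsum_two_inv_pow_mul (a : ℝ≥0∞) : ∑' k : ℕ, (2⁻¹ : ℝ≥0∞) ^ k * a = 2 * a := by
  rw [ENNReal.tsum_mul_right, ENNReal.tsum_geometric, ENNReal.one_sub_inv_two, inv_inv]

/-- The iterates grow at most like `B ^ k` in norm (as `1 ≤ B`, passing to the `p`-th root does not
hurt), so the weights `(2 B)⁻ᵏ` leave a geometric series of sum two. -/
theorem lintegral_rdf_rpow_le (hB : 1 ≤ B) (hT : ∀ g, AEMeasurable g μ → AEMeasurable (T g) μ)
    (hνμ : ν ≪ μ) {p : ℝ} (hp : 1 ≤ p)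
    (hbd : ∀ g, AEMeasurable g μ → ∫⁻ x, T g x ^ p ∂ν ≤ B * ∫⁻ x, g x ^ p ∂ν)
    (hh : AEMeasurable h μ) : ∫⁻ x, rdf T B h x ^ p ∂ν ≤ 2 ^ p * ∫⁻ x, h x ^ p ∂ν := by
  have hp0 : 0 < p := by linarith
  have hit : ∀ k, (∫⁻ x, T^[k] h x ^ p ∂ν) ^ (1 / p) ≤ B ^ k * (∫⁻ x, h x ^ p ∂ν) ^ (1 / p) := by
    intro k
    induction k with
    | zero => simp
    | succ k ih =>
      rw [Function.iterate_succ_apply', pow_succ', mul_assoc]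
      refine (ENNReal.rpow_le_rpow (hbd _ (aemeasurable_iterate hT hh k)) (by positivity)).trans ?_
      rw [ENNReal.mul_rpow_of_nonneg _ _ (by positivity)]
      refine mul_le_mul' ?_ ih
      refine (ENNReal.rpow_le_rpow_of_exponent_le (by exact_mod_cast hB)
        (by rw [div_le_one hp0]; exact hp)).trans (ENNReal.rpow_one _).le
  have h1 : (∫⁻ x, rdf T B h x ^ p ∂ν) ^ (1 / p) ≤ 2 * (∫⁻ x, h x ^ p ∂ν) ^ (1 / p) := by
    refine (lintegral_tsum_rpow_le (fun k =>
      ((aemeasurable_iterate hT hh k).mono_ac hνμ).const_mul _) hp).trans ?_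
    rw [← tsum_two_inv_pow_mul ((∫⁻ x, h x ^ p ∂ν) ^ (1 / p))]
    refine ENNReal.tsum_le_tsum fun k => ?_
    have hne : ((2 * B : ℝ≥0∞)⁻¹ ^ k) ≠ ∞ := ENNReal.pow_ne_top (two_mul_inv_ne_top hB)
    simp_rw [ENNReal.mul_rpow_of_nonneg _ _ hp0.le]
    rw [lintegral_const_mul' _ _ (ENNReal.rpow_ne_top_of_nonneg hp0.le hne),
      ENNReal.mul_rpow_of_nonneg _ _ (by positivity), ← ENNReal.rpow_mul,
      mul_one_div_cancel hp0.ne', ENNReal.rpow_one, ← two_mul_inv_pow_mul_pow hB, mul_assoc]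
    exact mul_le_mul_right (hit k) _
  have h2 := ENNReal.rpow_le_rpow h1 hp0.le
  rwa [ENNReal.mul_rpow_of_nonneg _ _ hp0.le, ← ENNReal.rpow_mul, ← ENNReal.rpow_mul,
    one_div_mul_cancel hp0.ne', ENNReal.rpow_one, ENNReal.rpow_one] at h2

/-- The same geometric series in `L^∞`; keeping `H` bounded in the weak-type argument relies on it.
-/
theorem ae_rdf_le_two (hB : 1 ≤ B)
    (hbd : ∀ (g : α → ℝ≥0∞) (A : ℝ≥0∞), (∀ᵐ x ∂μ, g x ≤ A) → ∀ᵐ x ∂μ, T g x ≤ B * A)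
    (hh : ∀ᵐ x ∂μ, h x ≤ 1) : ∀ᵐ x ∂μ, rdf T B h x ≤ 2 := by
  have hit : ∀ k, ∀ᵐ x ∂μ, T^[k] h x ≤ B ^ k := by
    intro k
    induction k with
    | zero => simpa using hh
    | succ k ih =>
      rw [Function.iterate_succ_apply', pow_succ']
      exact hbd _ _ ih
  filter_upwards [ae_all_iff.2 hit] with x hx
  calc rdf T B h x ≤ ∑' k : ℕ, (2⁻¹ : ℝ≥0∞) ^ k * 1 := by
        refine ENNReal.tsum_le_tsum fun k => ?_
        rw [mul_one, ← two_mul_inv_pow_mul_pow hB]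
        exact mul_le_mul_right (hx k) _
    _ = 2 := by rw [tsum_two_inv_pow_mul, mul_one]

end RubioDeFrancia

/-! ### Countable sublinearity of maximal operators and Jones factorization -/

variable {n : ℕ} {f g : (Fin n → ℝ) → ℝ≥0∞}

theorem mmax_tsum_const_mul_le {μ : Measure (Fin n → ℝ)} {F : ℕ → (Fin n → ℝ) → ℝ≥0∞}
    {a : ℕ → ℝ≥0∞} (hF : ∀ k, AEMeasurable (F k) μ) (ha : ∀ k, a k ≠ ∞) (x : Fin n → ℝ) :
    mmax μ (fun y => ∑' k, a k * F k y) x ≤ ∑' k, a k * mmax μ (F k) x :=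
  (mmax_tsum_le (fun k => (hF k).const_mul _) x).trans
    (ENNReal.tsum_le_tsum fun k => mmax_const_mul_le (ha k) x)

theorem mmax_ne_zero {μ : Measure (Fin n → ℝ)} (hμ : ∀ c r, μ (closedBall c r) < ∞)
    (hf : AEMeasurable f μ) (h : ¬ f =ᵐ[μ] 0) (x : Fin n → ℝ) : mmax μ f x ≠ 0 := by
  intro h0
  refine h ((lintegral_eq_zero_iff' hf).1 ?_)
  have hball : ∀ N : ℕ, ∫⁻ y in closedBall x (N + 1), f y ∂μ = 0 := by
    intro N
    have h1 : mavg μ x (N + 1) f ≤ 0 :=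
      h0 ▸ mavg_le_mmax (by positivity) (mem_closedBall_self (by positivity))
    rw [le_zero_iff, mavg, mul_eq_zero, ENNReal.inv_eq_zero] at h1
    exact h1.resolve_left (hμ _ _).ne
  have hU : (⋃ N : ℕ, closedBall x ((N : ℝ) + 1)) = univ := by
    refine eq_univ_of_forall fun y => mem_iUnion.2 ?_
    obtain ⟨N, hN⟩ := exists_nat_ge (dist y x)
    exact ⟨N, mem_closedBall.2 (by linarith)⟩
  rw [← setLIntegral_univ, ← hU, ← le_zero_iff]
  refine (lintegral_iUnion_le _ _).trans (by simp [hball])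

/-- Minkowski in `L^s` of each cube with density `w`. This is where `s ≥ 1` enters, and with `s = p
- 1` it explains the restriction `p ≥ 2` in the factorization. -/
theorem maximal_tsum_rpow_le {s : ℝ} (hs : 1 ≤ s) {F : ℕ → (Fin n → ℝ) → ℝ≥0∞} {a : ℕ → ℝ≥0∞}
    (hF : ∀ k, AEMeasurable (F k)) (ha : ∀ k, a k ≠ ∞) {w : (Fin n → ℝ) → ℝ≥0∞}
    (hw : AEMeasurable w) (x : Fin n → ℝ) :
    maximal (fun y => (∑' k, a k * F k y) ^ s * w y) x ^ (1 / s) ≤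
      ∑' k, a k * maximal (fun y => F k y ^ s * w y) x ^ (1 / s) := by
  have hs0 : 0 < s := by linarith
  have hroot : ∀ A B : ℝ≥0∞, A ^ (1 / s) ≤ B ↔ A ≤ B ^ s := fun A B => by
    rw [one_div, ENNReal.rpow_inv_le_iff hs0]
  rw [hroot]
  refine mmax_le fun c r hr hx => ?_
  rw [← hroot]
  have hconv : ∀ G : (Fin n → ℝ) → ℝ≥0∞, AEMeasurable G → mavg volume c r (fun y => G y ^ s * w y) =
      (volume (closedBall c r))⁻¹ *
        ∫⁻ y, G y ^ s ∂((volume.restrict (closedBall c r)).withDensity w) := by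
    intro G hG
    rw [lintegral_withDensity_eq_lintegral_mul₀ hw.restrict (hG.restrict.pow_const _), mavg]
    simp_rw [Pi.mul_apply, mul_comm]
  rw [hconv _ (AEMeasurable.tsum fun k => (hF k).const_mul _),
    ENNReal.mul_rpow_of_nonneg _ _ (by positivity)]
  refine (mul_le_mul_right (lintegral_tsum_rpow_le (fun k =>
    ((hF k).const_mul (a k)).restrict.mono_ac (withDensity_absolutelyContinuous _ _)) hs) _).trans ?_
  rw [← ENNReal.tsum_mul_left]
  refine ENNReal.tsum_le_tsum fun k => ?_
  rw [← ENNReal.mul_rpow_of_nonneg _ _ (by positivity), ← hconv _ ((hF k).const_mul _)]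
  have h1 : mavg volume c r (fun y => (a k * F k y) ^ s * w y) =
      a k ^ s * mavg volume c r (fun y => F k y ^ s * w y) := by
    rw [← mavg_const_mul (ENNReal.rpow_ne_top_of_nonneg hs0.le (ha k))]
    congr 1
    ext y
    rw [ENNReal.mul_rpow_of_nonneg _ _ hs0.le, mul_assoc]
  rw [h1, ENNReal.mul_rpow_of_nonneg _ _ (by positivity), ← ENNReal.rpow_mul,
    mul_one_div_cancel hs0.ne', ENNReal.rpow_one]
  gcongr
  exact mavg_le_mmax hr hx

/-- The Jones factorization theorem, for exponents at least two. -/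
theorem Ap.exists_factorization {p : ℝ} (hp : 2 ≤ p) {K : ℝ≥0} {w : (Fin n → ℝ) → ℝ≥0∞}
    (hw : Ap p K w) : ∃ (L : ℝ≥0) (w₁ w₂ : (Fin n → ℝ) → ℝ≥0∞), A1 L w₁ ∧ A1 L w₂ ∧
      ∀ᵐ x, w x = w₁ x * w₂ x ^ (-(p - 1)) := by
  have hp1 : 0 < p - 1 := by linarith
  have hp0 : 0 < p := by linarith
  have hq : 1 < p / (p - 1) := by rw [lt_div_iff₀ hp1]; linarith
  have hwm := hw.weight.aemeasurable
  obtain ⟨C₁, -, h₁⟩ := exists_lintegral_maximal_rpow_le n (by linarith : 1 < p) K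
  obtain ⟨C₂, -, h₂⟩ := exists_lintegral_maximal_rpow_le n hq (K ^ (1 / (p - 1)))
  -- Both operators are bounded on unweighted `L^p`, by Muckenhoupt's theorem for `w` and for its
  -- dual weight. If `T₁ η` and `T₂ η` are at most a multiple of `η`, then `η w^(-1/p)` and `η^(p-1)
  -- w^(1/p)` are in `A_1`, and these are the two factors.
  set T₁ : ((Fin n → ℝ) → ℝ≥0∞) → (Fin n → ℝ) → ℝ≥0∞ := fun g x =>
    w x ^ (1 / p) * maximal (fun y => g y * w y ^ (-(1 / p))) x with hT₁
  set T₂ : ((Fin n → ℝ) → ℝ≥0∞) → (Fin n → ℝ) → ℝ≥0∞ := fun g x =>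
    w x ^ (-(1 / p) * (1 / (p - 1))) *
      maximal (fun y => g y ^ (p - 1) * w y ^ (1 / p)) x ^ (1 / (p - 1)) with hT₂
  have hT₁m : ∀ g, AEMeasurable (T₁ g) := fun g =>
    (hwm.pow_const _).mul measurable_maximal.aemeasurable
  have hT₂m : ∀ g, AEMeasurable (T₂ g) := fun g =>
    (hwm.pow_const _).mul (measurable_maximal.aemeasurable.pow_const _)
  have hb₁ : ∀ g, AEMeasurable g → ∫⁻ x, T₁ g x ^ p ≤ C₁ * ∫⁻ x, g x ^ p := by
    intro g hg
    calc ∫⁻ x, T₁ g x ^ p = ∫⁻ x, maximal (fun y => g y * w y ^ (-(1 / p))) x ^ p * w x := by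
          refine lintegral_congr fun x => ?_
          rw [hT₁, ENNReal.mul_rpow_of_nonneg _ _ hp0.le, ← ENNReal.rpow_mul,
            one_div_mul_cancel hp0.ne', ENNReal.rpow_one, mul_comm]
      _ ≤ _ := h₁ w _ hw (by fun_prop)
      _ = _ := by
          congr 1
          refine lintegral_congr_ae ?_
          filter_upwards [hw.weight.ae_ne] with x hx
          rw [ENNReal.mul_rpow_of_nonneg _ _ hp0.le, mul_assoc]
          obtain ⟨s, hs⟩ := exists_eq_eexp hx.1 hx.2
          rw [hs, eexp_rpow, eexp_rpow, eexp_mul, show s * -(1 / p) * p + s = 0 by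
            field_simp; ring]
          simp [eexp]
  have hb₂ : ∀ g, AEMeasurable g → ∫⁻ x, T₂ g x ^ p ≤ C₂ * ∫⁻ x, g x ^ p := by
    intro g hg
    calc ∫⁻ x, T₂ g x ^ p = ∫⁻ x, maximal (fun y => g y ^ (p - 1) * w y ^ (1 / p)) x ^ (p / (p - 1)) *
          w x ^ (-(1 / (p - 1))) := by
          refine lintegral_congr fun x => ?_
          rw [hT₂, ENNReal.mul_rpow_of_nonneg _ _ hp0.le, ← ENNReal.rpow_mul, ← ENNReal.rpow_mul,
            mul_comm]
          congr 2
          · ring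
          · field_simp
      _ ≤ _ := h₂ _ _ (hw.dual (by linarith)) (by fun_prop)
      _ = _ := by
          congr 1
          refine lintegral_congr_ae ?_
          filter_upwards [hw.weight.ae_ne] with x hx
          rw [ENNReal.mul_rpow_of_nonneg _ _ (by positivity), mul_assoc, ← ENNReal.rpow_mul,
            mul_div_cancel₀ _ hp1.ne']
          obtain ⟨s, hs⟩ := exists_eq_eexp hx.1 hx.2
          rw [hs, eexp_rpow, eexp_rpow, eexp_rpow, eexp_mul,
            show s * (1 / p) * (p / (p - 1)) + s * -(1 / (p - 1)) = 0 by field_simp; ring]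
          simp [eexp]
  set T : ((Fin n → ℝ) → ℝ≥0∞) → (Fin n → ℝ) → ℝ≥0∞ := fun g x => T₁ g x + T₂ g x with hT
  have hTm : ∀ g, AEMeasurable g → AEMeasurable (T g) := fun g _ => (hT₁m g).add (hT₂m g)
  set B : ℝ≥0 := max 1 (2 ^ (p - 1) * (C₁ + C₂)) with hB
  have hB1 : 1 ≤ B := le_max_left _ _
  have hb : ∀ g, AEMeasurable g → ∫⁻ x, T g x ^ p ≤ B * ∫⁻ x, g x ^ p := by
    intro g hg
    calc ∫⁻ x, T g x ^ p ≤ ∫⁻ x, 2 ^ (p - 1) * (T₁ g x ^ p + T₂ g x ^ p) :=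
          lintegral_mono fun x => ENNReal.rpow_add_le_mul_rpow_add_rpow _ _ (by linarith)
      _ = 2 ^ (p - 1) * ((∫⁻ x, T₁ g x ^ p) + ∫⁻ x, T₂ g x ^ p) := by
          rw [lintegral_const_mul' _ _ (by finiteness), lintegral_add_left' ((hT₁m g).pow_const _)]
      _ ≤ 2 ^ (p - 1) * (C₁ * (∫⁻ x, g x ^ p) + C₂ * ∫⁻ x, g x ^ p) := by
          gcongr
          · exact hb₁ g hg
          · exact hb₂ g hg
      _ = ((2 ^ (p - 1) * (C₁ + C₂) : ℝ≥0) : ℝ≥0∞) * ∫⁻ x, g x ^ p := by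
          rw [ENNReal.coe_mul, coe_rpow hp1.le]
          push_cast
          ring
      _ ≤ _ := by
          gcongr
          exact le_max_right _ _
  have hsub : ∀ (F : ℕ → (Fin n → ℝ) → ℝ≥0∞) (a : ℕ → ℝ≥0∞), (∀ k, AEMeasurable (F k)) →
      (∀ k, a k ≠ ∞) → ∀ᵐ x, T (fun y => ∑' k, a k * F k y) x ≤ ∑' k, a k * T (F k) x := by
    intro F a hF ha
    refine Eventually.of_forall fun x => ?_
    simp only [hT, mul_add]
    rw [ENNReal.tsum_add]
    refine add_le_add ?_ ?_
    · simp only [hT₁]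
      simp_rw [mul_left_comm (a _), ENNReal.tsum_mul_left, ← ENNReal.tsum_mul_right, mul_assoc]
      gcongr
      exact mmax_tsum_const_mul_le (fun k => (hF k).mul (hwm.pow_const _)) ha x
    · simp only [hT₂]
      simp_rw [mul_left_comm (a _), ENNReal.tsum_mul_left]
      gcongr
      exact maximal_tsum_rpow_le (by linarith) hF ha (hwm.pow_const _) x
  -- Any nonzero function in `L^p` would serve as a seed.
  set h : (Fin n → ℝ) → ℝ≥0∞ := (closedBall 0 1).indicator fun _ => 1 with hh
  have hhm : AEMeasurable h := (measurable_const.indicator measurableSet_closedBall).aemeasurable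
  set η := rdf T B h with hη
  have hηm : AEMeasurable η := aemeasurable_rdf hTm hhm
  have hTη : ∀ᵐ x, T η x ≤ (2 * B : ℝ≥0) * η x := ae_apply_rdf_le hB1 hTm hsub hhm
  have hηint : ∫⁻ x, η x ^ p ≠ ∞ := by
    refine ne_top_of_le_ne_top ?_ (lintegral_rdf_rpow_le hB1 hTm
      (Measure.AbsolutelyContinuous.refl _) (by linarith) hb hhm)
    refine ENNReal.mul_ne_top (by finiteness) ?_
    have : ∀ x, h x ^ p = h x := fun x => by
      by_cases hx : x ∈ closedBall (0 : Fin n → ℝ) 1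
      · simp [hh, hx]
      · simp [hh, hx, hp0]
    simp_rw [this, hh]
    rw [lintegral_indicator measurableSet_closedBall, setLIntegral_one]
    exact (volume_closedBall_lt_top _ _).ne
  have hηtop : ∀ᵐ x, η x ≠ ∞ := by
    filter_upwards [ae_lt_top' (hηm.pow_const _) hηint] with x hx hx'
    rw [hx', ENNReal.top_rpow_of_pos hp0] at hx
    exact lt_irrefl _ hx
  have hηpos : ∀ᵐ x, η x ≠ 0 := by
    -- The maximal function of a nonzero function is positive everywhere, so `T η ≤ 2 B η` forces `η
    -- > 0` almost everywhere.
    have hmax : ∀ x, maximal (fun y => η y * w y ^ (-(1 / p))) x ≠ 0 := by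
      refine mmax_ne_zero volume_closedBall_lt_top (by fun_prop) fun h0 => ?_
      refine avg_ne_zero (n := n) (w := fun _ => 1) aemeasurable_const (by simp) 0 one_pos ?_
      unfold avg
      rw [mul_eq_zero, lintegral_eq_zero_iff' (by fun_prop)]
      right
      filter_upwards [ae_restrict_mem measurableSet_closedBall, ae_restrict_of_ae h0,
        ae_restrict_of_ae hw.weight.ae_ne] with x hx h1 h2
      have h3 : η x = 0 := by
        simpa [(rpow_ne_zero_top h2 (-(1 / p))).1, h2] using h1
      have h4 := le_rdf (T := T) (B := B) (h := h) x
      rw [← hη, h3, hh, indicator_of_mem hx] at h4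
      exact le_zero_iff.1 h4
    filter_upwards [hTη, hw.weight.ae_ne] with x hx hwx h0
    rw [h0, mul_zero, le_zero_iff] at hx
    simp only [hT, hT₁, add_eq_zero, mul_eq_zero] at hx
    rcases hx.1 with h | h
    · exact (rpow_ne_zero_top hwx _).1 h
    · exact hmax x h
  have hηne : ∀ᵐ x, η x ≠ 0 ∧ η x ≠ ∞ := hηpos.and hηtop
  refine ⟨max ((2 * B) ^ (p - 1)) (2 * B), fun x => η x ^ (p - 1) * w x ^ (1 / p),
    fun x => η x * w x ^ (-(1 / p)), ?_, ?_, ?_⟩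
  · refine (A1.of_maximal_le (K := (2 * B) ^ (p - 1)) (by fun_prop) ?_ ?_).mono (le_max_left _ _)
    · filter_upwards [hηne, hw.weight.ae_ne] with x h1 h2
      exact mul_ne_zero_top (rpow_ne_zero_top h1 _) (rpow_ne_zero_top h2 _)
    · filter_upwards [hTη, hw.weight.ae_ne] with x hx hwx
      have h1 : T₂ η x ≤ (2 * B : ℝ≥0) * η x := le_add_self.trans hx
      have h2 := ENNReal.rpow_le_rpow h1 hp1.le
      rw [hT₂, ENNReal.mul_rpow_of_nonneg _ _ hp1.le, ENNReal.mul_rpow_of_nonneg _ _ hp1.le,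
        ← ENNReal.rpow_mul, ← ENNReal.rpow_mul, mul_assoc, one_div_mul_cancel hp1.ne', mul_one,
        ENNReal.rpow_one, ← coe_rpow hp1.le] at h2
      calc _ = w x ^ (1 / p) * (w x ^ (-(1 / p)) *
            maximal (fun y => η y ^ (p - 1) * w y ^ (1 / p)) x) := by
            rw [← mul_assoc, ← ENNReal.rpow_add _ _ hwx.1 hwx.2]
            simp
        _ ≤ w x ^ (1 / p) * (((2 * B) ^ (p - 1) : ℝ≥0) * η x ^ (p - 1)) := by gcongr
        _ = _ := by ring
  · refine (A1.of_maximal_le (K := 2 * B) (by fun_prop) ?_ ?_).mono (le_max_right _ _)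
    · filter_upwards [hηne, hw.weight.ae_ne] with x h1 h2
      exact mul_ne_zero_top h1 (rpow_ne_zero_top h2 _)
    · filter_upwards [hTη, hw.weight.ae_ne] with x hx hwx
      have h1 : T₁ η x ≤ (2 * B : ℝ≥0) * η x := le_self_add.trans hx
      calc _ = w x ^ (-(1 / p)) * (w x ^ (1 / p) *
            maximal (fun y => η y * w y ^ (-(1 / p))) x) := by
            rw [← mul_assoc, ← ENNReal.rpow_add _ _ hwx.1 hwx.2]
            simp
        _ ≤ w x ^ (-(1 / p)) * ((2 * B : ℝ≥0) * η x) := by gcongr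
        _ = _ := by ring
  · filter_upwards [hηne, hw.weight.ae_ne] with x h1 h2
    obtain ⟨s, hs⟩ := exists_eq_eexp h1.1 h1.2
    obtain ⟨t, ht⟩ := exists_eq_eexp h2.1 h2.2
    simp only [hs, ht, eexp_rpow, eexp_mul]
    congr 1
    field_simp
    ring

end Muckenhoupt

namespace Muckenhoupt
open Metric Filter Set
open scoped Topology

variable {n : ℕ}

/-! ### Extrapolation for `A_∞` weights -/

/-- The pairs in `𝓕` satisfy a strong-type inequality with exponent `p` for all `A_s` weights, with
constants that depend only on `s` and the `A_s` constant. -/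
def Dominated (𝓕 : Set (((Fin n → ℝ) → ℝ≥0∞) × ((Fin n → ℝ) → ℝ≥0∞))) (p : ℝ) : Prop :=
  ∀ s : ℝ, 1 < s → ∀ K : ℝ≥0, ∃ C : ℝ≥0, ∀ w : (Fin n → ℝ) → ℝ≥0∞, Ap s K w → ∀ f ∈ 𝓕,
    ∫⁻ x, f.1 x ^ p * w x ≤ C * ∫⁻ x, f.2 x ^ p * w x

variable {F 𝓕 : Set (((Fin n → ℝ) → ℝ≥0∞) × ((Fin n → ℝ) → ℝ≥0∞))}

theorem Ap.isAInfty {s : ℝ} (hs : 1 < s) {K : ℝ≥0} {w : (Fin n → ℝ) → ℝ≥0∞} (hw : Ap s K w) :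
    IsAInfty w := ⟨s, hs, hw.isAq hs⟩

theorem IsAInfty.exists_ap {w : (Fin n → ℝ) → ℝ≥0∞} (hw : IsAInfty w) (t : ℝ) :
    ∃ s : ℝ, 1 < s ∧ t ≤ s ∧ ∃ K : ℝ≥0, Ap s K w := by
  obtain ⟨q, hq, hwq⟩ := hw
  obtain ⟨K, hK⟩ := hwq.exists_ap hq
  exact ⟨max q t, lt_max_of_lt_left hq, le_max_right _ _, K, hK.mono_exponent hq (le_max_left _ _)⟩

theorem lintegral_le_of_forall_min_le {g w w₀ : (Fin n → ℝ) → ℝ≥0∞} (hg : AEMeasurable g)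
    (hw : IsWeight w) (hw₀ : IsWeight w₀) {A : ℝ≥0∞}
    (h : ∀ k : ℕ, ∫⁻ x, g x * min (w x) ((k + 1 : ℝ≥0∞) * w₀ x) ≤ A) : ∫⁻ x, g x * w x ≤ A := by
  have hwm := hw.aemeasurable
  have hwm₀ := hw₀.aemeasurable
  refine le_of_tendsto' (lintegral_tendsto_of_tendsto_of_monotone (fun k => by fun_prop)
    (Eventually.of_forall fun x a b hab => ?_) ?_) h
  · have : (a : ℝ≥0∞) ≤ b := by exact_mod_cast hab
    dsimp only
    gcongr
  · filter_upwards [hw.ae_ne, hw₀.ae_ne] with x hx hx₀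
    refine tendsto_const_nhds.congr' ?_
    obtain ⟨N, hN⟩ := ENNReal.exists_nat_gt (ENNReal.div_ne_top hx.2 hx₀.1)
    filter_upwards [eventually_ge_atTop N] with k hk
    rw [min_eq_left]
    rw [ENNReal.div_lt_iff (Or.inl hx₀.1) (Or.inl hx₀.2)] at hN
    refine hN.le.trans ?_
    have : (N : ℝ≥0∞) ≤ k := by exact_mod_cast hk
    gcongr
    exact this.trans le_self_add

/-- The hypothesis says nothing when its left side is infinite. But `f₁ ^ p₀` is integrable against
some `w₀`, hence against `min w (k w₀)`, whose `A_t` constant does not depend on `k`. Letting `k`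
grow shows that the integral against `w` is finite whenever the right side is, and then the
hypothesis applies to `w` itself. -/
theorem dominated_of_aInfty (hF : ∀ f ∈ F, AEMeasurable f.1 volume ∧ AEMeasurable f.2 volume)
    {p₀ : ℝ} {φ : ℝ≥0 → ℝ≥0} (hφ : Monotone φ)
    (hyp : ∀ w : (Fin n → ℝ) → ℝ≥0∞, IsAInfty w → ∀ f ∈ F, ∫⁻ x, f.1 x ^ p₀ * w x < ∞ →
      ∫⁻ x, f.1 x ^ p₀ * w x ≤ φ (aInftyConst w).toNNReal * ∫⁻ x, f.2 x ^ p₀ * w x) :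
    Dominated {f ∈ F | ∃ w₀ : (Fin n → ℝ) → ℝ≥0∞, IsAInfty w₀ ∧ ∫⁻ x, f.1 x ^ p₀ * w₀ x < ∞} p₀ := by
  have happ : ∀ s : ℝ, 1 < s → ∀ K : ℝ≥0, ∃ C : ℝ≥0, ∀ w : (Fin n → ℝ) → ℝ≥0∞, Ap s K w → ∀ f ∈ F,
      ∫⁻ x, f.1 x ^ p₀ * w x < ∞ → ∫⁻ x, f.1 x ^ p₀ * w x ≤ C * ∫⁻ x, f.2 x ^ p₀ * w x := by
    intro s hs K
    obtain ⟨C, hC⟩ := exists_aInftyConst_le n hs K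
    refine ⟨φ C, fun w hw f hf hfin => (hyp w (hw.isAInfty hs) f hf hfin).trans ?_⟩
    gcongr
    refine hφ ?_
    rw [← ENNReal.toNNReal_coe C]
    exact ENNReal.toNNReal_mono ENNReal.coe_ne_top (hC w hw)
  intro s hs K
  obtain ⟨C, hC⟩ := happ s hs K
  -- The summand `1` makes the constant nonzero, so an infinite right side stays infinite.
  refine ⟨C + 1, fun w hw f hf => ?_⟩
  obtain ⟨hfF, w₀, hw₀, hfin₀⟩ := hf
  by_cases htop : ∫⁻ x, f.2 x ^ p₀ * w x = ∞
  · rw [htop, ENNReal.mul_top (by positivity)]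
    exact le_top
  suffices h : ∫⁻ x, f.1 x ^ p₀ * w x < ∞ by
    refine (hC w hw f hfF h).trans ?_
    gcongr
    simp
  obtain ⟨t, ht, hst, K₀, hK₀⟩ := hw₀.exists_ap s
  obtain ⟨C', hC'⟩ := happ t ht (2 ^ (t - 1) * (K + K₀))
  refine lt_of_le_of_lt (lintegral_le_of_forall_min_le ((hF f hfF).1.pow_const _) hw.weight
    hK₀.weight (A := C' * ∫⁻ x, f.2 x ^ p₀ * w x) fun k => ?_) (by finiteness)
  have hk : (k + 1 : ℝ≥0∞) ≠ 0 ∧ (k + 1 : ℝ≥0∞) ≠ ∞ := ⟨by positivity, by finiteness⟩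
  have hmin := (hw.mono_exponent hs hst).inf ht (hK₀.const_mul ht hk)
  refine (hC' _ hmin f hfF ?_).trans ?_
  · calc ∫⁻ x, f.1 x ^ p₀ * min (w x) ((k + 1 : ℝ≥0∞) * w₀ x)
        ≤ ∫⁻ x, (k + 1 : ℝ≥0∞) * (f.1 x ^ p₀ * w₀ x) := by
          refine lintegral_mono fun x => ?_
          rw [mul_left_comm]
          gcongr
          exact min_le_right _ _
      _ = (k + 1 : ℝ≥0∞) * ∫⁻ x, f.1 x ^ p₀ * w₀ x := lintegral_const_mul' _ _ hk.2
      _ < ∞ := ENNReal.mul_lt_top (lt_top_iff_ne_top.2 hk.2) hfin₀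
  · gcongr
    exact min_le_left _ _

theorem lintegral_withDensity_mul {w g : (Fin n → ℝ) → ℝ≥0∞} (hw : AEMeasurable w)
    (hg : AEMeasurable g) : ∫⁻ x, g x ∂(volume.withDensity w) = ∫⁻ x, g x * w x := by
  rw [lintegral_withDensity_eq_lintegral_mul₀ hw hg]
  simp_rw [Pi.mul_apply, mul_comm]

theorem ae_eq_zero_of_lintegral_eq_zero {w g : (Fin n → ℝ) → ℝ≥0∞} (hw : IsWeight w)
    (hg : AEMeasurable g) {p : ℝ} (hp : 0 < p) (h : ∫⁻ x, g x ^ p * w x = 0) : ∀ᵐ x, g x = 0 := by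
  have hwm := hw.aemeasurable
  rw [lintegral_eq_zero_iff' (by fun_prop)] at h
  filter_upwards [h, hw.ae_ne] with x h1 h2
  have h3 : g x ^ p = 0 := by simpa [h2.1] using h1
  exact (ENNReal.rpow_eq_zero_iff_of_pos hp).1 h3

theorem ae_ne_top_of_lintegral_ne_top {w g : (Fin n → ℝ) → ℝ≥0∞} (hw : IsWeight w)
    (hg : AEMeasurable g) {p : ℝ} (hp : 0 < p) (h : ∫⁻ x, g x ^ p * w x ≠ ∞) :
    ∀ᵐ x, g x ≠ ∞ := by
  filter_upwards [ae_lt_top' ((hg.pow_const _).mul hw.aemeasurable) h, hw.ae_ne] with x h1 h2 h3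
  rw [Pi.mul_apply, h3, ENNReal.top_rpow_of_pos hp, ENNReal.top_mul h2.1] at h1
  exact lt_irrefl _ h1

/-- Let `R ∈ A_1` be the Rubio de Francia majorant of `f₂ ^ (r / s)`. Hölder transfers the problem
to exponent `p` with weight `w R^(-e)`, which lies in `A_{s+e}`; leaving `A_s` is harmless since all
classes are admitted. -/
theorem Dominated.down (hF : ∀ f ∈ 𝓕, AEMeasurable f.1 volume ∧ AEMeasurable f.2 volume)
    {p r : ℝ} (hr : 0 < r) (hrp : r < p) (h : Dominated 𝓕 p) : Dominated 𝓕 r := by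
  intro s hs K
  have hp : 0 < p := hr.trans hrp
  obtain ⟨B, hB1, hB⟩ := exists_lintegral_maximal_rpow_le n hs K
  -- This exponent gives both `f₂ ^ (p - r) ≤ R ^ e` and, after Hölder, exactly the power `R ^ s`
  -- whose integral is controlled.
  set e : ℝ := s * (p - r) / r with he
  have hpr : 0 < p - r := by linarith
  have he0 : 0 < e := by positivity
  obtain ⟨C, hC⟩ := h (s + e) (by linarith) (K * (2 * B) ^ e)
  refine ⟨max 1 (C ^ (r / p) * (2 ^ s) ^ (1 - r / p)), fun w hw f hf => ?_⟩
  obtain ⟨hf1, hf2⟩ := hF f hf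
  have hwm := hw.weight.aemeasurable
  set Y := ∫⁻ x, f.2 x ^ r * w x with hY
  by_cases hYtop : Y = ∞
  · rw [hYtop, ENNReal.mul_top]
    · exact le_top
    · exact ENNReal.coe_ne_zero.2 (one_pos.trans_le (le_max_left _ _)).ne'
  set k : (Fin n → ℝ) → ℝ≥0∞ := fun x => f.2 x ^ (r / s) with hk
  have hkm : AEMeasurable k := hf2.pow_const _
  have hTm : ∀ g : (Fin n → ℝ) → ℝ≥0∞, AEMeasurable g → AEMeasurable (maximal g) :=
    fun g _ => measurable_maximal.aemeasurable
  set R := rdf maximal B k with hR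
  have hRm : AEMeasurable R := aemeasurable_rdf hTm hkm
  have hkR : ∀ x, k x ≤ R x := le_rdf
  have hMR : ∀ᵐ x, maximal R x ≤ (2 * B : ℝ≥0) * R x :=
    ae_apply_rdf_le hB1 hTm (fun F a hF ha => Eventually.of_forall fun x =>
      mmax_tsum_const_mul_le hF ha x) hkm
  have hks : ∫⁻ x, k x ^ s * w x = Y := by
    refine lintegral_congr fun x => ?_
    rw [hk, ← ENNReal.rpow_mul, div_mul_cancel₀ _ (by linarith)]
  have hRs : ∫⁻ x, R x ^ s * w x ≤ 2 ^ s * Y := by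
    rw [← hks, ← lintegral_withDensity_mul hwm (hRm.pow_const _),
      ← lintegral_withDensity_mul hwm (hkm.pow_const _)]
    refine lintegral_rdf_rpow_le hB1 hTm (withDensity_absolutelyContinuous _ _) hs.le
      (fun g hg => ?_) hkm
    rw [lintegral_withDensity_mul hwm (hg.pow_const _),
      lintegral_withDensity_mul hwm (measurable_maximal.pow_const _).aemeasurable]
    exact hB w g hw hg
  -- Here `R` could vanish, so the inequality with exponent `p` is used directly: `f₂ = 0` almost
  -- everywhere forces `f₁ = 0`.
  by_cases hY0 : Y = 0
  · have hf20 := ae_eq_zero_of_lintegral_eq_zero hw.weight hf2 hr hY0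
    obtain ⟨C', hC'⟩ := h s hs K
    have hf10 : ∫⁻ x, f.1 x ^ p * w x = 0 := by
      rw [← le_zero_iff]
      refine (hC' w hw f hf).trans (le_of_eq ?_)
      rw [lintegral_congr_ae (g := fun _ => 0), lintegral_zero, mul_zero]
      filter_upwards [hf20] with x hx
      rw [hx, ENNReal.zero_rpow_of_pos hp, zero_mul]
    rw [lintegral_congr_ae (g := fun _ => 0), lintegral_zero]
    · exact zero_le
    · filter_upwards [ae_eq_zero_of_lintegral_eq_zero hw.weight hf1 hp hf10] with x hx
      rw [hx, ENNReal.zero_rpow_of_pos hr, zero_mul]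
  have hRtop : ∀ᵐ x, R x ≠ ∞ := ae_ne_top_of_lintegral_ne_top hw.weight hRm (by linarith)
    (ne_top_of_le_ne_top (ENNReal.mul_ne_top (by finiteness) hYtop) hRs)
  have hRpos : ∀ᵐ x, R x ≠ 0 := by
    have hmax : ∀ x, maximal R x ≠ 0 := by
      refine mmax_ne_zero volume_closedBall_lt_top hRm fun h0 => hY0 ?_
      rw [← hks, lintegral_congr_ae (g := fun _ => 0), lintegral_zero]
      filter_upwards [h0] with x hx
      have : k x = 0 := le_zero_iff.1 ((hkR x).trans hx.le)
      rw [this, ENNReal.zero_rpow_of_pos (by linarith), zero_mul]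
    filter_upwards [hMR] with x hx h0
    rw [h0, mul_zero, le_zero_iff] at hx
    exact hmax x hx
  have hRA : A1 (2 * B) R := A1.of_maximal_le hRm (hRpos.and hRtop) hMR
  have hW := hw.mul_rpow_neg hs hRA he0
  have hp1 : r / p ≤ 1 := by rw [div_le_one hp]; exact hrp.le
  calc ∫⁻ x, f.1 x ^ r * w x
      = ∫⁻ x, (f.1 x ^ p * (w x * R x ^ (-e))) ^ (r / p) * (R x ^ s * w x) ^ (1 - r / p) := by
        refine lintegral_congr_ae ?_
        filter_upwards [hRpos, hRtop, hw.weight.ae_ne] with x h1 h2 h3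
        rw [ENNReal.mul_rpow_of_nonneg _ _ (by positivity), ← ENNReal.rpow_mul,
          mul_div_cancel₀ _ hp.ne', mul_assoc]
        obtain ⟨a, ha⟩ := exists_eq_eexp h1 h2
        obtain ⟨b, hb⟩ := exists_eq_eexp h3.1 h3.2
        simp only [ha, hb, eexp_rpow, eexp_mul]
        congr 2
        rw [he]
        field_simp
        ring
    _ ≤ (∫⁻ x, f.1 x ^ p * (w x * R x ^ (-e))) ^ (r / p) * (∫⁻ x, R x ^ s * w x) ^ (1 - r / p) :=
        ENNReal.lintegral_mul_norm_pow_le (by fun_prop) (by fun_prop) (by positivity)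
          (by linarith) (by ring)
    _ ≤ (C * Y) ^ (r / p) * (2 ^ s * Y) ^ (1 - r / p) := by
        refine mul_le_mul' (ENNReal.rpow_le_rpow ((hC _ hW f hf).trans ?_) (by positivity))
          (ENNReal.rpow_le_rpow hRs (by linarith))
        refine mul_le_mul_right (lintegral_mono_ae ?_) _
        filter_upwards [hRpos, hRtop] with x h1 h2
        have h3 : f.2 x ^ (p - r) ≤ R x ^ e := by
          refine le_trans (le_of_eq ?_) (ENNReal.rpow_le_rpow (hkR x) he0.le)
          rw [hk, ← ENNReal.rpow_mul]
          congr 1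
          rw [he]
          field_simp
        calc f.2 x ^ p * (w x * R x ^ (-e)) = f.2 x ^ r * w x * (f.2 x ^ (p - r) * R x ^ (-e)) := by
              have : f.2 x ^ p = f.2 x ^ r * f.2 x ^ (p - r) := by
                rw [← ENNReal.rpow_add_of_nonneg _ _ hr.le hpr.le]
                ring_nf
              rw [this]
              ring
          _ ≤ f.2 x ^ r * w x * (R x ^ e * R x ^ (-e)) := by gcongr
          _ = _ := by rw [← ENNReal.rpow_add _ _ h1 h2]; simp
    _ = ((C ^ (r / p) * (2 ^ s) ^ (1 - r / p) : ℝ≥0) : ℝ≥0∞) * Y := by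
        rw [ENNReal.mul_rpow_of_nonneg _ _ (by positivity), ENNReal.mul_rpow_of_nonneg _ _
          (by linarith), mul_mul_mul_comm, ← ENNReal.rpow_add_of_nonneg _ _ (by positivity)
          (by linarith), show r / p + (1 - r / p) = 1 by ring, ENNReal.rpow_one, ENNReal.coe_mul,
          coe_rpow (by positivity), coe_rpow (by linarith), coe_rpow (by linarith)]
        rfl
    _ ≤ _ := by
        gcongr
        exact le_max_right _ _

/-- Duality: `g ^ r = g ^ p · g ^ (r - p)`, and the second factor is majorized by an `H` built with
the maximal operator of the measure `w dx`. Then `H w` stays in `A_s`, and the inequality with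
exponent `p` applies to it. -/
theorem Dominated.up (hF : ∀ f ∈ 𝓕, AEMeasurable f.1 volume ∧ AEMeasurable f.2 volume)
    {p r : ℝ} (hp : 0 < p) (hpr : p < r) (h : Dominated 𝓕 p) : Dominated 𝓕 r := by
  intro s hs K
  have hr : 0 < r := hp.trans hpr
  have hrp : 0 < r - p := by linarith
  set m : ℝ := r / (r - p) with hm
  have hm1 : 1 < m := by rw [hm, lt_div_iff₀ hrp]; linarith
  obtain ⟨B, hB1, hB⟩ := exists_lintegral_mmax_rpow_le n (K * (5 ^ n) ^ s) hm1
  obtain ⟨C, hC⟩ := h s hs (K * (2 * B))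
  refine ⟨(C * 2) ^ (r / p), fun w hw f hf => ?_⟩
  obtain ⟨hf1, hf2⟩ := hF f hf
  have hwm := hw.weight.aemeasurable
  have hwd := hw.isDoubling hs
  have hac : volume.withDensity w ≪ volume := withDensity_absolutelyContinuous _ _
  set Y := ∫⁻ x, f.2 x ^ r * w x with hY
  -- Bounded, compactly supported truncations make `X` finite, so that its power can be cancelled;
  -- monotone convergence removes them.
  set g : ℕ → (Fin n → ℝ) → ℝ≥0∞ := fun N => (closedBall 0 (N : ℝ)).indicator
    fun x => min (f.1 x) N with hg
  have hgm : ∀ N, AEMeasurable (g N) := fun N =>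
    (hf1.min aemeasurable_const).indicator measurableSet_closedBall
  have hgf : ∀ N x, g N x ≤ f.1 x := fun N x =>
    (indicator_le_self' (fun _ _ => zero_le) x).trans (min_le_left _ _)
  have hgN : ∀ N, ∫⁻ x, g N x ^ r * w x ≤ ((C * 2) ^ (r / p) : ℝ≥0) * Y := by
    intro N
    set X := ∫⁻ x, g N x ^ r * w x with hX
    by_cases hX0 : X = 0
    · rw [hX0]
      exact zero_le
    have hXtop : X ≠ ∞ := by
      refine ne_top_of_le_ne_top (b := (N : ℝ≥0∞) ^ r * ∫⁻ x in closedBall 0 (N : ℝ), w x)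
        (ENNReal.mul_ne_top (by finiteness) (hw.weight.locally_integrable _ _).ne) ?_
      rw [← lintegral_const_mul' _ _ (by finiteness), ← lintegral_indicator measurableSet_closedBall]
      refine lintegral_mono fun x => ?_
      by_cases hx : x ∈ closedBall (0 : Fin n → ℝ) N
      · rw [indicator_of_mem hx]
        gcongr
        exact (congrFun (congrFun hg N) x).trans_le ((indicator_of_mem hx _).trans_le (min_le_right _ _))
      · have h0 : g N x = 0 := (congrFun (congrFun hg N) x).trans (indicator_of_notMem hx _)
        rw [indicator_of_notMem hx, h0, ENNReal.zero_rpow_of_pos hr, zero_mul]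
    set k : (Fin n → ℝ) → ℝ≥0∞ := fun x => g N x ^ (r - p) with hk
    have hkm : AEMeasurable k := (hgm N).pow_const _
    have hTm : ∀ g : (Fin n → ℝ) → ℝ≥0∞, AEMeasurable g →
        AEMeasurable (mmax (volume.withDensity w) g) := fun g _ => hwd.measurable_mmax.aemeasurable
    set H := rdf (mmax (volume.withDensity w)) B k with hH
    have hHm : AEMeasurable H := aemeasurable_rdf hTm hkm
    have hkH : ∀ x, k x ≤ H x := le_rdf
    have hMH : ∀ᵐ x, mmax (volume.withDensity w) H x ≤ (2 * B : ℝ≥0) * H x :=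
      ae_apply_rdf_le hB1 hTm (fun F a hF ha => Eventually.of_forall fun x =>
        mmax_tsum_const_mul_le (fun k => (hF k).mono_ac hac) ha x) hkm
    have hkX : ∫⁻ x, k x ^ m * w x = X := by
      refine lintegral_congr fun x => ?_
      rw [hk, ← ENNReal.rpow_mul, hm, mul_div_cancel₀ _ hrp.ne']
    have hHm' : ∫⁻ x, H x ^ m * w x ≤ 2 ^ m * X := by
      rw [← hkX, ← lintegral_withDensity_mul hwm (hHm.pow_const _),
        ← lintegral_withDensity_mul hwm (hkm.pow_const _)]
      exact lintegral_rdf_rpow_le hB1 hTm hac hm1.le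
        (fun g hg => hB _ hwd g (hg.mono_ac hac)) hkm
    have hHtop : ∀ᵐ x, H x ≠ ∞ := ae_ne_top_of_lintegral_ne_top hw.weight hHm (by linarith)
      (ne_top_of_le_ne_top (ENNReal.mul_ne_top (by finiteness) hXtop) hHm')
    have hHpos : ∀ᵐ x, H x ≠ 0 := by
      have hmax : ∀ x, mmax (volume.withDensity w) H x ≠ 0 := by
        refine mmax_ne_zero hwd.lt_top (hHm.mono_ac hac) fun h0 => hX0 ?_
        rw [← hkX, ← lintegral_withDensity_mul hwm (hkm.pow_const _),
          lintegral_congr_ae (g := fun _ => 0), lintegral_zero]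
        filter_upwards [h0] with x hx
        have : k x = 0 := le_zero_iff.1 ((hkH x).trans hx.le)
        rw [this, ENNReal.zero_rpow_of_pos (by linarith)]
      filter_upwards [hMH] with x hx h0
      rw [h0, mul_zero, le_zero_iff] at hx
      exact hmax x hx
    have hHw := hw.mul_of_mmax_le hs hHm (hHpos.and hHtop) hMH
    have hpr1 : p / r ≤ 1 := by rw [div_le_one hr]; exact hpr.le
    have key : X ≤ C * (Y ^ (p / r) * (2 ^ m * X) ^ (1 - p / r)) := by
      calc X ≤ ∫⁻ x, f.1 x ^ p * (H x * w x) := by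
            refine lintegral_mono fun x => ?_
            have : g N x ^ r = g N x ^ p * k x := by
              rw [hk, ← ENNReal.rpow_add_of_nonneg _ _ hp.le hrp.le]
              ring_nf
            dsimp only
            rw [this, mul_assoc]
            gcongr
            · exact hgf N x
            · exact hkH x
        _ ≤ C * ∫⁻ x, f.2 x ^ p * (H x * w x) := hC _ hHw f hf
        _ = C * ∫⁻ x, (f.2 x ^ r * w x) ^ (p / r) * (H x ^ m * w x) ^ (1 - p / r) := by
            congr 1
            refine lintegral_congr_ae ?_
            filter_upwards [hHpos, hHtop, hw.weight.ae_ne] with x h1 h2 h3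
            rw [ENNReal.mul_rpow_of_nonneg _ _ (by positivity), ← ENNReal.rpow_mul,
              mul_div_cancel₀ _ hr.ne', mul_assoc]
            obtain ⟨a, ha⟩ := exists_eq_eexp h1 h2
            obtain ⟨b, hb⟩ := exists_eq_eexp h3.1 h3.2
            simp only [ha, hb, eexp_rpow, eexp_mul]
            congr 2
            rw [hm]
            field_simp
            ring
        _ ≤ C * (Y ^ (p / r) * (∫⁻ x, H x ^ m * w x) ^ (1 - p / r)) := by
            gcongr
            exact ENNReal.lintegral_mul_norm_pow_le (by fun_prop) (by fun_prop) (by positivity)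
              (by linarith) (by ring)
        _ ≤ _ := by gcongr
    have key2 : X ^ (p / r) ≤ (C * 2 : ℝ≥0) * Y ^ (p / r) := by
      have h2 : ((2 : ℝ≥0∞) ^ m) ^ (1 - p / r) = 2 := by
        rw [← ENNReal.rpow_mul, hm, show r / (r - p) * (1 - p / r) = 1 by field_simp,
          ENNReal.rpow_one]
      rw [ENNReal.mul_rpow_of_nonneg _ _ (by linarith : 0 ≤ 1 - p / r), h2] at key
      have hXp := rpow_ne_zero_top ⟨hX0, hXtop⟩ (1 - p / r)
      rw [← ENNReal.mul_le_mul_iff_left hXp.1 hXp.2, ← ENNReal.rpow_add _ _ hX0 hXtop]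
      rw [show p / r + (1 - p / r) = 1 by ring, ENNReal.rpow_one]
      refine key.trans (le_of_eq ?_)
      push_cast
      ring
    have key3 := ENNReal.rpow_le_rpow key2 (by positivity : 0 ≤ r / p)
    rwa [ENNReal.mul_rpow_of_nonneg _ _ (by positivity), ← ENNReal.rpow_mul, ← ENNReal.rpow_mul,
      show p / r * (r / p) = 1 by field_simp, ENNReal.rpow_one, ENNReal.rpow_one,
      ← coe_rpow (by positivity)] at key3
  refine le_of_tendsto' (lintegral_tendsto_of_tendsto_of_monotone
    (fun N => ((hgm N).pow_const r).mul hwm) (Eventually.of_forall fun x a b hab => ?_)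
    (Eventually.of_forall fun x => ?_)) hgN
  · dsimp only
    refine mul_le_mul_left (ENNReal.rpow_le_rpow ?_ hr.le) _
    have hab' : (a : ℝ) ≤ b := by exact_mod_cast hab
    have hab'' : (a : ℝ≥0∞) ≤ b := by exact_mod_cast hab
    by_cases hx : x ∈ closedBall (0 : Fin n → ℝ) a
    · rw [hg]
      dsimp only
      rw [indicator_of_mem hx, indicator_of_mem (closedBall_subset_closedBall hab' hx)]
      gcongr
    · rw [hg]
      dsimp only
      rw [indicator_of_notMem hx]
      exact zero_le
  · have hlim : Tendsto (fun N => g N x) atTop (𝓝 (f.1 x)) := by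
      have h1 : Tendsto (fun N : ℕ => min (f.1 x) (N : ℝ≥0∞)) atTop (𝓝 (min (f.1 x) ∞)) :=
        tendsto_const_nhds.min ENNReal.tendsto_nat_nhds_top
      rw [min_eq_left le_top] at h1
      refine h1.congr' ?_
      obtain ⟨N, hN⟩ := exists_nat_ge (dist x 0)
      filter_upwards [eventually_ge_atTop N] with M hM
      rw [hg]
      dsimp only
      rw [indicator_of_mem]
      exact mem_closedBall.2 (hN.trans (by exact_mod_cast hM))
    by_cases hf0 : f.1 x = 0
    · have : ∀ N, g N x = 0 := fun N => le_zero_iff.1 (hf0 ▸ hgf N x)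
      simp [this, hf0]
    · refine ENNReal.Tendsto.mul_const ((ENNReal.continuous_rpow_const.tendsto _).comp hlim)
        (Or.inl ?_)
      simp [hf0, hr.le, hr]

theorem Dominated.of_pos (hF : ∀ f ∈ 𝓕, AEMeasurable f.1 volume ∧ AEMeasurable f.2 volume)
    {p r : ℝ} (hp : 0 < p) (hr : 0 < r) (h : Dominated 𝓕 p) : Dominated 𝓕 r := by
  rcases lt_trichotomy r p with h1 | rfl | h1
  · exact h.down hF hr h1
  · exact h
  · exact h.up hF hp h1

end Muckenhoupt

namespace Muckenhoupt
open Metric Filter Set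
open scoped Topology

variable {n : ℕ}

/-! ### The mixed weak-type inequality -/

theorem A1.rpow_mul_rpow_of_lt {K L : ℝ≥0} {u v : (Fin n → ℝ) → ℝ≥0∞} (hu : A1 K u) (hv : A1 L v)
    {a b : ℝ} (ha : 0 ≤ a) (ha1 : a < 1) (hb : 0 ≤ b) (hab : a + b ≤ 1) :
    A1 (K ^ a * (L ^ (b / (1 - a))) ^ (1 - a)) (fun x => u x ^ a * v x ^ b) := by
  have h1 : 0 < 1 - a := by linarith
  have h := hu.rpow_mul_rpow (hv.rpow (a := b / (1 - a)) (by positivity)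
    (by rw [div_le_one h1]; linarith)) ha h1.le (by ring)
  refine h.congr (Eventually.of_forall fun x => ?_)
  dsimp only
  rw [← ENNReal.rpow_mul, div_mul_cancel₀ _ h1.ne']

/-- Characteristic functions have bounded majorants `H` such that `H u₀` is an `A_1` weight. -/
theorem exists_majorant (hn : 0 < n) {a b : ℝ} (ha : 0 ≤ a) (hb : 0 ≤ b) (K : ℝ≥0) :
    ∃ (P : ℝ) (L : ℝ≥0), 1 < P ∧ ∀ u₀ v₀ ω₁ ω₂ W : (Fin n → ℝ) → ℝ≥0∞,
      A1 K u₀ → A1 K v₀ → A1 K ω₁ → A1 K ω₂ →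
      (∀ᵐ x, W x = u₀ x * ω₁ x ^ (-a) * (v₀ x * ω₂ x ^ (-b))) →
      ∀ E : Set (Fin n → ℝ), NullMeasurableSet E → ∫⁻ x in E, W x ≠ 0 →
      ∃ H : (Fin n → ℝ) → ℝ≥0∞, AEMeasurable H ∧ (∀ x ∈ E, 1 ≤ H x) ∧ (∀ᵐ x, H x ≤ 2) ∧
        (∀ᵐ x, H x ≠ 0) ∧ ∫⁻ x, H x ^ P * W x ≤ 2 ^ P * ∫⁻ x in E, W x ∧
        A1 L (fun x => H x * u₀ x) := by
  obtain ⟨θ, hθ, hθ1, hmul⟩ := exists_A1_mul_rpow hn K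
  -- The added `1` keeps `a / A` below one and `A` positive even for `a = b = 0`.
  set A : ℝ := a + b + 1 with hA
  have hA0 : 0 < A := by positivity
  have haA : a / A < 1 := by rw [div_lt_one hA0]; linarith
  obtain ⟨K₁, hK₁⟩ := hmul θ hθ.le le_rfl (K ^ (a / A) * (K ^ (b / A / (1 - a / A))) ^ (1 - a / A))
  -- Then `u₀^(-P) W = v₀ (u₀ (ω₁^(a/A) ω₂^(b/A))^θ)^(-(P-1))`. The parenthesis is in `A_1` by the
  -- choice of `θ`, so this weight is in `A_P`, and boundedness of `M` on it is boundedness of `g ↦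
  -- M(g u₀)/u₀` on `L^P(W)`.
  set P : ℝ := 1 + A / θ with hP
  have hP1 : 1 < P := by rw [hP]; linarith [div_pos hA0 hθ]
  obtain ⟨C, hC1, hC⟩ := exists_lintegral_maximal_rpow_le n hP1 (K * K₁ ^ (A / θ))
  -- One constant for both spaces: `C` bounds the operator on `L^P(W)` and `K` on `L^∞`.
  set B : ℝ≥0 := max C K with hB
  have hB1 : 1 ≤ B := hC1.trans (le_max_left _ _)
  refine ⟨P, 2 * B, hP1, fun u₀ v₀ ω₁ ω₂ W hu₀ hv₀ hω₁ hω₂ hW E hE hE0 => ?_⟩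
  have hu₀m := hu₀.weight.aemeasurable
  have hWne : ∀ᵐ x, W x ≠ 0 ∧ W x ≠ ∞ := by
    filter_upwards [hW, hu₀.weight.ae_ne, hv₀.weight.ae_ne, hω₁.weight.ae_ne, hω₂.weight.ae_ne]
      with x h h1 h2 h3 h4
    rw [h]
    exact mul_ne_zero_top (mul_ne_zero_top h1 (rpow_ne_zero_top h3 _))
      (mul_ne_zero_top h2 (rpow_ne_zero_top h4 _))
  have hWm : AEMeasurable W := by
    have h1 := hv₀.weight.aemeasurable
    have h2 := hω₁.weight.aemeasurable
    have h3 := hω₂.weight.aemeasurable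
    exact AEMeasurable.congr (by fun_prop) (EventuallyEq.symm hW)
  have hω := hω₁.rpow_mul_rpow_of_lt hω₂ (a := a / A) (b := b / A) (by positivity) haA
    (by positivity) (by rw [← add_div, div_le_one hA0]; linarith)
  have hW' := hv₀.ap (hK₁ _ _ hu₀ hω) (e := A / θ) (by positivity)
  rw [← hP] at hW'
  have hWW' : ∀ᵐ x, v₀ x * (u₀ x * (ω₁ x ^ (a / A) * ω₂ x ^ (b / A)) ^ θ) ^ (-(A / θ)) =
      u₀ x ^ (-P) * W x := by
    filter_upwards [hW, hu₀.weight.ae_ne, hv₀.weight.ae_ne, hω₁.weight.ae_ne, hω₂.weight.ae_ne]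
      with x h h1 h2 h3 h4
    obtain ⟨t1, e1⟩ := exists_eq_eexp h1.1 h1.2
    obtain ⟨t2, e2⟩ := exists_eq_eexp h2.1 h2.2
    obtain ⟨t3, e3⟩ := exists_eq_eexp h3.1 h3.2
    obtain ⟨t4, e4⟩ := exists_eq_eexp h4.1 h4.2
    simp only [h, e1, e2, e3, e4, eexp_rpow, eexp_mul]
    congr 1
    rw [hP]
    field_simp
    ring
  have hW'' := hW'.congr hWW'
  set T : ((Fin n → ℝ) → ℝ≥0∞) → (Fin n → ℝ) → ℝ≥0∞ := fun g x =>
    (u₀ x)⁻¹ * maximal (fun y => g y * u₀ y) x with hT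
  have hTm : ∀ g, AEMeasurable g → AEMeasurable (T g) := fun g _ =>
    hu₀m.inv.mul measurable_maximal.aemeasurable
  have hsub : ∀ (F : ℕ → (Fin n → ℝ) → ℝ≥0∞) (c : ℕ → ℝ≥0∞), (∀ k, AEMeasurable (F k)) →
      (∀ k, c k ≠ ∞) → ∀ᵐ x, T (fun y => ∑' k, c k * F k y) x ≤ ∑' k, c k * T (F k) x := by
    intro F c hF hc
    refine Eventually.of_forall fun x => ?_
    simp only [hT]
    simp_rw [mul_left_comm (c _), ENNReal.tsum_mul_left, ← ENNReal.tsum_mul_right, mul_assoc]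
    gcongr
    exact mmax_tsum_const_mul_le (fun k => (hF k).mul hu₀m) hc x
  have hbd : ∀ g, AEMeasurable g → ∫⁻ x, T g x ^ P ∂(volume.withDensity W) ≤
      B * ∫⁻ x, g x ^ P ∂(volume.withDensity W) := by
    intro g hg
    rw [lintegral_withDensity_mul hWm (hg.pow_const _),
      lintegral_withDensity_mul hWm ((hTm g hg).pow_const _)]
    calc ∫⁻ x, T g x ^ P * W x
        = ∫⁻ x, maximal (fun y => g y * u₀ y) x ^ P * (u₀ x ^ (-P) * W x) := by
          refine lintegral_congr fun x => ?_
          rw [hT, ENNReal.mul_rpow_of_nonneg _ _ (by linarith), ENNReal.inv_rpow, ENNReal.rpow_neg]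
          ring
      _ ≤ C * ∫⁻ x, (g x * u₀ x) ^ P * (u₀ x ^ (-P) * W x) := hC _ _ hW'' (by fun_prop)
      _ = C * ∫⁻ x, g x ^ P * W x := by
          congr 1
          refine lintegral_congr_ae ?_
          filter_upwards [hu₀.weight.ae_ne] with x hx
          rw [ENNReal.mul_rpow_of_nonneg _ _ (by linarith), mul_assoc, ← mul_assoc (u₀ x ^ P),
            ← ENNReal.rpow_add _ _ hx.1 hx.2, add_neg_cancel, ENNReal.rpow_zero, one_mul]
      _ ≤ _ := by
          gcongr
          exact le_max_left _ _
  have hbd' : ∀ (g : (Fin n → ℝ) → ℝ≥0∞) (c : ℝ≥0∞), (∀ᵐ x, g x ≤ c) →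
      ∀ᵐ x, T g x ≤ B * c := by
    intro g c hgc
    by_cases hc : c = ∞
    · refine Eventually.of_forall fun x => ?_
      rw [hc, ENNReal.mul_top (ENNReal.coe_ne_zero.2 (one_pos.trans_le hB1).ne')]
      exact le_top
    filter_upwards [hu₀.le, hu₀.weight.ae_ne] with x hx hx'
    calc T g x ≤ (u₀ x)⁻¹ * (c * (K * u₀ x)) := by
          refine mul_le_mul_right ?_ _
          calc maximal (fun y => g y * u₀ y) x ≤ maximal (fun y => c * u₀ y) x := by
                refine mmax_mono ?_ x
                filter_upwards [hgc] with y hy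
                gcongr
            _ ≤ c * maximal u₀ x := mmax_const_mul_le hc x
            _ ≤ _ := by gcongr
      _ = K * c * ((u₀ x)⁻¹ * u₀ x) := by ring
      _ = K * c := by rw [ENNReal.inv_mul_cancel hx'.1 hx'.2, mul_one]
      _ ≤ _ := by
          gcongr
          exact le_max_right _ _
  set h : (Fin n → ℝ) → ℝ≥0∞ := E.indicator fun _ => 1 with hh
  have hhm : AEMeasurable h := aemeasurable_const.indicator₀ hE
  set H := rdf T B h with hH
  have hHm : AEMeasurable H := aemeasurable_rdf hTm hhm
  have hHE : ∀ x ∈ E, 1 ≤ H x := fun x hx =>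
    (indicator_of_mem hx (fun _ => (1 : ℝ≥0∞))).ge.trans (le_rdf x)
  have hTH : ∀ᵐ x, T H x ≤ (2 * B : ℝ≥0) * H x := ae_apply_rdf_le hB1 hTm hsub hhm
  have hH2 : ∀ᵐ x, H x ≤ 2 := ae_rdf_le_two hB1 hbd' (Eventually.of_forall fun x =>
    indicator_le' (fun _ _ => le_rfl) (fun _ _ => zero_le_one) x)
  have hMH : ∀ᵐ x, maximal (fun y => H y * u₀ y) x ≤ (2 * B : ℝ≥0) * (H x * u₀ x) := by
    filter_upwards [hTH, hu₀.weight.ae_ne] with x hx hx'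
    calc maximal (fun y => H y * u₀ y) x = u₀ x * T H x := by
          rw [hT, ← mul_assoc, ENNReal.mul_inv_cancel hx'.1 hx'.2, one_mul]
      _ ≤ u₀ x * ((2 * B : ℝ≥0) * H x) := by gcongr
      _ = _ := by ring
  have hHpos : ∀ᵐ x, H x ≠ 0 := by
    have hmax : ∀ x, maximal (fun y => H y * u₀ y) x ≠ 0 := by
      refine mmax_ne_zero volume_closedBall_lt_top (by fun_prop) fun h0 => hE0 ?_
      rw [lintegral_eq_zero_iff' hWm.restrict]
      filter_upwards [ae_restrict_mem₀ hE, ae_restrict_of_ae h0,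
        ae_restrict_of_ae hu₀.weight.ae_ne] with x h1 h2 h3
      have h4 : H x = 0 := by simpa [h3.1] using h2
      have h5 := hHE x h1
      simp [h4] at h5
    filter_upwards [hMH] with x hx h0
    rw [h0, zero_mul, mul_zero, le_zero_iff] at hx
    exact hmax x hx
  refine ⟨H, hHm, hHE, hH2, hHpos, ?_, A1.of_maximal_le (by fun_prop) ?_ hMH⟩
  · rw [← lintegral_withDensity_mul hWm (hHm.pow_const _)]
    refine (lintegral_rdf_rpow_le hB1 hTm (withDensity_absolutelyContinuous _ _) hP1.le hbd
      hhm).trans (le_of_eq ?_)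
    rw [lintegral_withDensity_mul hWm (hhm.pow_const _), ← lintegral_indicator₀ hE]
    congr 1
    refine lintegral_congr fun x => ?_
    by_cases hx : x ∈ E
    · simp [hh, hx]
    · simp [hh, hx, (by linarith : 0 < P)]
  · filter_upwards [hHpos, hH2, hu₀.weight.ae_ne] with x h1 h2 h3
    exact mul_ne_zero_top ⟨h1, ne_top_of_le_ne_top (by simp) h2⟩ h3

/-- A Hölder-type inequality between a weak Lebesgue space and a bounded function in `L^P`. -/
theorem lintegral_rpow_mul_le_of_weak {q P r : ℝ} (hP : 1 < P) (hr : 0 < r)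
    (hrP : q * (1 - 1 / P) < r) (hrq : r < q) {W H g : (Fin n → ℝ) → ℝ≥0∞}
    (hWm : AEMeasurable W) (hHm : AEMeasurable H) (hgm : AEMeasurable g)
    (hH2 : ∀ᵐ x, H x ≤ 2) {m N : ℝ≥0∞}
    (hm : m ≠ 0 ∧ m ≠ ∞) (hN : N ≠ 0 ∧ N ≠ ∞) (hHP : ∫⁻ x, H x ^ P * W x ≤ 2 ^ P * m)
    (hweak : ∀ t : ℝ, 0 < t → ∫⁻ x in {x | ENNReal.ofReal t < g x}, W x ≤
      N ^ q * ENNReal.ofReal (t ^ (-q))) :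
    ∫⁻ x, g x ^ r * (H x * W x) ≤
      ENNReal.ofReal (2 * (r / (r - q * (1 - 1 / P)) + r / (q - r))) *
        (N ^ r * m ^ (1 - r / q)) := by
  have hq : 0 < q := hr.trans hrq
  have hP0 : 0 < P := by linarith
  have hP1 : 0 < 1 - 1 / P := by
    rw [sub_pos, div_lt_one hP0]
    exact hP
  have hν : ∀ t : ℝ, (volume.withDensity fun x => H x * W x) {x | ENNReal.ofReal t < g x} =
      ∫⁻ x in {x | ENNReal.ofReal t < g x}, H x * W x := fun t =>
    withDensity_apply₀ _ (nullMeasurableSet_lt aemeasurable_const hgm)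
  obtain ⟨lm, hlm⟩ := exists_eq_eexp hm.1 hm.2
  obtain ⟨lN, hlN⟩ := exists_eq_eexp hN.1 hN.2
  -- This is `N m^(-1/q)`, the level at which the two distribution bounds below agree.
  set s : ℝ := Real.exp (lN - lm / q) with hs
  have hs0 : 0 < s := Real.exp_pos _
  have h2P : (2 ^ P * m) ^ (1 / P) = 2 * m ^ (1 / P) := by
    rw [ENNReal.mul_rpow_of_nonneg _ _ (by positivity), ← ENNReal.rpow_mul,
      mul_one_div_cancel hP0.ne', ENNReal.rpow_one]
  -- The distribution of `g` under `H W` decays with exponent `q (1 - 1/P)` by Hölder and the `L^P`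
  -- bound on `H`, and with exponent `q` because `H ≤ 2`; these exponents enclose `r`.
  have key := lintegral_rpow_le_of_weak (ν := volume.withDensity fun x => H x * W x) (g := g)
    (hgm.mono_ac (withDensity_absolutelyContinuous _ _)) hr hrP hrq
    (C₁ := 2 * m ^ (1 / P) * N ^ (q * (1 - 1 / P))) (C₂ := 2 * N ^ q) ?_ ?_ hs0
  · rw [lintegral_withDensity_mul (by fun_prop) (hgm.pow_const _)] at key
    refine key.trans (le_of_eq ?_)
    have hsr : ∀ y : ℝ, s ^ y = Real.exp ((lN - lm / q) * y) := fun y => by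
      rw [hs, ← Real.exp_mul]
    have hc1 : 0 ≤ r / (r - q * (1 - 1 / P)) := div_nonneg hr.le (by linarith)
    have hc2 : 0 ≤ r / (q - r) := div_nonneg hr.le (by linarith)
    rw [ENNReal.ofReal_mul hc1, ENNReal.ofReal_mul hc2, hsr, hsr, ← eexp, ← eexp, hlm, hlN,
      eexp_rpow, eexp_rpow, eexp_rpow, eexp_rpow, eexp_rpow, eexp_mul,
      ENNReal.ofReal_mul zero_le_two, ENNReal.ofReal_add hc1 hc2,
      show ENNReal.ofReal 2 = 2 by simp, mul_assoc 2, eexp_mul]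
    have e1 : eexp (lm * (1 / P) + lN * (q * (1 - 1 / P))) *
        eexp ((lN - lm / q) * (r - q * (1 - 1 / P))) = eexp (lN * r + lm * (1 - r / q)) := by
      rw [eexp_mul]
      congr 1
      field_simp
      ring
    have e2 : eexp (lN * q) * eexp ((lN - lm / q) * (r - q)) = eexp (lN * r + lm * (1 - r / q)) := by
      rw [eexp_mul]
      congr 1
      field_simp
      ring
    calc _ = 2 * ENNReal.ofReal (r / (r - q * (1 - 1 / P))) *
          (eexp (lm * (1 / P) + lN * (q * (1 - 1 / P))) *
            eexp ((lN - lm / q) * (r - q * (1 - 1 / P)))) +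
          2 * ENNReal.ofReal (r / (q - r)) *
            (eexp (lN * q) * eexp ((lN - lm / q) * (r - q))) := by ring
      _ = _ := by rw [e1, e2]; ring
  · intro t ht
    rw [hν]
    calc ∫⁻ x in {x | ENNReal.ofReal t < g x}, H x * W x
        = ∫⁻ x in {x | ENNReal.ofReal t < g x}, (H x ^ P * W x) ^ (1 / P) * W x ^ (1 - 1 / P) := by
          refine lintegral_congr fun x => ?_
          rw [ENNReal.mul_rpow_of_nonneg _ _ (by positivity), ← ENNReal.rpow_mul,
            mul_one_div_cancel hP0.ne', ENNReal.rpow_one, mul_assoc,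
            ← ENNReal.rpow_add_of_nonneg _ _ (by positivity) hP1.le,
            show 1 / P + (1 - 1 / P) = 1 by ring, ENNReal.rpow_one]
      _ ≤ (∫⁻ x in {x | ENNReal.ofReal t < g x}, H x ^ P * W x) ^ (1 / P) *
          (∫⁻ x in {x | ENNReal.ofReal t < g x}, W x) ^ (1 - 1 / P) :=
          ENNReal.lintegral_mul_norm_pow_le (by fun_prop) (by fun_prop) (by positivity) hP1.le
            (by ring)
      _ ≤ (2 ^ P * m) ^ (1 / P) * (N ^ q * ENNReal.ofReal (t ^ (-q))) ^ (1 - 1 / P) := by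
          gcongr
          · exact (setLIntegral_le_lintegral _ _).trans hHP
          · exact hweak t ht
      _ = _ := by
          rw [h2P, ENNReal.mul_rpow_of_nonneg _ _ hP1.le, ← ENNReal.rpow_mul,
            ENNReal.ofReal_rpow_of_nonneg (by positivity) hP1.le, ← Real.rpow_mul ht.le, neg_mul]
          ring
  · intro t ht
    rw [hν]
    calc ∫⁻ x in {x | ENNReal.ofReal t < g x}, H x * W x
        ≤ ∫⁻ x in {x | ENNReal.ofReal t < g x}, 2 * W x := by
          refine lintegral_mono_ae ?_
          filter_upwards [ae_restrict_of_ae hH2] with x hx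
          gcongr
      _ = 2 * ∫⁻ x in {x | ENNReal.ofReal t < g x}, W x := lintegral_const_mul' _ _ (by simp)
      _ ≤ _ := by
          rw [mul_assoc]
          gcongr
          exact hweak t ht

theorem setLIntegral_le_of_weakNorm_le {q : ℝ} (hq : 0 < q) {W g : (Fin n → ℝ) → ℝ≥0∞} {N : ℝ≥0∞}
    (h : weakNorm q W g ≤ N) {t : ℝ} (ht : 0 < t) :
    ∫⁻ x in {x | ENNReal.ofReal t < g x}, W x ≤ N ^ q * ENNReal.ofReal (t ^ (-q)) := by
  have h1 : ENNReal.ofReal t * (∫⁻ x in {x | ENNReal.ofReal t < g x}, W x) ^ (1 / q) ≤ N := by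
    refine le_trans ?_ h
    refine le_iSup_of_le t.toNNReal (le_iSup_of_le (by simpa using ht) le_rfl)
  have h2 := ENNReal.rpow_le_rpow h1 hq.le
  rw [ENNReal.mul_rpow_of_nonneg _ _ hq.le, ← ENNReal.rpow_mul, one_div_mul_cancel hq.ne',
    ENNReal.rpow_one, ENNReal.ofReal_rpow_of_pos ht] at h2
  calc _ = (ENNReal.ofReal (t ^ q) * ∫⁻ x in {x | ENNReal.ofReal t < g x}, W x) *
        ENNReal.ofReal (t ^ (-q)) := by
        rw [mul_right_comm, ← ENNReal.ofReal_mul (by positivity), ← Real.rpow_add ht]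
        simp
    _ ≤ _ := by gcongr

end Muckenhoupt

namespace Muckenhoupt
open Metric Filter Set
open scoped Topology

variable {n : ℕ} {𝓕 : Set (((Fin n → ℝ) → ℝ≥0∞) × ((Fin n → ℝ) → ℝ≥0∞))}

/-- The mixed weak-type inequality for products of powers of `A_1` weights. -/
theorem exists_weakNorm_le (hn : 0 < n)
    (hF : ∀ f ∈ 𝓕, AEMeasurable f.1 volume ∧ AEMeasurable f.2 volume)
    (hdom : ∀ r : ℝ, 0 < r → Dominated 𝓕 r) {q : ℝ} (hq : 0 < q) {a b : ℝ} (ha : 0 ≤ a) (hb : 0 ≤ b)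
    (K : ℝ≥0) : ∃ C : ℝ≥0, ∀ u₀ v₀ ω₁ ω₂ u v : (Fin n → ℝ) → ℝ≥0∞,
      A1 K u₀ → A1 K v₀ → A1 K ω₁ → A1 K ω₂ → (∀ᵐ x, u x = u₀ x * ω₁ x ^ (-a)) →
      (∀ᵐ x, v x ^ q = v₀ x * ω₂ x ^ (-b)) → ∀ f ∈ 𝓕,
        weakNorm q (fun x => u x * v x ^ q) (fun x => f.1 x * (v x)⁻¹) ≤
          C * weakNorm q (fun x => u x * v x ^ q) (fun x => f.2 x * (v x)⁻¹) := by
  obtain ⟨P, L, hP, hmaj⟩ := exists_majorant hn ha hb K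
  obtain ⟨θ, hθ, hθ1, hmul⟩ := exists_A1_mul_rpow hn L
  have hP0 : 0 < P := by linarith
  -- The bound by `θ` keeps `H u₀ v₀^ε` in `A_1`; the bound below `1 / P` makes `r = q (1 - ε)`
  -- exceed `q (1 - 1/P)`.
  set ε : ℝ := min θ (1 / (2 * P)) with hε
  have hε0 : 0 < ε := by positivity
  have hεθ : ε ≤ θ := min_le_left _ _
  have hε1 : ε < 1 := hεθ.trans_lt hθ1
  have hεP : ε < 1 / P := by
    refine (min_le_right _ _).trans_lt ?_
    rw [div_lt_div_iff₀ (by positivity) hP0]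
    linarith
  set r : ℝ := q * (1 - ε) with hr
  have hr0 : 0 < r := mul_pos hq (by linarith)
  have hrq : r < q := by rw [hr]; nlinarith
  have hrP : q * (1 - 1 / P) < r := by rw [hr]; gcongr
  set A : ℝ := a + b + 1 with hA
  have hA0 : 0 < A := by positivity
  have haA : a / A < 1 := by rw [div_lt_one hA0]; linarith
  obtain ⟨K₂, hK₂⟩ := hmul ε hε0.le hεθ K
  obtain ⟨C₁, hC₁⟩ := hdom r hr0 (1 + A) (by linarith)
    (K₂ * (K ^ (a / A) * (K ^ (b * ε / A / (1 - a / A))) ^ (1 - a / A)) ^ A)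
  set C₂ : ℝ≥0 := Real.toNNReal (2 * (r / (r - q * (1 - 1 / P)) + r / (q - r))) with hC₂
  refine ⟨(C₁ * C₂) ^ (1 / r) + 1, fun u₀ v₀ ω₁ ω₂ u v hu₀ hv₀ hω₁ hω₂ hu hv f hf => ?_⟩
  obtain ⟨hf1, hf2⟩ := hF f hf
  set W : (Fin n → ℝ) → ℝ≥0∞ := fun x => u x * v x ^ q with hWdef
  have hu₀m := hu₀.weight.aemeasurable
  have hv₀m := hv₀.weight.aemeasurable
  have hω₁m := hω₁.weight.aemeasurable
  have hω₂m := hω₂.weight.aemeasurable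
  have hum : AEMeasurable u := AEMeasurable.congr (by fun_prop) (EventuallyEq.symm hu)
  have hvqm : AEMeasurable (fun x => v x ^ q) :=
    AEMeasurable.congr (by fun_prop) (EventuallyEq.symm hv)
  have hvm : AEMeasurable v := by
    have := hvqm.pow_const (1 / q)
    simpa only [← ENNReal.rpow_mul, mul_one_div_cancel hq.ne', ENNReal.rpow_one] using this
  have hWm : AEMeasurable W := hum.mul hvqm
  have hWeq : ∀ᵐ x, W x = u₀ x * ω₁ x ^ (-a) * (v₀ x * ω₂ x ^ (-b)) := by
    filter_upwards [hu, hv] with x h1 h2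
    simp only [hWdef]
    rw [h1, h2]
  have hune : ∀ᵐ x, u x ≠ 0 ∧ u x ≠ ∞ := by
    filter_upwards [hu, hu₀.weight.ae_ne, hω₁.weight.ae_ne] with x h h1 h2
    rw [h]
    exact mul_ne_zero_top h1 (rpow_ne_zero_top h2 _)
  have hvne : ∀ᵐ x, v x ≠ 0 ∧ v x ≠ ∞ := by
    filter_upwards [hv, hv₀.weight.ae_ne, hω₂.weight.ae_ne] with x h h1 h2
    have h3 := mul_ne_zero_top h1 (rpow_ne_zero_top h2 (-b))
    rw [← h] at h3
    refine ⟨fun h0 => h3.1 ?_, fun h0 => h3.2 ?_⟩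
    · rw [h0, ENNReal.zero_rpow_of_pos hq]
    · rw [h0, ENNReal.top_rpow_of_pos hq]
  have hWtop : ∀ᵐ x, W x ≠ ∞ := by
    filter_upwards [hune, hvne] with x h1 h2
    exact (mul_ne_zero_top h1 (rpow_ne_zero_top h2 q)).2
  set g₁ : (Fin n → ℝ) → ℝ≥0∞ := fun x => f.1 x * (v x)⁻¹ with hg₁
  set g₂ : (Fin n → ℝ) → ℝ≥0∞ := fun x => f.2 x * (v x)⁻¹ with hg₂
  have hg₁m : AEMeasurable g₁ := hf1.mul hvm.inv
  have hg₂m : AEMeasurable g₂ := hf2.mul hvm.inv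
  have hω := hω₁.rpow_mul_rpow_of_lt hω₂ (a := a / A) (b := b * ε / A) (by positivity) haA
    (by positivity) (by rw [← add_div, div_le_one hA0]; nlinarith)
  by_cases hNtop : weakNorm q W g₂ = ∞
  · rw [hNtop, ENNReal.mul_top (by positivity)]
    exact le_top
  -- The estimate for subsets of the level set of finite `W`-measure, as finiteness is needed to
  -- divide by a power of `m`. The number `δ` makes `N` positive.
  have hset : ∀ (t : ℝ≥0), 0 < t → ∀ E : Set (Fin n → ℝ), NullMeasurableSet E →
      E ⊆ {x | (t : ℝ≥0∞) < g₁ x} → ∫⁻ x in E, W x ≠ ∞ → ∀ δ : ℝ, 0 < δ →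
      (t : ℝ≥0∞) * (∫⁻ x in E, W x) ^ (1 / q) ≤
        ((C₁ * C₂) ^ (1 / r) + 1 : ℝ≥0) * (weakNorm q W g₂ + ENNReal.ofReal δ) := by
    intro t ht E hE hEt hEtop δ hδ
    set m := ∫⁻ x in E, W x with hm
    set N := weakNorm q W g₂ + ENNReal.ofReal δ with hN
    have hNne : N ≠ 0 ∧ N ≠ ∞ := by
      refine ⟨fun h0 => ?_, by finiteness⟩
      rw [hN, add_eq_zero, ENNReal.ofReal_eq_zero] at h0
      linarith [h0.2]
    by_cases hm0 : m = 0
    · rw [hm0, ENNReal.zero_rpow_of_pos (by positivity), mul_zero]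
      exact zero_le
    obtain ⟨H, hHm, hHE, hH2, hHpos, hHP, hHA⟩ :=
      hmaj u₀ v₀ ω₁ ω₂ W hu₀ hv₀ hω₁ hω₂ hWeq E hE hm0
    have hAp := (hK₂ _ _ hHA hv₀).ap hω hA0
    -- Since `v^(-r) v^q = (v^q)^ε`, only the power `ε` of `v₀` survives; the `A_1` part and the
    -- negative powers then combine to a weight in `A_{1+A}`.
    have hAeq : ∀ᵐ x, H x * u₀ x * v₀ x ^ ε * (ω₁ x ^ (a / A) * ω₂ x ^ (b * ε / A)) ^ (-A) =
        H x * (((v x)⁻¹) ^ r * W x) := by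
      filter_upwards [hu, hv, hvne, hu₀.weight.ae_ne, hv₀.weight.ae_ne, hω₁.weight.ae_ne,
        hω₂.weight.ae_ne] with x h1 h2 h3 h4 h5 h6 h7
      obtain ⟨t4, e4⟩ := exists_eq_eexp h4.1 h4.2
      obtain ⟨t5, e5⟩ := exists_eq_eexp h5.1 h5.2
      obtain ⟨t6, e6⟩ := exists_eq_eexp h6.1 h6.2
      obtain ⟨t7, e7⟩ := exists_eq_eexp h7.1 h7.2
      have hvx : (v x)⁻¹ ^ r = (v x ^ q) ^ (-(1 - ε)) := by
        rw [ENNReal.inv_rpow, ← ENNReal.rpow_neg, ← ENNReal.rpow_mul, hr]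
        congr 1
        ring
      simp only [hWdef]
      rw [hvx, h1, h2, mul_assoc (H x), mul_assoc (H x)]
      simp only [e4, e5, e6, e7, eexp_rpow, eexp_mul]
      congr 2
      field_simp
      ring
    have hdomr := hC₁ _ (hAp.congr hAeq) f hf
    have hmul' : ∀ (y : ℝ≥0∞) (x : Fin n → ℝ), y ^ r * (H x * (((v x)⁻¹) ^ r * W x)) =
        (y * (v x)⁻¹) ^ r * (H x * W x) := fun y x => by
      rw [ENNReal.mul_rpow_of_nonneg _ _ hr0.le]
      ring
    simp_rw [hmul'] at hdomr
    have hleft : (t : ℝ≥0∞) ^ r * m ≤ ∫⁻ x, g₁ x ^ r * (H x * W x) := by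
      rw [hm, ← lintegral_const_mul' _ _ (by finiteness)]
      refine le_trans ?_ (setLIntegral_le_lintegral E _)
      refine lintegral_mono_ae ?_
      filter_upwards [ae_restrict_mem₀ hE] with x hx
      refine mul_le_mul' (ENNReal.rpow_le_rpow (le_of_lt (hEt hx)) hr0.le) ?_
      exact le_mul_of_one_le_left zero_le (hHE x hx)
    have hright := lintegral_rpow_mul_le_of_weak hP hr0 hrP hrq hWm hHm hg₂m hH2 ⟨hm0, hEtop⟩ hNne
      hHP fun t ht => setLIntegral_le_of_weakNorm_le hq (le_self_add (a := weakNorm q W g₂)) ht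
    have hall : (t : ℝ≥0∞) ^ r * m ≤ (C₁ * C₂ : ℝ≥0) * (N ^ r * m ^ (1 - r / q)) := by
      refine hleft.trans (hdomr.trans ((mul_le_mul_right hright _).trans (le_of_eq ?_)))
      rw [ENNReal.coe_mul, mul_assoc]
      rfl
    have hmp := rpow_ne_zero_top ⟨hm0, hEtop⟩ (1 - r / q)
    have hall2 : (t : ℝ≥0∞) ^ r * m ^ (r / q) ≤ (C₁ * C₂ : ℝ≥0) * N ^ r := by
      rw [← ENNReal.mul_le_mul_iff_left hmp.1 hmp.2, mul_assoc, mul_assoc,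
        ← ENNReal.rpow_add _ _ hm0 hEtop, show r / q + (1 - r / q) = 1 by ring, ENNReal.rpow_one]
      exact hall
    have hall3 := ENNReal.rpow_le_rpow hall2 (by positivity : 0 ≤ 1 / r)
    rw [ENNReal.mul_rpow_of_nonneg _ _ (by positivity), ENNReal.mul_rpow_of_nonneg _ _
      (by positivity), ← ENNReal.rpow_mul, ← ENNReal.rpow_mul, ← ENNReal.rpow_mul,
      mul_one_div_cancel hr0.ne', ENNReal.rpow_one, ENNReal.rpow_one, ← coe_rpow (by positivity),
      show r / q * (1 / r) = 1 / q by field_simp] at hall3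
    refine hall3.trans ?_
    gcongr
    simp
  refine iSup_le fun t => iSup_le fun ht => ?_
  set G : Set (Fin n → ℝ) := {x | (t : ℝ≥0∞) < g₁ x} with hG
  have hGm : NullMeasurableSet G := nullMeasurableSet_lt aemeasurable_const hg₁m
  set ρ := volume.withDensity W with hρ
  -- The density `W` is finite almost everywhere, though perhaps not locally integrable; the level
  -- set is therefore exhausted by sets of finite `W`-measure from σ-finiteness.
  have hρσ : SigmaFinite ρ := SigmaFinite.withDensity_of_ne_top hWtop
  refine le_of_forall_add_ofReal_le (Φ := fun y => ((C₁ * C₂) ^ (1 / r) + 1 : ℝ≥0) * y)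
    (ENNReal.continuous_const_mul (by finiteness)) fun δ hδ => ?_
  have hsets : ∀ i, NullMeasurableSet (G ∩ spanningSets ρ i) := fun i =>
    hGm.inter (measurableSet_spanningSets ρ i).nullMeasurableSet
  have hbound : ∀ i, (t : ℝ≥0∞) * (ρ.restrict (spanningSets ρ i) G) ^ (1 / q) ≤
      ((C₁ * C₂) ^ (1 / r) + 1 : ℝ≥0) * (weakNorm q W g₂ + ENNReal.ofReal δ) := by
    intro i
    have e : ρ (G ∩ spanningSets ρ i) = ∫⁻ x in G ∩ spanningSets ρ i, W x :=
      withDensity_apply₀ _ (hsets i)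
    rw [Measure.restrict_apply' (measurableSet_spanningSets ρ i), e]
    refine hset t ht _ (hsets i) inter_subset_left ?_ δ hδ
    rw [← e]
    exact ((measure_mono inter_subset_right).trans_lt (measure_spanningSets_lt_top ρ i)).ne
  have hGe : ∫⁻ x in G, W x = ⨆ i, ρ.restrict (spanningSets ρ i) G := by
    rw [Measure.iSup_restrict_spanningSets]
    exact (withDensity_apply₀ _ hGm).symm
  rw [hGe]
  have hmono : Monotone fun i => ρ.restrict (spanningSets ρ i) G := fun i j hij =>
    Measure.restrict_mono (monotone_spanningSets ρ hij) le_rfl G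
  refine le_of_tendsto' (ENNReal.Tendsto.const_mul
    ((ENNReal.continuous_rpow_const.tendsto _).comp (tendsto_atTop_iSup hmono))
    (Or.inr ENNReal.coe_ne_top)) hbound

end Muckenhoupt

/-! ### Powers of maximal functions as powers of `A_1` weights -/

namespace Muckenhoupt
open Metric Filter Set
open scoped Topology

variable {n : ℕ}

/-- The maximal function of a locally integrable function vanishes identically, is identically
infinite, or its square root is an `A_1` weight with a constant that depends on `n` only. -/
theorem maximalReal_trichotomy {h : (Fin n → ℝ) → ℝ} (hh : LocallyIntegrable h volume) :
    (∀ x, maximalReal h x = 0) ∨ (∀ x, maximalReal h x = ∞) ∨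
      A1 (1 + 15 ^ n + 3 ^ n) (fun x => maximalReal h x ^ (1 / 2 : ℝ)) := by
  have hm : AEMeasurable (fun y => ‖h y‖ₑ) := hh.aestronglyMeasurable.enorm
  by_cases h0 : (fun y => ‖h y‖ₑ) =ᵐ[volume] 0
  · left
    intro x
    rw [maximalReal, maximal_eq_mmax, mmax_congr h0]
    refine le_zero_iff.1 (mmax_le fun c r hr hx => ?_)
    simp [mavg]
  have hne : ∀ x, maximalReal h x ≠ 0 := mmax_ne_zero (fun c r => measure_closedBall_lt_top) hm h0
  by_cases htop : ∀ x, maximalReal h x = ∞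
  · exact Or.inr (Or.inl htop)
  right
  right
  push Not at htop
  obtain ⟨x₀, hx₀⟩ := htop
  have hMm : Measurable (maximalReal h) := measurable_maximal
  have hM := maximal_sqrt_maximal_le (fun y => ‖h y‖ₑ)
  -- By the Coifman-Rochberg bound, finiteness at the single point `x₀` controls the average of the
  -- square root over every cube centred at `x₀`.
  have hfin : ∀ᵐ x, maximalReal h x ^ (1 / 2 : ℝ) < ∞ := by
    have hball : ∀ N : ℕ, ∀ᵐ x ∂(volume.restrict (closedBall x₀ (N + 1))),
        maximalReal h x ^ (1 / 2 : ℝ) < ∞ := by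
      intro N
      have hN : (0 : ℝ) < N + 1 := by positivity
      refine ae_lt_top (hMm.pow_const _) ?_
      rw [setLIntegral_eq_mul_avg _ _ hN]
      refine ENNReal.mul_ne_top measure_closedBall_lt_top.ne (ne_top_of_le_ne_top ?_
        ((avg_le_maximal hN (mem_closedBall_self hN.le)).trans (hM x₀)))
      exact ENNReal.mul_ne_top (by finiteness)
        (ENNReal.rpow_ne_top_of_nonneg (by norm_num) hx₀)
    have := ae_all_iff.2 fun N => (ae_restrict_iff' measurableSet_closedBall).1 (hball N)
    filter_upwards [this] with x hx
    obtain ⟨N, hN⟩ := exists_nat_ge (dist x x₀)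
    exact hx N (mem_closedBall.2 (by linarith))
  refine A1.of_maximal_le (hMm.pow_const _).aemeasurable ?_ (Eventually.of_forall fun x => ?_)
  · filter_upwards [hfin] with x hx
    refine ⟨fun h1 => ?_, hx.ne⟩
    rw [ENNReal.rpow_eq_zero_iff_of_pos (by norm_num)] at h1
    exact hne x h1
  · refine (hM x).trans (le_of_eq ?_)
    push_cast
    rfl

/-- A power of a maximal function that is almost everywhere positive and finite is a power of an
`A_1` weight. -/
theorem exists_A1_maximalReal_rpow_eq {h : (Fin n → ℝ) → ℝ} (hh : LocallyIntegrable h volume)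
    {e : ℝ} (hne : ∀ᵐ x, maximalReal h x ^ e ≠ 0 ∧ maximalReal h x ^ e ≠ ∞) :
    ∃ ω : (Fin n → ℝ) → ℝ≥0∞, A1 (1 + 15 ^ n + 3 ^ n) ω ∧
      ∀ x, maximalReal h x ^ e = ω x ^ (2 * e) := by
  rcases eq_or_ne e 0 with rfl | he
  · exact ⟨fun _ => 1, A1.one.mono (by rw [add_assoc]; exact le_self_add), fun x => by simp⟩
  obtain ⟨x, hx⟩ := hne.exists
  rcases maximalReal_trichotomy hh with h0 | h1 | hA
  · rw [h0 x] at hx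
    rcases he.lt_or_gt with he | he
    · exact absurd (ENNReal.zero_rpow_of_neg he) hx.2
    · exact absurd (ENNReal.zero_rpow_of_pos he) hx.1
  · rw [h1 x] at hx
    rcases he.lt_or_gt with he | he
    · exact absurd (ENNReal.top_rpow_of_neg he) hx.1
    · exact absurd (ENNReal.top_rpow_of_pos he) hx.2
  · refine ⟨_, hA, fun x => ?_⟩
    rw [← ENNReal.rpow_mul]
    congr 1
    ring

/-- The two maximal functions merge: the geometric mean of their square roots with exponents `β` and
`1 - β` is in `A_1` with the same dimensional constant. -/
theorem HatFactor.exists_A1 {q : ℝ} {w u₀ : (Fin n → ℝ) → ℝ≥0∞} (hw : IsWeight w)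
    (h : HatFactor q w u₀) : ∃ ω : (Fin n → ℝ) → ℝ≥0∞, A1 (1 + 15 ^ n + 3 ^ n) ω ∧
      ∀ᵐ x, w x = u₀ x * ω x ^ (-(2 * (q - 1))) := by
  obtain ⟨β, h₁, h₂, hβ0, hβ1, hh₁, hh₂, heq⟩ := h
  -- As `0 * ∞ = 0`, a nonzero product has nonzero factors, and then finiteness of the product
  -- excludes infinite factors. A maximal function that is identically `0` or `∞` can therefore
  -- occur only with exponent zero.
  have hfac : ∀ᵐ x, (maximalReal h₁ x ^ (β * (1 - q)) ≠ 0 ∧ maximalReal h₁ x ^ (β * (1 - q)) ≠ ∞) ∧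
      (maximalReal h₂ x ^ ((1 - β) * (1 - q)) ≠ 0 ∧ maximalReal h₂ x ^ ((1 - β) * (1 - q)) ≠ ∞) := by
    filter_upwards [hw.ae_ne, heq] with x hx he
    rw [he, mul_ne_zero_iff, mul_ne_zero_iff] at hx
    obtain ⟨⟨⟨ha, hb⟩, hc⟩, ht⟩ := hx
    refine ⟨⟨hb, fun hbt => ht ?_⟩, ⟨hc, fun hct => ht ?_⟩⟩
    · rw [hbt, ENNReal.mul_top ha, ENNReal.top_mul hc]
    · rw [hct, ENNReal.mul_top (mul_ne_zero ha hb)]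
  obtain ⟨ω₁, hω₁, he₁⟩ := exists_A1_maximalReal_rpow_eq hh₁ (hfac.mono fun _ h => h.1)
  obtain ⟨ω₂, hω₂, he₂⟩ := exists_A1_maximalReal_rpow_eq hh₂ (hfac.mono fun _ h => h.2)
  have hA := hω₁.rpow_mul_rpow hω₂ hβ0 (sub_nonneg.2 hβ1) (add_sub_cancel _ _)
  rw [← NNReal.rpow_add_of_nonneg _ hβ0 (sub_nonneg.2 hβ1), add_sub_cancel, NNReal.rpow_one] at hA
  refine ⟨_, hA, ?_⟩
  filter_upwards [heq, hω₁.weight.ae_ne, hω₂.weight.ae_ne] with x hx h1 h2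
  rw [hx, he₁, he₂, mul_assoc]
  obtain ⟨t1, e1⟩ := exists_eq_eexp h1.1 h1.2
  obtain ⟨t2, e2⟩ := exists_eq_eexp h2.1 h2.2
  simp only [e1, e2, eexp_rpow, eexp_mul]
  congr 2
  ring

theorem A1.of_a1Const_lt {u : (Fin n → ℝ) → ℝ≥0∞} (hu : IsWeight u) {K : ℝ≥0}
    (h : a1Const u < K) : A1 K u := by
  obtain ⟨C, hC, hCK⟩ := sInf_lt_iff.1 h
  refine ⟨hu, ?_⟩
  filter_upwards [hC] with x hx
  exact hx.trans (mul_le_mul_left hCK.le _)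

/-- The infimum need not be attained; adding one leaves room for an actual factorization. -/
theorem IsHatA2.exists_a1Const_lt {q : ℝ} (hq : 0 < q) {w : (Fin n → ℝ) → ℝ≥0∞}
    (hw : IsHatA2 q w) : ∃ u₀ : (Fin n → ℝ) → ℝ≥0∞, HatFactor q w u₀ ∧ IsWeight u₀ ∧
      a1Const u₀ < (((hatA2Const q w).toNNReal + 1) ^ q : ℝ≥0) := by
  obtain ⟨-, u₁, hu₁, hfac₁⟩ := hw
  have hfin : hatA2Const q w ≠ ∞ := by
    refine ne_top_of_le_ne_top ?_ (iInf_le_of_le u₁ (iInf_le_of_le hu₁ (iInf_le _ hfac₁)))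
    exact ENNReal.rpow_ne_top_of_nonneg (by positivity) hu₁.2.ne
  have hlt : hatA2Const q w < hatA2Const q w + 1 := ENNReal.lt_add_right hfin one_ne_zero
  obtain ⟨u₀, h⟩ := iInf_lt_iff.1 hlt
  obtain ⟨hu₀, h⟩ := iInf_lt_iff.1 h
  obtain ⟨hfac, h⟩ := iInf_lt_iff.1 h
  refine ⟨u₀, hfac, hu₀.1, ?_⟩
  have := ENNReal.rpow_lt_rpow h hq
  rw [← ENNReal.rpow_mul, one_div_mul_cancel hq.ne', ENNReal.rpow_one] at this
  rw [coe_rpow hq.le, ENNReal.coe_add, ENNReal.coe_toNNReal hfin]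
  exact this

end Muckenhoupt

/-! ### Proof of the two statements -/

theorem theorem1p4 {n : ℕ} (hn : 0 < n)
    (F : Set (((Fin n → ℝ) → ℝ≥0∞) × ((Fin n → ℝ) → ℝ≥0∞)))
    (hF : ∀ f ∈ F, AEMeasurable f.1 volume ∧ AEMeasurable f.2 volume)
    (p₀ : ℝ) (hp₀ : 0 < p₀) (φ : ℝ≥0 → ℝ≥0) (hφ : Monotone φ)
    (hyp : ∀ w : (Fin n → ℝ) → ℝ≥0∞, IsAInfty w → ∀ f ∈ F,
      ∫⁻ x, f.1 x ^ p₀ * w x < ∞ →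
      ∫⁻ x, f.1 x ^ p₀ * w x ≤ φ (aInftyConst w).toNNReal * ∫⁻ x, f.2 x ^ p₀ * w x)
    (q : ℝ) (hq : 1 ≤ q) :
    (∀ u v : (Fin n → ℝ) → ℝ≥0∞, IsAInfty u → IsAInfty (fun x => v x ^ q) →
      ∃ C : ℝ≥0, ∀ f ∈ F,
        (∃ w₀ : (Fin n → ℝ) → ℝ≥0∞, IsAInfty w₀ ∧ ∫⁻ x, f.1 x ^ p₀ * w₀ x < ∞) →
        weakNorm q (fun x => u x * v x ^ q) (fun x => f.1 x * (v x)⁻¹) ≤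
          C * weakNorm q (fun x => u x * v x ^ q) (fun x => f.2 x * (v x)⁻¹)) ∧
    (∀ α : ℝ, 0 < α → ∃ ψ : ℝ≥0 → ℝ≥0, Monotone ψ ∧
      ∀ (u : (Fin n → ℝ) → ℝ≥0∞) (h : (Fin n → ℝ) → ℝ) (v : (Fin n → ℝ) → ℝ≥0∞),
        IsHatA2 q u → LocallyIntegrable h volume → (∀ x, v x = maximalReal h x ^ (-α)) →
        ∀ f ∈ F,
        (∃ w₀ : (Fin n → ℝ) → ℝ≥0∞, IsAInfty w₀ ∧ ∫⁻ x, f.1 x ^ p₀ * w₀ x < ∞) →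
        weakNorm q (fun x => u x * v x ^ q) (fun x => f.1 x * (v x)⁻¹) ≤
          ψ (hatA2Const q u).toNNReal *
            weakNorm q (fun x => u x * v x ^ q) (fun x => f.2 x * (v x)⁻¹)) := by
  have hq0 : 0 < q := by linarith
  have hF' : ∀ f ∈ {f ∈ F | ∃ w₀ : (Fin n → ℝ) → ℝ≥0∞, IsAInfty w₀ ∧
      ∫⁻ x, f.1 x ^ p₀ * w₀ x < ∞}, AEMeasurable f.1 volume ∧ AEMeasurable f.2 volume :=
    fun f hf => hF f hf.1
  have hdom := fun (r : ℝ) (hr : 0 < r) =>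
    (dominated_of_aInfty hF hφ hyp).of_pos hF' hp₀ hr
  refine ⟨fun u v hu hv => ?_, fun α hα => ?_⟩
  · obtain ⟨s, hs, hs2, K₁, hK₁⟩ := hu.exists_ap 2
    obtain ⟨t, ht, ht2, K₂, hK₂⟩ := hv.exists_ap 2
    obtain ⟨L₁, u₀, ω₁, hu₀, hω₁, hueq⟩ := hK₁.exists_factorization hs2
    obtain ⟨L₂, v₀, ω₂, hv₀, hω₂, hveq⟩ := hK₂.exists_factorization ht2
    obtain ⟨C, hC⟩ := exists_weakNorm_le hn hF' hdom hq0 (a := s - 1) (b := t - 1) (by linarith)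
      (by linarith) (max L₁ L₂)
    exact ⟨C, fun f hf hw => hC u₀ v₀ ω₁ ω₂ u v (hu₀.mono (le_max_left _ _))
      (hv₀.mono (le_max_right _ _)) (hω₁.mono (le_max_left _ _)) (hω₂.mono (le_max_right _ _))
      hueq hveq f ⟨hf, hw⟩⟩
  · choose C hC using fun k : ℕ => exists_weakNorm_le hn hF' hdom hq0 (a := 2 * (q - 1))
      (b := 2 * (α * q)) (by linarith) (by positivity) (k + (1 + 15 ^ n + 3 ^ n))
    -- The constants `C k` are chosen independently for integer `A_1` bounds, with no monotonicity;
    -- summing up to the relevant integer gives an increasing function that dominates the constant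
    -- needed.
    refine ⟨fun t => ∑ k ∈ Finset.range (⌈(t + 1) ^ q⌉₊ + 1), C k, fun s t hst => ?_, ?_⟩
    · refine Finset.sum_le_sum_of_subset (Finset.range_mono ?_)
      gcongr
    intro u h v hu hh hv f hf hw
    obtain ⟨u₀, hfac, hu₀, hlt⟩ := hu.exists_a1Const_lt hq0
    set t := (hatA2Const q u).toNNReal
    obtain ⟨ω₁, hω₁, hueq⟩ := hfac.exists_A1 hu.1
    -- If `M h = 0` then `v⁻¹ = 0`, and if `M h = ∞` then `v ^ q = 0`; in both cases the weak norms
    -- vanish. Otherwise `v ^ q` is the power `-2 α q` of the `A_1` weight `(M h)^(1/2)`, with `v₀ =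
    -- 1`.
    rcases maximalReal_trichotomy hh with h0 | h1 | hA
    · have hv' : ∀ x, (v x)⁻¹ = 0 := fun x => by
        rw [hv, h0, ENNReal.zero_rpow_of_neg (by linarith), ENNReal.inv_top]
      simp [weakNorm, hv', hq0]
    · have hv' : ∀ x, v x ^ q = 0 := fun x => by
        rw [hv, h1, ENNReal.top_rpow_of_neg (by linarith), ENNReal.zero_rpow_of_pos hq0]
      simp [weakNorm, hv', hq0]
    · have hk : (t + 1) ^ q ≤ (⌈(t + 1) ^ q⌉₊ : ℝ≥0) + (1 + 15 ^ n + 3 ^ n) :=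
        (Nat.le_ceil _).trans le_self_add
      refine (hC ⌈(t + 1) ^ q⌉₊ u₀ (fun _ => 1) ω₁ _ u v
        (A1.of_a1Const_lt hu₀ (hlt.trans_le (by exact_mod_cast hk)))
        (A1.one.mono ?_) (hω₁.mono le_add_self) (hA.mono le_add_self) hueq
        (Filter.Eventually.of_forall fun x => ?_) f ⟨hf, hw⟩).trans ?_
      · rw [← add_assoc, ← add_assoc, add_comm _ (1 : ℝ≥0), add_assoc, add_assoc]
        exact le_self_add
      · rw [hv, one_mul, ← ENNReal.rpow_mul, ← ENNReal.rpow_mul]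
        congr 1
        ring
      · gcongr
        exact_mod_cast Finset.single_le_sum (f := C) (fun _ _ => zero_le)
          (Finset.self_mem_range_succ _)
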